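/- **Setup.** Alice and Bob are connected by two independent discrete memoryless broadcast channels (DMBCs) with finite alphabets: a forward DMBC $X_f\to(Y_f,Z_f)$ from Alice to Bob and a backward DMBC $X_b\to(Y_b,Z_b)$ from Bob to Alice; Eve receives $Z_f$ and $Z_b$. Entropies are in bits. **Rates.** Let $V_f,W_{1,b},W_{2,b}$ range over random variables with finite alphabets such that $V_f\leftrightarrow Y_f\leftrightarrow (X_f,Z_f)$ and $W_{2,b}\leftrightarrow W_{1,b}\leftrightarrow X_b\leftrightarrow (Y_b,Z_b)$ are Markov chains and the two groups are independent, and put $$R^A_{s1}=I(V_f;X_f)-I(V_f;Z_f),\qquad R^A_{s2}=I(W_{1,b};Y_b|W_{2,b})-I(W_{1,b};Z_b|W_{2,b}).$$ Call a choice of $P_{X_f,V_f}$, $P_{X_b,W_{2,b},W_{1,b}}$ and of integers $n_f,n_b\ge 0$ feasible if $n_f I(V_f;Y_f|X_f)<n_b I(W_{1,b};Y_b)$, and let $$L_A=\sup\frac{n_fR^A_{s1}+n_b\max\{0,R^A_{s2}\}}{n_f+n_b},\qquad R^{ICC}_A=\sup\frac{n_fR^A_{s1}+n_bR^A_{s2}}{n_f+n_b}$$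 over all feasible choices (a supremum over the empty set is $0$). $L_B$ and $R^{ICC}_B$ are defined in the same way with the roles of the forward and the backward DMBC exchanged. **Secrecy potential.** The backward DMBC has secrecy potential if merely realizing a noiseless channel from it is not optimal: the values $\frac{n_fR^A_{s1}+n_b\max\{0,R^A_{s2}\}}{n_f+n_b}$ of the feasible choices with $R^A_{s2}<0$ are bounded above by some number smaller than $L_A$. The forward DMBC has secrecy potential if the same holds with the roles of the two DMBCs exchanged. **ICC protocol.** In an instance of the Interactive Channel Coding (ICC) protocol initiated by Alice, one fixes random variables as above, $\epsilon>0$, lengths $n_f$ and $n_b=n_{b,1}+n_{b,2}$, a codebook $\mathcal C_V$ of $\epsilon$-typical $V_f$-sequences of length $n_f$, a codebook $\mathcal C_W$ of $\epsilon$-typical $W_{1,b}$-sequences of length $n_{b,1}$, a deterministic systematic encoder that appends to $(v,w)\in\mathcal C_V\times\mathcal C_W$ a parity-check sequence of $n_{b,2}$ symbols of the alphabet of $W_{1,b}$, and a function $g$ that partitions $\mathcal C_V\times\mathcal C_W$ into parts of equal size. Alice sends an i.i.d. sequence $X_f^{n_f}$. Bob picks a $V\in\mathcal C_V$ that is $\epsilon$-jointly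 typical with $Y_f^{n_f}$ (NULL if there is none), draws $W\in\mathcal C_W$ uniformly, passes $W$ followed by the parity-check sequence of $(V,W)$ through the memoryless channel $P_{X_b|W_{1,b}}$, and sends the result over the backward DMBC. Alice decodes $(V,W)$ as the unique pair in $\mathcal C_V\times\mathcal C_W$ whose codeword is $\epsilon$-bipartite jointly typical with $(X_f^{n_f},Y_b^{n_b})$ with respect to $(P_{V_f,X_f},P_{W_{1,b},Y_b})$ (NULL if there is no unique pair). Bob's key is $S=g(V,W)$, and $\hat S$ is $g$ of Alice's decoded pair. Bob-initiated instances are defined by exchanging the roles. A rate $R$ is achieved by ICC if for every $\delta>0$ there is an instance (initiated by Alice or by Bob, with $\epsilon<\delta$) such that $$\frac{H(S)}{n_f+n_b}>R-\delta,\qquad \Pr(\hat S\ne S)<\delta,\qquad \frac{H(S\mid Z_f^{n_f},Z_b^{n_b})}{H(S)}>1-\delta,$$ where a NULL counts as an error and the last condition is void for a constant key. **Corollary.** If both DMBCs have secrecy potential, then $R^{ICC}_A=L_A$ and $R^{ICC}_B=L_B$, and the ICC protocol achieves the secret-key rate $\max\{L_A,L_B\}$. -/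

import Mathlib

open Finset

noncomputable section

namespace SKE

/-! Finite probability: laws are real mass functions, entropies are in bits. -/

section Information

variable {Ω α β γ : Type*}

open Classical in
/-- The law of the random variable `f` under the mass function `P`. -/
def law [Fintype Ω] (P : Ω → ℝ) (f : Ω → α) : α → ℝ :=
  fun a => ∑ ω with f ω = a, P ω

open Classical in
/-- The probability of the event `E` under the mass function `P`. -/
def prob [Fintype Ω] (P : Ω → ℝ) (E : Ω → Prop) : ℝ :=
  ∑ ω with E ω, P ω

/-- Shannon entropy (in bits) of a mass function. -/
def entropy [Fintype α] (p : α → ℝ) : ℝ :=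
  ∑ a, -(p a * Real.logb 2 (p a))

variable [Fintype Ω] [Fintype α] [Fintype β] [Fintype γ]

/-- `H(A)`. -/
def ent (P : Ω → ℝ) (A : Ω → α) : ℝ := entropy (law P A)

/-- `H(A | B) = H(A, B) - H(B)`. -/
def condEnt (P : Ω → ℝ) (A : Ω → α) (B : Ω → β) : ℝ :=
  ent P (fun ω => (A ω, B ω)) - ent P B

/-- `I(A ; B) = H(A) - H(A | B)`. -/
def mutInfo (P : Ω → ℝ) (A : Ω → α) (B : Ω → β) : ℝ :=
  ent P A - condEnt P A B

/-- `I(A ; B | C) = H(A | C) - H(A | B, C)`. -/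
def condMutInfo (P : Ω → ℝ) (A : Ω → α) (B : Ω → β) (C : Ω → γ) : ℝ :=
  condEnt P A C - condEnt P A (fun ω => (B ω, C ω))

end Information

/-! Typical sequences. -/

section Typicality

variable {α α' β β' : Type*}

/-- The probability of the sequence `u` when its entries are i.i.d. with mass function `p`. -/
def seqProb {n : ℕ} (p : α → ℝ) (u : Fin n → α) : ℝ := ∏ i, p (u i)

/-- `P` is positive and `|-(1/N) log P - h/N| < ε`. -/
def NearEntropy (ε : ℝ) (N : ℕ) (P h : ℝ) : Prop :=
  0 < P ∧ |-(1 / (N : ℝ)) * Real.logb 2 P - h / (N : ℝ)| < ε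

/-- `u` is an `ε`-typical sequence with respect to `p`. -/
def Typical [Fintype α] (ε : ℝ) (p : α → ℝ) {n : ℕ} (u : Fin n → α) : Prop :=
  NearEntropy ε n (seqProb p u) (n * entropy p)

/-- `(u, u')` is an `ε`-jointly typical pair with respect to `p`. -/
def JointlyTypical [Fintype α] [Fintype α'] (ε : ℝ) (p : α × α' → ℝ) {n : ℕ}
    (u : Fin n → α) (u' : Fin n → α') : Prop :=
  Typical ε (law p Prod.fst) u ∧ Typical ε (law p Prod.snd) u' ∧
    Typical ε p (fun i => (u i, u' i))

/-- `(u ‖ t)` is an `(ε, n)`-bipartite typical sequence with respect to `(p, q)`. -/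
def BipTypical [Fintype α] [Fintype β] (ε : ℝ) (p : α → ℝ) (q : β → ℝ) {n d : ℕ}
    (u : Fin n → α) (t : Fin d → β) : Prop :=
  NearEntropy ε (n + d) (seqProb p u * seqProb q t) (n * entropy p + d * entropy q)

/-- `((u ‖ t), (u' ‖ t'))` is an `(ε, n)`-bipartite jointly typical pair of sequences with
respect to `(p, q)`. -/
def BipJointlyTypical [Fintype α] [Fintype α'] [Fintype β] [Fintype β'] (ε : ℝ)
    (p : α × α' → ℝ) (q : β × β' → ℝ) {n d : ℕ}
    (u : Fin n → α) (t : Fin d → β) (u' : Fin n → α') (t' : Fin d → β') : Prop :=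
  BipTypical ε (law p Prod.fst) (law q Prod.fst) u t ∧
  BipTypical ε (law p Prod.snd) (law q Prod.snd) u' t' ∧
  BipTypical ε p q (fun i => (u i, u' i)) (fun i => (t i, t' i))

end Typicality

/-- A discrete memoryless broadcast channel `X → (Y, Z)`, given by `P_{YZ|X}`; `Y` is the output
of the legitimate receiver and `Z` that of the eavesdropper. -/
abbrev DMBC (X Y Z : Type*) [Fintype Y] [Fintype Z] : Type _ := X → stdSimplex ℝ (Y × Z)

/-- A choice of the random variables `V ↔ Y₁ ↔ (X₁, Z₁)` on the channel `X₁ → (Y₁, Z₁)` of the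
initiator and `W₂ ↔ W₁ ↔ X₂ ↔ (Y₂, Z₂)` on the channel `X₂ → (Y₂, Z₂)` of the responder.
The Markov chains hold because the joint laws are built from the conditional ones below. -/
structure Selection (X₁ Y₁ X₂ : Type*) [Fintype X₁] [Fintype X₂] where
  /-- the size of the alphabet of `V` -/
  v : ℕ
  /-- the size of the alphabet of `W₁` -/
  w₁ : ℕ
  /-- the size of the alphabet of `W₂` -/
  w₂ : ℕ
  /-- `P_{X₁}` -/
  pX : stdSimplex ℝ X₁
  /-- `P_{V|Y₁}` -/
  pV : Y₁ → stdSimplex ℝ (Fin v)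
  /-- `P_{W₂,W₁}` -/
  pW : stdSimplex ℝ (Fin w₂ × Fin w₁)
  /-- `P_{X₂|W₁}` -/
  pXW : Fin w₁ → stdSimplex ℝ X₂

section Bounds

variable {X₁ Y₁ Z₁ X₂ Y₂ Z₂ : Type*} [Fintype X₁] [Fintype Y₁] [Fintype Z₁]
  [Fintype X₂] [Fintype Y₂] [Fintype Z₂]

namespace Selection

/-- The joint law of `(V, X₁, Y₁, Z₁)`. -/
def law₁ (s : Selection X₁ Y₁ X₂) (C₁ : DMBC X₁ Y₁ Z₁) : Fin s.v × X₁ × Y₁ × Z₁ → ℝ :=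
  fun (v, x, y, z) => s.pX.1 x * (C₁ x).1 (y, z) * (s.pV y).1 v

/-- The joint law of `(W₂, W₁, X₂, Y₂, Z₂)`. -/
def law₂ (s : Selection X₁ Y₁ X₂) (C₂ : DMBC X₂ Y₂ Z₂) :
    Fin s.w₂ × Fin s.w₁ × X₂ × Y₂ × Z₂ → ℝ :=
  fun (w₂, w₁, x, y, z) => s.pW.1 (w₂, w₁) * (s.pXW w₁).1 x * (C₂ x).1 (y, z)

/-- `R_{s1} = I(V; X₁) - I(V; Z₁)`. -/
def Rs₁ (s : Selection X₁ Y₁ X₂) (C₁ : DMBC X₁ Y₁ Z₁) : ℝ :=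
  mutInfo (s.law₁ C₁) (fun (v, _, _, _) => v) (fun (_, x, _, _) => x) -
    mutInfo (s.law₁ C₁) (fun (v, _, _, _) => v) (fun (_, _, _, z) => z)

/-- `R_{s2} = I(W₁; Y₂ | W₂) - I(W₁; Z₂ | W₂)`. -/
def Rs₂ (s : Selection X₁ Y₁ X₂) (C₂ : DMBC X₂ Y₂ Z₂) : ℝ :=
  condMutInfo (s.law₂ C₂) (fun (_, w₁, _, _, _) => w₁) (fun (_, _, _, y, _) => y)
      (fun (w₂, _, _, _, _) => w₂) -
    condMutInfo (s.law₂ C₂) (fun (_, w₁, _, _, _) => w₁) (fun (_, _, _, _, z) => z)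
      (fun (w₂, _, _, _, _) => w₂)

/-- The constraint `n₁ I(V; Y₁ | X₁) < n₂ I(W₁; Y₂)`. -/
def Feasible (s : Selection X₁ Y₁ X₂) (C₁ : DMBC X₁ Y₁ Z₁) (C₂ : DMBC X₂ Y₂ Z₂)
    (n₁ n₂ : ℕ) : Prop :=
  n₁ * condMutInfo (s.law₁ C₁) (fun (v, _, _, _) => v) (fun (_, _, y, _) => y)
      (fun (_, x, _, _) => x) <
    n₂ * mutInfo (s.law₂ C₂) (fun (_, w₁, _, _, _) => w₁) (fun (_, _, _, y, _) => y)

/-- The objective `(n₁ R_{s1} + n₂ [R_{s2}]₊) / (n₁ + n₂)`. -/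
def valueL (s : Selection X₁ Y₁ X₂) (C₁ : DMBC X₁ Y₁ Z₁) (C₂ : DMBC X₂ Y₂ Z₂)
    (n₁ n₂ : ℕ) : ℝ :=
  (n₁ * s.Rs₁ C₁ + n₂ * max 0 (s.Rs₂ C₂)) / (n₁ + n₂)

/-- The objective `(n₁ R_{s1} + n₂ R_{s2}) / (n₁ + n₂)`. -/
def valueICC (s : Selection X₁ Y₁ X₂) (C₁ : DMBC X₁ Y₁ Z₁) (C₂ : DMBC X₂ Y₂ Z₂)
    (n₁ n₂ : ℕ) : ℝ :=
  (n₁ * s.Rs₁ C₁ + n₂ * s.Rs₂ C₂) / (n₁ + n₂)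

end Selection

/-- The bound `L` when the first channel belongs to the initiator: with the forward channel first
this is `L_A`, with the backward channel first it is `L_B`. -/
def lowerBound (C₁ : DMBC X₁ Y₁ Z₁) (C₂ : DMBC X₂ Y₂ Z₂) : ℝ :=
  sSup {r | ∃ (s : Selection X₁ Y₁ X₂) (n₁ n₂ : ℕ),
    s.Feasible C₁ C₂ n₁ n₂ ∧ r = s.valueL C₁ C₂ n₁ n₂}

/-- The rate `R^ICC` when the first channel belongs to the initiator: with the forward channel
first this is `R^ICC_A`, with the backward channel first it is `R^ICC_B`. -/
def iccRate (C₁ : DMBC X₁ Y₁ Z₁) (C₂ : DMBC X₂ Y₂ Z₂) : ℝ :=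
  sSup {r | ∃ (s : Selection X₁ Y₁ X₂) (n₁ n₂ : ℕ),
    s.Feasible C₁ C₂ n₁ n₂ ∧ r = s.valueICC C₁ C₂ n₁ n₂}

/-- `C₂` has secrecy potential, as the responder's channel next to `C₁`: the selections with
`R_{s2} < 0`, in which `C₂` serves only to realize a noiseless channel, are not optimal in the
maximization that defines `L`, that is, they stay below some value smaller than `L`. -/
def HasSecrecyPotential (C₁ : DMBC X₁ Y₁ Z₁) (C₂ : DMBC X₂ Y₂ Z₂) : Prop :=
  ∃ r < lowerBound C₁ C₂, ∀ (s : Selection X₁ Y₁ X₂) (n₁ n₂ : ℕ),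
    s.Feasible C₁ C₂ n₁ n₂ → s.Rs₂ C₂ < 0 → s.valueL C₁ C₂ n₁ n₂ ≤ r

end Bounds

/-- An instance of the interactive channel coding protocol. The initiator owns `C₁`, the responder
owns `C₂`. The responder's `n₂ = n₂₁ + n₂₂` symbols are `n₂₁` information symbols followed by
`n₂₂` parity-check symbols. -/
structure ICC {X₁ Y₁ Z₁ X₂ Y₂ Z₂ : Type*} [Fintype X₁] [Fintype Y₁] [Fintype Z₁]
    [Fintype X₂] [Fintype Y₂] [Fintype Z₂] (C₁ : DMBC X₁ Y₁ Z₁) (C₂ : DMBC X₂ Y₂ Z₂)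
    extends Selection X₁ Y₁ X₂ where
  /-- the typicality parameter -/
  ε : ℝ
  ε_pos : 0 < ε
  /-- the number of uses of `C₁` -/
  n₁ : ℕ
  /-- the number of information symbols sent over `C₂` -/
  n₂₁ : ℕ
  /-- the number of parity-check symbols sent over `C₂` -/
  n₂₂ : ℕ
  length_pos : 0 < n₁ + (n₂₁ + n₂₂)
  /-- the codebook of `V`-sequences -/
  codeV : Finset (Fin n₁ → Fin v)
  codeV_typical : ∀ c ∈ codeV,
    Typical ε (law (toSelection.law₁ C₁) (fun (a, _, _, _) => a)) c
  /-- the codebook of `W₁`-information sequences -/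
  codeW : Finset (Fin n₂₁ → Fin w₁)
  codeW_typical : ∀ c ∈ codeW,
    Typical ε (law (toSelection.law₂ C₂) (fun (_, b, _, _, _) => b)) c
  codeW_nonempty : codeW.Nonempty
  /-- the codeword that the responder chooses after he has received a `Y₁`-sequence -/
  pick : (Fin n₁ → Y₁) → codeV
  /-- the choice is jointly typical with the received sequence if any codeword is; otherwise the
  run has failed and the value of `pick` is arbitrary -/
  pick_typical : ∀ y : Fin n₁ → Y₁,
    (∃ c : codeV, JointlyTypical ε
      (law (toSelection.law₁ C₁) (fun (a, _, b, _) => (a, b))) c.1 y) →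
    JointlyTypical ε (law (toSelection.law₁ C₁) (fun (a, _, b, _) => (a, b))) (pick y).1 y
  /-- the parity-check sequence of the systematic encoder -/
  parity : codeV → codeW → (Fin n₂₂ → Fin w₁)
  /-- the number of values of the key -/
  K : ℕ
  /-- the key, as a function of the information sequence -/
  g : codeV × codeW → Fin K
  /-- the key function partitions the information sequences into parts of equal size -/
  g_equal : ∀ i j : Fin K,
    Nat.card {c : codeV × codeW // g c = i} = Nat.card {c : codeV × codeW // g c = j}

namespace ICC

variable {X₁ Y₁ Z₁ X₂ Y₂ Z₂ : Type*} [Fintype X₁] [Fintype Y₁] [Fintype Z₁]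
  [Fintype X₂] [Fintype Y₂] [Fintype Z₂] {C₁ : DMBC X₁ Y₁ Z₁} {C₂ : DMBC X₂ Y₂ Z₂}

/-- The number of uses of `C₂`. -/
def n₂ (Γ : ICC C₁ C₂) : ℕ := Γ.n₂₁ + Γ.n₂₂

/-- The systematic encoder `(v, w) ↦ (v ‖ w ‖ parity-check sequence)`. -/
def enc (Γ : ICC C₁ C₂) (c : Γ.codeV × Γ.codeW) :
    (Fin Γ.n₁ → Fin Γ.v) × (Fin Γ.n₂ → Fin Γ.w₁) :=
  (c.1.1, Fin.append c.2.1 (Γ.parity c.1 c.2))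

/-- The information sequence `c` is encoded to a codeword that is bipartite jointly typical with
the initiator's sequences `(x₁ ‖ y₂)`. -/
def Fits (Γ : ICC C₁ C₂) (x₁ : Fin Γ.n₁ → X₁) (y₂ : Fin Γ.n₂ → Y₂)
    (c : Γ.codeV × Γ.codeW) : Prop :=
  BipJointlyTypical Γ.ε
    (law (Γ.law₁ C₁) (fun (a, x, _, _) => (a, x)))
    (law (Γ.law₂ C₂) (fun (_, b, _, y, _) => (b, y)))
    (Γ.enc c).1 (Γ.enc c).2 x₁ y₂

open Classical in
/-- The initiator's decoder: the unique information sequence that fits, or NULL. -/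
def dec (Γ : ICC C₁ C₂) (x₁ : Fin Γ.n₁ → X₁) (y₂ : Fin Γ.n₂ → Y₂) :
    Option (Γ.codeV × Γ.codeW) :=
  if h : ∃! c, Γ.Fits x₁ y₂ c then some h.choose else none

/-- The outcome of a run: `x₁, y₁, z₁`, the responder's information sequence `w`,
and `x₂, y₂, z₂`. -/
abbrev Outcome (Γ : ICC C₁ C₂) : Type _ :=
  (Fin Γ.n₁ → X₁) × (Fin Γ.n₁ → Y₁) × (Fin Γ.n₁ → Z₁) × Γ.codeW ×
    (Fin Γ.n₂ → X₂) × (Fin Γ.n₂ → Y₂) × (Fin Γ.n₂ → Z₂)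

/-- The law of a run. The initiator sends an i.i.d. sequence over `C₁`; the responder draws `w`
uniformly from its codebook, encodes `(pick y₁, w)`, passes the `W₁`-part of the codeword through
the memoryless channel `W₁ → X₂` and sends the result over `C₂`. -/
def runLaw (Γ : ICC C₁ C₂) : Γ.Outcome → ℝ :=
  fun (x₁, y₁, z₁, w, x₂, y₂, z₂) =>
    (∏ i, Γ.pX.1 (x₁ i) * (C₁ (x₁ i)).1 (y₁ i, z₁ i)) *
      (1 / (Γ.codeW.card : ℝ)) *
      ∏ j, (Γ.pXW ((Γ.enc (Γ.pick y₁, w)).2 j)).1 (x₂ j) * (C₂ (x₂ j)).1 (y₂ j, z₂ j)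

/-- The key `S`, computed by the responder. -/
def key (Γ : ICC C₁ C₂) : Γ.Outcome → Fin Γ.K :=
  fun (_, y₁, _, w, _, _, _) => Γ.g (Γ.pick y₁, w)

/-- The estimate of the key, computed by the initiator (NULL if decoding fails). -/
def keyEstimate (Γ : ICC C₁ C₂) : Γ.Outcome → Option (Fin Γ.K) :=
  fun (x₁, _, _, _, _, y₂, _) => (Γ.dec x₁ y₂).map Γ.g

/-- The responder returns NULL: no codeword is jointly typical with what he received. -/
def PickFails (Γ : ICC C₁ C₂) : Γ.Outcome → Prop :=
  fun (_, y₁, _, _, _, _, _) => ¬ ∃ c : Γ.codeV, JointlyTypical Γ.ε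
    (law (Γ.law₁ C₁) (fun (a, _, b, _) => (a, b))) c.1 y₁

/-- The eavesdropper's view. -/
def viewE (Γ : ICC C₁ C₂) : Γ.Outcome → (Fin Γ.n₁ → Z₁) × (Fin Γ.n₂ → Z₂) :=
  fun (_, _, z₁, _, _, _, z₂) => (z₁, z₂)

/-- `Γ` is `(R, δ)`-secure. A NULL of either party counts as an error. A constant key, for which
the ratio of the last requirement is `0 / 0`, is trivially secret. -/
def Secure (Γ : ICC C₁ C₂) (R δ : ℝ) : Prop :=
  R - δ < ent Γ.runLaw Γ.key / (Γ.n₁ + Γ.n₂) ∧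
  prob Γ.runLaw (fun ω => Γ.PickFails ω ∨ Γ.keyEstimate ω ≠ some (Γ.key ω)) < δ ∧
  (ent Γ.runLaw Γ.key ≠ 0 →
    1 - δ < condEnt Γ.runLaw Γ.key Γ.viewE / ent Γ.runLaw Γ.key)

end ICC

/-- The ICC protocol achieves the secret-key rate `R` over the forward channel `Cf` (owned by
Alice) and the backward channel `Cb` (owned by Bob): for every `δ > 0` an instance initiated by
Alice or an instance initiated by Bob, with typicality parameter below `δ`,
is `(R, δ)`-secure. -/
def ICCAchieves {Xf Yf Zf Xb Yb Zb : Type*} [Fintype Xf] [Fintype Yf] [Fintype Zf]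
    [Fintype Xb] [Fintype Yb] [Fintype Zb] (Cf : DMBC Xf Yf Zf) (Cb : DMBC Xb Yb Zb)
    (R : ℝ) : Prop :=
  ∀ δ > 0, (∃ Γ : ICC Cf Cb, Γ.ε < δ ∧ Γ.Secure R δ) ∨
    (∃ Γ : ICC Cb Cf, Γ.ε < δ ∧ Γ.Secure R δ)

end SKE

end

set_option linter.unusedSectionVars false

namespace SKE

/-! ### Indicators, laws and weighted sums -/

/-! Rates. Under secrecy potential, the choices with `Rs₂ < 0` have values below some `r < L`, so
the supremum does not see them; on all other choices the two objectives agree. Hence the suprema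
coincide (`iccRate_eq_lowerBound`), and values close to a positive `L` are values of the ICC
objective for the same choice. It remains to achieve every positive value of that objective
(`Selection.exists_secure`); when `max L_A L_B ≤ 0` a constant key suffices.

Achievability is random coding. Write `U = W₂`, `W = W₁`, and let `n`, `m` be the numbers of uses of
the two channels. About `2^(n I(V;Y₁))` covering codewords guarantee that the responder finds a
typical one (`exists_covering_code`). With `A` covering codewords and `B` values of the fresh
message, each of the `A * B` pairs is sent as a satellite codeword of a superposition code with
about `2^(m I(U;Y₂))` clouds (`exists_superposition_code`). The initiator decodes as long as `log A
+ log B` is below `n I(V;X₁) + m I(W;Y₂)`; so `log B` may be about `m I(W;Y₂) - n I(V;Y₁|X₁)`, which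
is positive precisely by feasibility.

For secrecy, on good runs the joint probability of a pair and a view `z` is at most `2^(-κ) τ(z)`
for a law `τ` that does not depend on the pair, with `κ ≈ n (I(V;Y₁) - I(V;Z₁)) + log B - m
I(W;Z₂|U) - m I(U;Y₂)` (`SeqCode.expect_view_le`). This is `n Rs₁ + m Rs₂`. A second-moment argument
shows that some balanced partition into about `2^κ` parts gives an almost uniform, almost
independent key (`exists_perm_le_condEnt`).

The protocol also demands distinct typical codewords and a systematic encoder. Both are met by
attaching independent uniform labels to `V` and `W`: the label on `W` is ignored by the channel, and
labels leave typicality unchanged. All words of the `W`-codebook lie over one fixed typical sequence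
`w₀` and differ in their labels only, so the information symbols carry nothing and the parity
symbols carry the whole superposition codeword. The information symbols are a vanishing fraction of
the transmission, so they cost no rate in the limit. -/

open Classical in
/-- The indicator of a proposition. -/
noncomputable def ind (p : Prop) : ℝ := if p then 1 else 0

theorem ind_true {p : Prop} (h : p) : ind p = 1 := by simp [ind, h]

theorem ind_false {p : Prop} (h : ¬ p) : ind p = 0 := by simp [ind, h]

theorem ind_nonneg (p : Prop) : 0 ≤ ind p := by
  by_cases h : p <;> simp [ind, h]

theorem ind_le_one (p : Prop) : ind p ≤ 1 := by
  by_cases h : p <;> simp [ind, h]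

theorem ind_mono {p q : Prop} (h : p → q) : ind p ≤ ind q := by
  by_cases hp : p
  · rw [ind_true hp, ind_true (h hp)]
  · rw [ind_false hp]; exact ind_nonneg q

theorem ind_or_le (p q : Prop) : ind (p ∨ q) ≤ ind p + ind q := by
  by_cases hp : p <;> by_cases hq : q <;> simp [ind, hp, hq]

theorem ind_and (p q : Prop) : ind (p ∧ q) = ind p * ind q := by
  by_cases hp : p <;> by_cases hq : q <;> simp [ind, hp, hq]

theorem ind_exists_le {ι : Type*} [Fintype ι] (p : ι → Prop) :
    ind (∃ i, p i) ≤ ∑ i, ind (p i) := by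
  by_cases h : ∃ i, p i
  · obtain ⟨i, hi⟩ := h
    rw [ind_true ⟨i, hi⟩, ← ind_true hi]
    exact Finset.single_le_sum (f := fun i => ind (p i)) (fun i _ => ind_nonneg _) (mem_univ i)
  · rw [ind_false h]
    exact Finset.sum_nonneg fun i _ => ind_nonneg _

theorem ind_forall {ι : Type*} [Fintype ι] (p : ι → Prop) :
    ind (∀ i, p i) = ∏ i, ind (p i) := by
  by_cases h : ∀ i, p i
  · rw [ind_true h]
    exact (Finset.prod_eq_one fun i _ => ind_true (h i)).symm
  · rw [ind_false h]
    push Not at h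
    obtain ⟨i, hi⟩ := h
    exact (Finset.prod_eq_zero (mem_univ i) (ind_false hi)).symm

theorem sum_ind_eq_mul {α : Type*} [Fintype α] (a : α) (F : α → ℝ) :
    ∑ b, ind (a = b) * F b = F a := by
  classical
  simp [ind]

theorem sum_ind_eq {α : Type*} [Fintype α] (a : α) : ∑ b, ind (a = b) = 1 := by
  simpa using sum_ind_eq_mul a fun _ => (1 : ℝ)

section Law

variable {Ω α β : Type*} [Fintype Ω]

theorem law_eq_sum (P : Ω → ℝ) (f : Ω → α) (a : α) : law P f a = ∑ ω, P ω * ind (f ω = a) := by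
  classical
  unfold law
  rw [Finset.sum_filter]
  exact Finset.sum_congr rfl fun ω _ => by by_cases h : f ω = a <;> simp [ind, h]

theorem prob_eq_sum (P : Ω → ℝ) (E : Ω → Prop) : prob P E = ∑ ω, P ω * ind (E ω) := by
  classical
  unfold prob
  rw [Finset.sum_filter]
  exact Finset.sum_congr rfl fun ω _ => by by_cases h : E ω <;> simp [ind, h]

theorem sum_law_mul [Fintype α] (P : Ω → ℝ) (f : Ω → α) (F : α → ℝ) :
    ∑ a, law P f a * F a = ∑ ω, P ω * F (f ω) := by
  simp only [law_eq_sum, Finset.sum_mul]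
  rw [Finset.sum_comm]
  refine Finset.sum_congr rfl fun ω _ => ?_
  simp only [mul_assoc, ← Finset.mul_sum]
  rw [sum_ind_eq_mul]

theorem sum_law [Fintype α] (P : Ω → ℝ) (f : Ω → α) : ∑ a, law P f a = ∑ ω, P ω := by
  simpa using sum_law_mul P f fun _ => (1 : ℝ)

theorem law_law [Fintype α] (P : Ω → ℝ) (f : Ω → α) (g : α → β) :
    law (law P f) g = law P (fun ω => g (f ω)) := by
  funext b
  rw [law_eq_sum, sum_law_mul P f (fun a => ind (g a = b)), law_eq_sum]

theorem law_nonneg {P : Ω → ℝ} (hP : ∀ ω, 0 ≤ P ω) (f : Ω → α) (a : α) : 0 ≤ law P f a := by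
  rw [law_eq_sum]
  exact Finset.sum_nonneg fun ω _ => mul_nonneg (hP ω) (ind_nonneg _)

theorem le_law {P : Ω → ℝ} (hP : ∀ ω, 0 ≤ P ω) (f : Ω → α) (ω : Ω) : P ω ≤ law P f (f ω) := by
  rw [law_eq_sum]
  refine le_trans ?_ (Finset.single_le_sum (f := fun ω' => P ω' * ind (f ω' = f ω))
    (fun ω' _ => mul_nonneg (hP ω') (ind_nonneg _)) (mem_univ ω))
  simp [ind_true]

theorem law_pos {P : Ω → ℝ} (hP : ∀ ω, 0 ≤ P ω) (f : Ω → α) {ω : Ω} (h : 0 < P ω) :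
    0 < law P f (f ω) := h.trans_le (le_law hP f ω)

theorem law_comp_le {P : Ω → ℝ} (hP : ∀ ω, 0 ≤ P ω) (f : Ω → α) (g : α → β) (a : α) :
    law P f a ≤ law P (fun ω => g (f ω)) (g a) := by
  rw [law_eq_sum, law_eq_sum]
  exact Finset.sum_le_sum fun ω _ =>
    mul_le_mul_of_nonneg_left (ind_mono fun h => by rw [h]) (hP ω)

/-- A weighted average is at least some value of positive weight. -/
theorem exists_pos_le_of_sum_mul_le {μ f : Ω → ℝ} {b : ℝ} (hμ : ∀ x, 0 ≤ μ x)
    (h1 : ∑ x, μ x = 1) (h : ∑ x, μ x * f x ≤ b) : ∃ x, 0 < μ x ∧ f x ≤ b := by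
  by_contra! hc
  have h2 : ∑ x, μ x * b < ∑ x, μ x * f x := by
    obtain ⟨x, -, hx⟩ : ∃ x ∈ (univ : Finset Ω), 0 < μ x := by
      by_contra! h0
      have : ∑ x, μ x = 0 := Finset.sum_eq_zero fun x hx => le_antisymm (h0 x hx) (hμ x)
      linarith
    refine Finset.sum_lt_sum (fun y _ => ?_) ⟨x, mem_univ x, ?_⟩
    · rcases (hμ y).eq_or_lt with h0 | h0
      · simp [← h0]
      · exact mul_le_mul_of_nonneg_left (hc y h0).le (hμ y)
    · exact mul_lt_mul_of_pos_left (hc x hx) hx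
  rw [← Finset.sum_mul, h1, one_mul] at h2
  linarith

end Law

/-! ### Product weights -/

section Product

variable {ι α : Type*} [Fintype ι] [Fintype α]

theorem sum_prod_pi [DecidableEq ι] (F : ι → α → ℝ) :
    ∑ x : ι → α, ∏ i, F i (x i) = ∏ i, ∑ a, F i a := by
  rw [Finset.prod_univ_sum, Fintype.piFinset_univ]

theorem sum_prod_pi_const [DecidableEq ι] (F : α → ℝ) :
    ∑ x : ι → α, ∏ i, F (x i) = (∑ a, F a) ^ Fintype.card ι := by
  rw [sum_prod_pi (fun _ => F)]
  simp

/-- The factors with index other than `i` sum to 1, so the `i`-th coordinate has law `q`. -/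
theorem sum_prod_mul_one [DecidableEq ι] {q : α → ℝ} (hq : ∑ a, q a = 1) (f : α → ℝ) (i : ι) :
    ∑ x : ι → α, (∏ j, q (x j)) * f (x i) = ∑ a, q a * f a := by
  have h : ∀ x : ι → α, (∏ j, q (x j)) * f (x i) =
      ∏ j, (q (x j) * if j = i then f (x j) else 1) := fun x => by
    rw [Finset.prod_mul_distrib]
    simp
  simp only [h]
  rw [sum_prod_pi (fun j a => q a * if j = i then f a else 1), Finset.prod_eq_single i]
  · simp
  · intro j _ hj
    simp [hj, hq]
  · simp

/-- Two distinct coordinates are independent: this is a factorisation when `f` is a product, and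
every `f` on a finite set is a combination of products of indicators. -/
theorem sum_prod_mul_two [DecidableEq ι] {q : α → ℝ} (hq : ∑ a, q a = 1) (f : α → α → ℝ)
    {i i' : ι} (hi : i ≠ i') :
    ∑ x : ι → α, (∏ j, q (x j)) * f (x i) (x i') = ∑ a, ∑ b, q a * q b * f a b := by
  classical
  have key : ∀ g h : α → ℝ, ∑ x : ι → α, (∏ j, q (x j)) * (g (x i) * h (x i')) =
      (∑ a, q a * g a) * ∑ b, q b * h b := by
    intro g h
    have e : ∀ x : ι → α, (∏ j, q (x j)) * (g (x i) * h (x i')) =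
        ∏ j, (q (x j) * ((if j = i then g (x j) else 1) * if j = i' then h (x j) else 1)) :=
      fun x => by
        rw [Finset.prod_mul_distrib, Finset.prod_mul_distrib]
        simp
    simp only [e]
    rw [sum_prod_pi (fun j a => q a * ((if j = i then g a else 1) * if j = i' then h a else 1)),
      Finset.prod_eq_mul i i' hi]
    · simp [hi, hi.symm]
    · intro j _ hj
      simp [hj.1, hj.2, hq]
    · simp
    · simp
  have e : ∀ x : ι → α, f (x i) (x i') = ∑ a, ∑ b, f a b * (ind (x i = a) * ind (x i' = b)) := by
    intro x
    have := sum_ind_eq_mul (x i) fun a => ∑ b, ind (x i' = b) * f a b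
    simp only [sum_ind_eq_mul (x i')] at this
    rw [← this]
    refine Finset.sum_congr rfl fun a _ => ?_
    rw [← sum_ind_eq_mul (x i') (fun b => f a b), Finset.mul_sum]
    exact Finset.sum_congr rfl fun b _ => by ring
  simp only [e, Finset.mul_sum]
  rw [Finset.sum_comm]
  refine Finset.sum_congr rfl fun a _ => ?_
  rw [Finset.sum_comm]
  refine Finset.sum_congr rfl fun b _ => ?_
  have := key (fun c => ind (c = a)) (fun c => ind (c = b))
  have e1 : ∀ c : α, ∑ a, q a * ind (a = c) = q c := fun c => by
    rw [← sum_ind_eq_mul c q]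
    exact Finset.sum_congr rfl fun a _ => by
      rw [mul_comm, show (a = c) = (c = a) from propext eq_comm]
  rw [e1, e1] at this
  calc _ = f a b * ∑ x : ι → α, (∏ j, q (x j)) * (ind (x i = a) * ind (x i' = b)) := by
        rw [Finset.mul_sum]
        exact Finset.sum_congr rfl fun x _ => by ring
    _ = _ := by rw [this]; ring

/-- Chebyshev's inequality for sums of independent, identically distributed terms. -/
theorem sum_prod_mul_ind_lt_abs_le {P : α → ℝ} (hP : ∀ a, 0 ≤ P a) (h1 : ∑ a, P a = 1)
    (f : α → ℝ) (n : ℕ) {ε : ℝ} (hε : 0 < ε) :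
    ∑ x : Fin n → α, (∏ i, P (x i)) *
        ind (n * ε < |∑ i, f (x i) - n * ∑ a, P a * f a|) ≤
      (∑ a, P a * (f a - ∑ b, P b * f b) ^ 2) / (n * ε ^ 2) := by
  set μ := ∑ a, P a * f a with hμ
  set V := ∑ a, P a * (f a - μ) ^ 2 with hV
  -- For `n = 0` the bound is a division by zero, hence `0`; the event is then `0 < 0`.
  rcases Nat.eq_zero_or_pos n with rfl | hn
  · simp [ind_false]
  have hn' : (0 : ℝ) < n := by exact_mod_cast hn
  have hvar : ∑ x : Fin n → α, (∏ i, P (x i)) * (∑ i, (f (x i) - μ)) ^ 2 = n * V := by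
    have e : ∀ x : Fin n → α, (∏ i, P (x i)) * (∑ i, (f (x i) - μ)) ^ 2 =
        ∑ i, ∑ j, (∏ i, P (x i)) * ((f (x i) - μ) * (f (x j) - μ)) := by
      intro x
      rw [sq, Finset.sum_mul_sum, Finset.mul_sum]
      exact Finset.sum_congr rfl fun i _ => by rw [Finset.mul_sum]
    simp only [e]
    rw [Finset.sum_comm]
    -- The centred terms have mean zero, so the cross terms vanish and each row contributes one
    -- variance.
    have : ∀ i : Fin n, ∑ x : Fin n → α,
        ∑ j, (∏ i, P (x i)) * ((f (x i) - μ) * (f (x j) - μ)) = V := by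
      intro i
      rw [Finset.sum_comm, Finset.sum_eq_single i]
      · rw [sum_prod_mul_one h1 (fun a => (f a - μ) * (f a - μ)) i, hV]
        exact Finset.sum_congr rfl fun a _ => by ring
      · intro j _ hj
        rw [sum_prod_mul_two h1 (fun a b => (f a - μ) * (f b - μ)) hj.symm]
        have : ∑ b, P b * (f b - μ) = 0 := by
          simp only [mul_sub, Finset.sum_sub_distrib, ← Finset.sum_mul, h1]
          rw [← hμ]; ring
        refine Finset.sum_eq_zero fun a _ => ?_
        calc _ = P a * (f a - μ) * ∑ b, P b * (f b - μ) := by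
              rw [Finset.mul_sum]
              exact Finset.sum_congr rfl fun b _ => by ring
          _ = 0 := by rw [this, mul_zero]
      · simp
    rw [Finset.sum_congr rfl fun i _ => this i]
    simp
  rw [le_div_iff₀ (by positivity)]
  have hb : (∑ x : Fin n → α, (∏ i, P (x i)) *
      ind (n * ε < |∑ i, f (x i) - n * μ|)) * (n * ε) ^ 2 ≤ n * V := by
    rw [← hvar, Finset.sum_mul]
    refine Finset.sum_le_sum fun x _ => ?_
    rw [mul_assoc]
    refine mul_le_mul_of_nonneg_left ?_ (Finset.prod_nonneg fun i _ => hP _)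
    have e : ∑ i, (f (x i) - μ) = ∑ i, f (x i) - n * μ := by
      simp [Finset.sum_sub_distrib]
    rw [e]
    by_cases h : n * ε < |∑ i, f (x i) - n * μ|
    · rw [ind_true h, one_mul, ← sq_abs (∑ i, f (x i) - n * μ)]
      gcongr
    · rw [ind_false h, zero_mul]
      positivity
  have : (∑ x : Fin n → α, (∏ i, P (x i)) *
      ind (n * ε < |∑ i, f (x i) - n * μ|)) * (n * ε ^ 2) * n ≤ V * n := by
    calc _ = (∑ x : Fin n → α, (∏ i, P (x i)) *
      ind (n * ε < |∑ i, f (x i) - n * μ|)) * (n * ε) ^ 2 := by ring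
      _ ≤ n * V := hb
      _ = V * n := by ring
  exact le_of_mul_le_mul_right this hn'

end Product
end SKE

namespace SKE

/-! ### Entropy -/

section Entropy

variable {Ω α β γ δ : Type*} [Fintype Ω] [Fintype α] [Fintype β] [Fintype γ] [Fintype δ]

/-- The surprisal `-log P_A(A)` of the random variable `A`. -/
noncomputable def surp (P : Ω → ℝ) (A : Ω → α) (ω : Ω) : ℝ := -Real.logb 2 (law P A (A ω))

theorem ent_eq_sum (P : Ω → ℝ) (A : Ω → α) : ent P A = ∑ ω, P ω * surp P A ω := by
  unfold surp
  rw [← sum_law_mul P A fun a => -Real.logb 2 (law P A a)]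
  exact Finset.sum_congr rfl fun a _ => by ring

/-- From `log x ≤ x - 1`. Neither function has to be normalised; the comparison of total masses is
enough. -/
theorem gibbs {p q : α → ℝ} (hp : ∀ a, 0 ≤ p a) (hq : ∀ a, 0 ≤ q a)
    (h : ∑ a, q a ≤ ∑ a, p a) (hpq : ∀ a, 0 < p a → 0 < q a) :
    ∑ a, p a * (Real.logb 2 (q a) - Real.logb 2 (p a)) ≤ 0 := by
  have hl : (0 : ℝ) < Real.log 2 := Real.log_pos one_lt_two
  have : ∀ a, p a * (Real.logb 2 (q a) - Real.logb 2 (p a)) ≤ (q a - p a) / Real.log 2 := by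
    intro a
    rcases (hp a).eq_or_lt with h0 | h0
    · rw [← h0]
      simp only [zero_mul, sub_zero]
      exact div_nonneg (hq a) hl.le
    · have h1 := hpq a h0
      rw [Real.logb, Real.logb, ← sub_div, mul_div_assoc', div_le_div_iff_of_pos_right hl,
        ← Real.log_div h1.ne' h0.ne']
      have := Real.log_le_sub_one_of_pos (div_pos h1 h0)
      calc p a * Real.log (q a / p a) ≤ p a * (q a / p a - 1) := by gcongr
        _ = q a - p a := by field_simp
  refine (Finset.sum_le_sum fun a _ => this a).trans ?_
  rw [← Finset.sum_div, Finset.sum_sub_distrib]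
  exact div_nonpos_of_nonpos_of_nonneg (by linarith) hl.le

theorem ent_le_logb_card {P : Ω → ℝ} (hP : ∀ ω, 0 ≤ P ω) (h1 : ∑ ω, P ω = 1) (A : Ω → α) :
    ent P A ≤ Real.logb 2 (Fintype.card α) := by
  have hne : Nonempty α := by
    by_contra hc
    rw [not_nonempty_iff] at hc
    have : IsEmpty Ω := ⟨fun ω => hc.elim (A ω)⟩
    simp at h1
  have hc : (0 : ℝ) < Fintype.card α := by exact_mod_cast Fintype.card_pos
  have := gibbs (p := law P A) (q := fun _ => 1 / (Fintype.card α : ℝ)) (law_nonneg hP A)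
    (fun _ => by positivity) (by rw [sum_law, h1]; simp) (fun _ _ => by positivity)
  simp only [mul_sub, Finset.sum_sub_distrib, ← Finset.sum_mul, sum_law, h1] at this
  rw [one_mul, one_div, Real.logb_inv] at this
  simp only [ent, entropy, Finset.sum_neg_distrib]
  linarith

/-- Gibbs' inequality for the joint law against the product of its marginals. -/
theorem condEnt_le_ent {P : Ω → ℝ} (hP : ∀ ω, 0 ≤ P ω) (h1 : ∑ ω, P ω = 1) (A : Ω → α)
    (B : Ω → β) : condEnt P A B ≤ ent P A := by
  have := gibbs (p := law P fun ω => (A ω, B ω)) (q := fun x => law P A x.1 * law P B x.2)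
    (law_nonneg hP _) (fun x => mul_nonneg (law_nonneg hP _ _) (law_nonneg hP _ _))
    (by
      rw [Fintype.sum_prod_type]
      simp only [← Finset.mul_sum, sum_law, h1, mul_one, le_refl])
    (fun x hx => mul_pos (hx.trans_le (law_comp_le hP _ Prod.fst x))
      (hx.trans_le (law_comp_le hP _ Prod.snd x)))
  rw [sum_law_mul P (fun ω => (A ω, B ω)) fun x =>
    Real.logb 2 (law P A x.1 * law P B x.2) - Real.logb 2 (law P (fun ω => (A ω, B ω)) x)] at this
  have e : ent P (fun ω => (A ω, B ω)) - ent P A - ent P B =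
      ∑ ω, P ω * (Real.logb 2 (law P A (A ω) * law P B (B ω)) -
        Real.logb 2 (law P (fun ω => (A ω, B ω)) (A ω, B ω))) := by
    rw [ent_eq_sum, ent_eq_sum, ent_eq_sum, ← Finset.sum_sub_distrib, ← Finset.sum_sub_distrib]
    refine Finset.sum_congr rfl fun ω _ => ?_
    rcases (hP ω).eq_or_lt with h0 | h0
    · simp [← h0]
    · rw [Real.logb_mul (law_pos hP A h0).ne' (law_pos hP B h0).ne']
      simp only [surp]
      ring
  simp only at this
  rw [← e] at this
  unfold condEnt
  linarith

/-- An identity between laws on the support gives an identity between entropies. -/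
theorem ent_add_ent_eq {P : Ω → ℝ} (hP : ∀ ω, 0 ≤ P ω) {A : Ω → α} {B : Ω → β} {C : Ω → γ}
    {D : Ω → δ} (h : ∀ ω, 0 < P ω →
      law P A (A ω) * law P B (B ω) = law P C (C ω) * law P D (D ω)) :
    ent P A + ent P B = ent P C + ent P D := by
  simp only [ent_eq_sum, ← Finset.sum_add_distrib]
  refine Finset.sum_congr rfl fun ω _ => ?_
  rcases (hP ω).eq_or_lt with h0 | h0
  · simp [← h0]
  · have := congrArg (Real.logb 2) (h ω h0)
    rw [Real.logb_mul (law_pos hP _ h0).ne' (law_pos hP _ h0).ne',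
      Real.logb_mul (law_pos hP _ h0).ne' (law_pos hP _ h0).ne'] at this
    simp only [surp]
    rw [← mul_add, ← mul_add]
    congr 1
    linarith

theorem ent_const {P : Ω → ℝ} (h1 : ∑ ω, P ω = 1) [Subsingleton α] (A : Ω → α) :
    ent P A = 0 := by
  rw [ent_eq_sum]
  refine Finset.sum_eq_zero fun ω _ => ?_
  have : law P A (A ω) = 1 := by
    rw [law_eq_sum, ← h1]
    exact Finset.sum_congr rfl fun ω' _ => by rw [ind_true (Subsingleton.elim _ _), mul_one]
  simp [surp, this]

/-- A conditional entropy is large if the conditional probabilities are mostly small. -/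
theorem le_condEnt {P : Ω → ℝ} (hP : ∀ ω, 0 ≤ P ω) (h1 : ∑ ω, P ω = 1) (A : Ω → α) (B : Ω → β)
    {L β' : ℝ} (hL : 1 ≤ L)
    (h : ∑ x : α × β, law P (fun ω => (A ω, B ω)) x *
      ind (law P B x.2 < L * law P (fun ω => (A ω, B ω)) x) ≤ β') :
    (1 - β') * Real.logb 2 L ≤ condEnt P A B := by
  have hl : 0 ≤ Real.logb 2 L := Real.logb_nonneg one_lt_two hL
  set J := law P fun ω => (A ω, B ω) with hJ
  have hJ0 : ∀ x, 0 ≤ J x := law_nonneg hP _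
  have e : condEnt P A B = ∑ x : α × β, J x * (Real.logb 2 (law P B x.2) - Real.logb 2 (J x)) := by
    rw [sum_law_mul P (fun ω => (A ω, B ω)) fun x =>
      Real.logb 2 (law P B x.2) - Real.logb 2 (J x)]
    unfold condEnt
    rw [ent_eq_sum, ent_eq_sum, ← Finset.sum_sub_distrib]
    refine Finset.sum_congr rfl fun ω _ => ?_
    simp only [surp, ← hJ]
    ring
  rw [e]
  calc (1 - β') * Real.logb 2 L
      ≤ (∑ x, J x * (1 - ind (law P B x.2 < L * J x))) * Real.logb 2 L := by
        refine mul_le_mul_of_nonneg_right ?_ hl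
        simp only [mul_sub, mul_one, Finset.sum_sub_distrib]
        have : ∑ x, J x = 1 := by rw [hJ, sum_law, h1]
        linarith
    _ ≤ _ := by
        rw [Finset.sum_mul]
        refine Finset.sum_le_sum fun x _ => ?_
        rcases (hJ0 x).eq_or_lt with h0 | h0
        · simp [← h0]
        rw [mul_assoc]
        refine mul_le_mul_of_nonneg_left ?_ h0.le
        -- The conditional surprisal is never negative, so exceptional pairs do no harm; all other
        -- pairs contribute at least `log L`.
        have hB : J x ≤ law P B x.2 := law_comp_le hP (fun ω => (A ω, B ω)) Prod.snd x
        by_cases hc : law P B x.2 < L * J x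
        · rw [ind_true hc, sub_self, zero_mul, sub_nonneg]
          exact Real.logb_le_logb_of_le one_lt_two h0 hB
        · rw [ind_false hc, sub_zero, one_mul, le_sub_iff_add_le,
            ← Real.logb_mul (by linarith) h0.ne']
          exact Real.logb_le_logb_of_le one_lt_two (by positivity) (not_lt.mp hc)

end Entropy
end SKE

namespace SKE

/-! ### Privacy amplification by a random balanced partition -/

section Privacy

/-- Two distinct points collide under a uniformly permuted partition with probability at most `1/K`.
Composing with a transposition shows that all partners of `c` collide with it equally often, and `c`
has `M - 1` collision partners among `K M - 1` points; `(M - 1)/(K M - 1) ≤ 1/K`. -/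
theorem sum_perm_ind_eq_le {C : Type*} [Fintype C] [DecidableEq C] {K : ℕ} (g : C → Fin K) {M : ℝ}
    (hg : ∀ s, ∑ c, ind (g c = s) = M) {c c' : C} (hc : c ≠ c') :
    (∑ σ : Equiv.Perm C, ind (g (σ c) = g (σ c'))) * K ≤ Fintype.card (Equiv.Perm C) := by
  classical
  set N : ℝ := ∑ σ : Equiv.Perm C, ind (g (σ c) = g (σ c')) with hN
  have hcard : (Fintype.card C : ℝ) = K * M := by
    calc (Fintype.card C : ℝ) = ∑ c : C, ∑ s, ind (g c = s) := by simp [sum_ind_eq]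
      _ = ∑ s, ∑ c : C, ind (g c = s) := Finset.sum_comm
      _ = K * M := by simp [hg]
  have hsame : ∀ c'' ∈ univ.erase c, ∑ σ : Equiv.Perm C, ind (g (σ c) = g (σ c'')) = N := by
    intro c'' hc''
    have h1 : c ≠ c'' := (Finset.ne_of_mem_erase hc'').symm
    rw [hN, ← Equiv.sum_comp (Equiv.mulRight (Equiv.swap c' c''))]
    refine Finset.sum_congr rfl fun σ _ => ?_
    simp [Equiv.swap_apply_of_ne_of_ne hc h1]
  have htot : ∑ c'' ∈ univ.erase c, ∑ σ : Equiv.Perm C, ind (g (σ c) = g (σ c'')) =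
      Fintype.card (Equiv.Perm C) * (M - 1) := by
    rw [Finset.sum_comm]
    have : ∀ σ : Equiv.Perm C, ∑ c'' ∈ univ.erase c, ind (g (σ c) = g (σ c'')) = M - 1 := by
      intro σ
      have h1 := Finset.add_sum_erase univ (fun c'' => ind (g (σ c) = g (σ c''))) (mem_univ c)
      have h2 : ∑ c'', ind (g (σ c) = g (σ c'')) = M := by
        rw [← hg (g (σ c)), ← Equiv.sum_comp σ (fun x => ind (g x = g (σ c)))]
        exact Finset.sum_congr rfl fun x _ => by
          rw [show (g (σ c) = g (σ x)) = (g (σ x) = g (σ c)) from propext eq_comm]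
      rw [h2] at h1
      simp only [ind_true] at h1
      linarith
    rw [Finset.sum_congr rfl fun σ _ => this σ]
    simp [mul_sub]
  rw [Finset.sum_congr rfl hsame] at htot
  simp only [sum_const, nsmul_eq_mul] at htot
  have hc2 : (2 : ℝ) ≤ Fintype.card C := by
    have : 1 < Fintype.card C := Fintype.one_lt_card_iff.mpr ⟨c, c', hc⟩
    exact_mod_cast this
  have he : (((univ.erase c).card : ℕ) : ℝ) = K * M - 1 := by
    rw [Finset.card_erase_of_mem (mem_univ c), Finset.card_univ, ← hcard,
      Nat.cast_sub (by exact_mod_cast (by linarith : (1 : ℝ) ≤ Fintype.card C))]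
    simp
  rw [he] at htot
  have hK : (1 : ℝ) ≤ K := by
    have : 0 < K := (g c).pos
    exact_mod_cast this
  have hpos : 0 < K * M - 1 := by rw [← hcard]; linarith
  refine le_of_mul_le_mul_left ?_ hpos
  calc (K * M - 1) * (N * K) = (Fintype.card (Equiv.Perm C)) * (K * M - K) := by
        rw [← mul_assoc, htot]; ring
    _ ≤ (Fintype.card (Equiv.Perm C)) * (K * M - 1) := by gcongr
    _ = _ := by ring

variable {Ω C Z : Type*} [Fintype Ω] [Fintype C] [Fintype Z]

/-- The average over all permutations satisfies the bound. In the expanded square the diagonal terms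
are controlled by `q c z ≤ τ z / K`, the off-diagonal ones by the collision probability and `∑ q ≤
p`; the weight `τ + p` absorbs both. -/
theorem exists_perm_sum_sq_le [DecidableEq C] {K : ℕ} (hK : 0 < K) (g : C → Fin K) {M : ℝ}
    (hg : ∀ s, ∑ c, ind (g c = s) = M) {q : C → Z → ℝ} (hq : ∀ c z, 0 ≤ q c z)
    {τ p : Z → ℝ} (hτ : ∀ z, 0 ≤ τ z) (hp : ∀ z, 0 ≤ p z) (hqτ : ∀ c z, q c z ≤ τ z / K)
    (hqp : ∀ z, ∑ c, q c z ≤ p z) (hp1 : ∑ z, p z ≤ 1) :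
    ∃ σ : Equiv.Perm C, ∑ z, (∑ s, (∑ c, ind (g (σ c) = s) * q c z) ^ 2) / (τ z + p z) ≤
      1 / K := by
  classical
  have hK' : (0 : ℝ) < K := by exact_mod_cast hK
  set F : ℝ := ((Fintype.card (Equiv.Perm C) : ℕ) : ℝ) with hF
  have hFpos : 0 < F := by
    rw [hF]
    exact_mod_cast Fintype.card_pos
  have key : ∀ z, ∑ σ : Equiv.Perm C, ∑ s, (∑ c, ind (g (σ c) = s) * q c z) ^ 2 ≤
      (F / K * ∑ c, q c z) * (τ z + p z) := by
    intro z
    have e : ∀ σ : Equiv.Perm C, ∑ s, (∑ c, ind (g (σ c) = s) * q c z) ^ 2 =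
        ∑ c, ∑ c', q c z * q c' z * ind (g (σ c) = g (σ c')) := by
      intro σ
      simp only [sq, Finset.sum_mul_sum]
      rw [Finset.sum_comm]
      refine Finset.sum_congr rfl fun c _ => ?_
      rw [Finset.sum_comm]
      refine Finset.sum_congr rfl fun c' _ => ?_
      rw [show (g (σ c) = g (σ c')) = (g (σ c') = g (σ c)) from propext eq_comm,
        ← sum_ind_eq_mul (g (σ c)) (fun s => ind (g (σ c') = s)), Finset.mul_sum]
      exact Finset.sum_congr rfl fun s _ => by ring
    simp only [e]
    rw [Finset.sum_comm, mul_assoc, mul_comm (∑ c, q c z), ← mul_assoc, Finset.mul_sum]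
    refine Finset.sum_le_sum fun c _ => ?_
    rw [Finset.sum_comm]
    simp only [← Finset.mul_sum]
    have h1 : ∀ c', q c z * q c' z * ∑ σ : Equiv.Perm C, ind (g (σ c) = g (σ c')) ≤
        q c z * (F * (ind (c = c') * q c' z) + F / K * q c' z) := by
      intro c'
      rw [mul_assoc]
      refine mul_le_mul_of_nonneg_left ?_ (hq c z)
      by_cases h : c = c'
      · rw [ind_true h, h]
        simp only [ind_true, sum_const, nsmul_eq_mul, mul_one, Finset.card_univ, ← hF]
        have : 0 ≤ F / K * q c' z := mul_nonneg (by positivity) (hq _ _)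
        linarith
      · rw [ind_false h, zero_mul, mul_zero, zero_add, mul_comm]
        refine mul_le_mul_of_nonneg_right ?_ (hq _ _)
        rw [le_div_iff₀ hK']
        exact sum_perm_ind_eq_le g hg h
    refine (Finset.sum_le_sum fun c' _ => h1 c').trans ?_
    rw [← Finset.mul_sum, Finset.sum_add_distrib, ← Finset.mul_sum, ← Finset.mul_sum,
      sum_ind_eq_mul c (fun c' => q c' z), mul_comm]
    refine mul_le_mul_of_nonneg_right ?_ (hq c z)
    have h2 := hqτ c z
    have h3 := hqp z
    calc F * q c z + F / K * ∑ c', q c' z ≤ F * (τ z / K) + F / K * p z := by gcongr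
      _ = F / K * (τ z + p z) := by ring
  have hsum : ∑ σ : Equiv.Perm C, 1 / F *
      ∑ z, (∑ s, (∑ c, ind (g (σ c) = s) * q c z) ^ 2) / (τ z + p z) ≤ 1 / K := by
    rw [← Finset.mul_sum, Finset.sum_comm]
    simp only [← Finset.sum_div]
    calc _ ≤ 1 / F * ∑ z, F / K * ∑ c, q c z := by
          refine mul_le_mul_of_nonneg_left (Finset.sum_le_sum fun z _ => ?_) (by positivity)
          exact div_le_of_le_mul₀ (add_nonneg (hτ z) (hp z))
            (mul_nonneg (by positivity) (Finset.sum_nonneg fun c _ => hq c z)) (key z)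
      _ = 1 / K * ∑ z, ∑ c, q c z := by
          rw [← Finset.mul_sum]
          field_simp
      _ ≤ 1 / K * 1 := by
          refine mul_le_mul_of_nonneg_left ?_ (by positivity)
          exact (Finset.sum_le_sum fun z _ => hqp z).trans hp1
      _ = 1 / K := mul_one _
  obtain ⟨σ, -, hσ⟩ := exists_pos_le_of_sum_mul_le (μ := fun _ : Equiv.Perm C => 1 / F)
    (fun _ => by positivity) (by simp [hF]) hsum
  exact ⟨σ, hσ⟩

/-- Privacy amplification. `τ` is a reference law for the view `B`, and the probabilities restricted
to the good event `G` are below `τ / K` for each message. The second moment of the key probabilities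
is then small, so most conditional probabilities of the key are at most of order `1 / (K β²)`. -/
theorem exists_perm_le_condEnt [DecidableEq C] {P : Ω → ℝ} (hP : ∀ ω, 0 ≤ P ω)
    (h1 : ∑ ω, P ω = 1) (A : Ω → C) (B : Ω → Z) (G : Ω → Prop) {K : ℕ} (g : C → Fin K) {M : ℝ}
    (hg : ∀ s, ∑ c, ind (g c = s) = M) {τ : Z → ℝ} (hτ : ∀ z, 0 ≤ τ z) (hτ1 : ∑ z, τ z ≤ 1)
    (hQ : ∀ c z, ∑ ω, P ω * (ind (A ω = c) * ind (B ω = z) * ind (G ω)) ≤ τ z / K)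
    {β : ℝ} (hβ : 0 < β) (hG : ∑ ω, P ω * ind (¬ G ω) ≤ β) (hL : 1 ≤ K * β ^ 2 / 2) :
    ∃ σ : Equiv.Perm C, (1 - 6 * β) * Real.logb 2 (K * β ^ 2 / 2) ≤
      condEnt P (fun ω => g (σ (A ω))) B := by
  classical
  have hK : 0 < K := by
    rcases Nat.eq_zero_or_pos K with h | h
    · rw [h] at hL; norm_num at hL
    · exact h
  have hK' : (0 : ℝ) < K := by exact_mod_cast hK
  set q : C → Z → ℝ := fun c z => ∑ ω, P ω * (ind (A ω = c) * ind (B ω = z) * ind (G ω)) with hq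
  have hq0 : ∀ c z, 0 ≤ q c z := fun c z => Finset.sum_nonneg fun ω _ =>
    mul_nonneg (hP ω) (mul_nonneg (mul_nonneg (ind_nonneg _) (ind_nonneg _)) (ind_nonneg _))
  have hsumq : ∀ (F : C → ℝ) (z : Z), ∑ c, F c * q c z =
      ∑ ω, P ω * (F (A ω) * ind (B ω = z) * ind (G ω)) := by
    intro F z
    simp only [hq, Finset.mul_sum]
    rw [Finset.sum_comm]
    refine Finset.sum_congr rfl fun ω _ => ?_
    rw [← sum_ind_eq_mul (A ω) F, Finset.sum_mul, Finset.sum_mul, Finset.mul_sum]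
    exact Finset.sum_congr rfl fun c _ => by ring
  have hp0 : ∀ z, 0 ≤ law P B z := law_nonneg hP B
  have hp1 : ∑ z, law P B z = 1 := by rw [sum_law, h1]
  have hqp : ∀ z, ∑ c, q c z ≤ law P B z := by
    intro z
    have := hsumq (fun _ => 1) z
    simp only [one_mul] at this
    rw [this, law_eq_sum]
    refine Finset.sum_le_sum fun ω _ => mul_le_mul_of_nonneg_left ?_ (hP ω)
    exact mul_le_of_le_one_right (ind_nonneg _) (ind_le_one _)
  obtain ⟨σ, hσ⟩ := exists_perm_sum_sq_le hK g hg hq0 hτ hp0 hQ hqp hp1.le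
  refine ⟨σ, le_condEnt hP h1 _ B hL ?_⟩
  set J := law P fun ω => (g (σ (A ω)), B ω) with hJ
  set Q : Fin K → Z → ℝ := fun s z => ∑ c, ind (g (σ c) = s) * q c z with hQdef
  have hJ0 : ∀ x, 0 ≤ J x := law_nonneg hP _
  have hJe : ∀ s z, J (s, z) = ∑ ω, P ω * (ind (g (σ (A ω)) = s) * ind (B ω = z)) := by
    intro s z
    rw [hJ, law_eq_sum]
    exact Finset.sum_congr rfl fun ω _ => by rw [Prod.mk.injEq, ind_and]
  have hQ0 : ∀ s z, 0 ≤ Q s z := fun s z =>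
    Finset.sum_nonneg fun c _ => mul_nonneg (ind_nonneg _) (hq0 c z)
  have hJQ : ∀ s z, J (s, z) - Q s z =
      ∑ ω, P ω * (ind (g (σ (A ω)) = s) * ind (B ω = z) * ind (¬ G ω)) := by
    intro s z
    simp only [hQdef]
    rw [hJe, hsumq (fun c => ind (g (σ c) = s)), ← Finset.sum_sub_distrib]
    refine Finset.sum_congr rfl fun ω _ => ?_
    have : ind (¬ G ω) = 1 - ind (G ω) := by
      by_cases h : G ω <;> simp [ind, h]
    rw [this]; ring
  have hJQ0 : ∀ s z, 0 ≤ J (s, z) - Q s z := fun s z => by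
    rw [hJQ]
    exact Finset.sum_nonneg fun ω _ =>
      mul_nonneg (hP ω) (mul_nonneg (mul_nonneg (ind_nonneg _) (ind_nonneg _)) (ind_nonneg _))
  have hdiff : ∑ s, ∑ z, (J (s, z) - Q s z) ≤ β := by
    refine le_trans (le_of_eq ?_) hG
    simp only [hJQ]
    rw [Finset.sum_congr rfl fun s _ => Finset.sum_comm, Finset.sum_comm]
    refine Finset.sum_congr rfl fun ω _ => ?_
    simp only [← Finset.mul_sum, ← Finset.sum_mul, sum_ind_eq, mul_one, one_mul]
  have hmarg : ∀ z, ∑ s, J (s, z) = law P B z := by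
    intro z
    simp only [hJe]
    rw [Finset.sum_comm, law_eq_sum]
    refine Finset.sum_congr rfl fun ω _ => ?_
    simp only [← Finset.mul_sum, ← Finset.sum_mul, sum_ind_eq, one_mul]
  -- A pair that is too likely falls into one of three classes, each of total weight at most `2 *
  -- β`: more than half of its mass lies outside `G`; its view is rare compared with `τ + p`; or its
  -- mass is dominated by the second-moment term.
  have hpt : ∀ s z, J (s, z) * ind (law P B z < K * β ^ 2 / 2 * J (s, z)) ≤
      2 * (J (s, z) - Q s z) + J (s, z) * ind (law P B z < β * (τ z + law P B z)) +
        2 * K * β * (Q s z ^ 2 / (τ z + law P B z)) := by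
    intro s z
    have t1 := hJQ0 s z
    have t2 : 0 ≤ J (s, z) * ind (law P B z < β * (τ z + law P B z)) :=
      mul_nonneg (hJ0 _) (ind_nonneg _)
    have t3 : 0 ≤ 2 * K * β * (Q s z ^ 2 / (τ z + law P B z)) :=
      mul_nonneg (by positivity) (div_nonneg (sq_nonneg _) (add_nonneg (hτ z) (hp0 z)))
    by_cases h : law P B z < K * β ^ 2 / 2 * J (s, z)
    swap
    · rw [ind_false h, mul_zero]; linarith
    rw [ind_true h, mul_one]
    by_cases h2 : 2 * Q s z < J (s, z)
    · linarith
    push Not at h2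
    by_cases h3 : law P B z < β * (τ z + law P B z)
    · rw [ind_true h3]; linarith
    push Not at h3
    have hJpos : 0 < J (s, z) := by
      rcases (hJ0 (s, z)).eq_or_lt with h0 | h0
      · rw [← h0, mul_zero] at h
        exact absurd h (not_lt.mpr (hp0 z))
      · exact h0
    have hle : J (s, z) ≤ law P B z := by
      rw [← hmarg z]
      exact Finset.single_le_sum (f := fun s => J (s, z)) (fun s _ => hJ0 _) (mem_univ s)
    have hτp : 0 < τ z + law P B z := by linarith [hτ z]
    have hx : τ z + law P B z ≤ K * β * Q s z := by
      refine le_of_mul_le_mul_left ?_ hβ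
      calc β * (τ z + law P B z) ≤ K * β ^ 2 / 2 * J (s, z) := h3.trans h.le
        _ ≤ K * β ^ 2 / 2 * (2 * Q s z) := by gcongr
        _ = β * (K * β * Q s z) := by ring
    have : J (s, z) ≤ 2 * K * β * (Q s z ^ 2 / (τ z + law P B z)) := by
      rw [mul_div_assoc', le_div_iff₀ hτp]
      calc J (s, z) * (τ z + law P B z) ≤ (2 * Q s z) * (K * β * Q s z) := by
            gcongr
            exact mul_nonneg zero_le_two (hQ0 s z)
        _ = _ := by ring
    linarith
  rw [Fintype.sum_prod_type]
  refine (Finset.sum_le_sum fun s _ => Finset.sum_le_sum fun z _ => hpt s z).trans ?_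
  simp only [Finset.sum_add_distrib, ← Finset.mul_sum]
  have b2 : ∑ s, ∑ z, J (s, z) * ind (law P B z < β * (τ z + law P B z)) ≤ 2 * β := by
    rw [Finset.sum_comm]
    simp only [← Finset.sum_mul, hmarg]
    calc _ ≤ ∑ z, β * (τ z + law P B z) := by
          refine Finset.sum_le_sum fun z _ => ?_
          have : 0 ≤ β * (τ z + law P B z) := mul_nonneg hβ.le (add_nonneg (hτ z) (hp0 z))
          by_cases h : law P B z < β * (τ z + law P B z)
          · rw [ind_true h, mul_one]; exact h.le
          · rw [ind_false h, mul_zero]; exact this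
      _ ≤ 2 * β := by
          rw [← Finset.mul_sum, Finset.sum_add_distrib, hp1]
          nlinarith
  have b3 : 2 * K * β * ∑ s, ∑ z, Q s z ^ 2 / (τ z + law P B z) ≤ 2 * β := by
    rw [Finset.sum_comm]
    simp only [← Finset.sum_div]
    calc _ ≤ 2 * K * β * (1 / K) := mul_le_mul_of_nonneg_left hσ (by positivity)
      _ = 2 * β := by field_simp
  linarith

end Privacy
end SKE

namespace SKE

/-! ### Random coding -/

section Covering

/-- Bernoulli's inequality gives `(1 - x)^A ≤ 1 / (1 + A x)`, and `1 / (1 + A s / D) ≤ 1 - s + D /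
A`. This replaces the usual exponential estimate of the covering lemma. -/
theorem one_sub_pow_le {x s D : ℝ} {A : ℕ} (hA : 0 < A) (hx0 : 0 ≤ x) (hx1 : x ≤ 1)
    (hs0 : 0 ≤ s) (hs1 : s ≤ 1) (hD : 0 < D) (h : s ≤ D * x) :
    (1 - x) ^ A ≤ 1 - s + D / A := by
  have hA' : (0 : ℝ) < A := by exact_mod_cast hA
  have h1 : (1 - x) ^ A * (1 + A * x) ≤ 1 := by
    calc (1 - x) ^ A * (1 + A * x) ≤ (1 - x) ^ A * (1 + x) ^ A := by
          refine mul_le_mul_of_nonneg_left ?_ (pow_nonneg (by linarith) _)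
          exact one_add_mul_le_pow (by linarith) A
      _ = (1 - x ^ 2) ^ A := by rw [← mul_pow]; ring
      _ ≤ 1 := pow_le_one₀ (by nlinarith) (by nlinarith)
  have h2 : 1 ≤ (1 - s + D / A) * (1 + A * x) := by
    have h3 : A * s / D ≤ A * x := by
      rw [div_le_iff₀ hD]
      nlinarith
    have h4 : 0 ≤ 1 - s + D / A := by
      have : 0 ≤ D / A := by positivity
      linarith
    calc (1 : ℝ) ≤ 1 + D / A + A * s / D * (1 - s) := by
          have : 0 ≤ D / A := by positivity
          have : 0 ≤ A * s / D * (1 - s) := mul_nonneg (by positivity) (by linarith)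
          linarith
      _ = (1 - s + D / A) * (1 + A * s / D) := by field_simp; ring
      _ ≤ _ := by gcongr
  have h5 : 0 < 1 + A * x := by positivity
  exact le_of_mul_le_mul_right (h1.trans h2) h5

variable {V X Y Z : Type*} [Fintype V] [Fintype X] [Fintype Y] [Fintype Z]

/-- Random covering, with a choice rule whose outcome is moreover typical with the side
information. -/
theorem exists_covering_code {Q : X → Y → Z → ℝ} (hQ : ∀ x y z, 0 ≤ Q x y z) {pY : Y → ℝ}
    (hpY : ∀ y, ∑ x, ∑ z, Q x y z = pY y) (hpY1 : ∑ y, pY y = 1) {kV : Y → V → ℝ}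
    (hkV : ∀ y v, 0 ≤ kV y v) (hkV1 : ∀ y, ∑ v, kV y v = 1) {q : V → ℝ} (hq : ∀ v, 0 ≤ q v)
    (hq1 : ∑ v, q v = 1) (JT : V → Y → Prop) {D : ℝ} (hD : 0 < D)
    (hJT : ∀ v y, JT v y → kV y v ≤ D * q v) (T : V → X → Y → Z → Prop)
    (hTJ : ∀ v x y z, T v x y z → JT v y) {η η' : ℝ}
    (hη : ∑ y, ∑ v, kV y v * ∑ x, ∑ z, Q x y z * ind (¬ T v x y z) ≤ η)
    (hη' : 0 < η') (hη'1 : η' ≤ 1) {A : ℕ} (hA : 0 < A) :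
    ∃ (v : Fin A → V) (pk : Y → Fin A), (∀ i, 0 < q (v i)) ∧
      (∀ y, (∃ i, JT (v i) y) → JT (v (pk y)) y) ∧
      ∑ y, ∑ x, ∑ z, Q x y z * ind (¬ T (v (pk y)) x y z) ≤ η / η' + D / A + η' := by
  classical
  set bad : V → Y → ℝ := fun v y => ∑ x, ∑ z, Q x y z * ind (¬ T v x y z) with hbad
  have hbad0 : ∀ v y, 0 ≤ bad v y := fun v y => Finset.sum_nonneg fun x _ =>
    Finset.sum_nonneg fun z _ => mul_nonneg (hQ x y z) (ind_nonneg _)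
  have hbad1 : ∀ v y, bad v y ≤ pY y := fun v y => by
    rw [← hpY]
    exact Finset.sum_le_sum fun x _ => Finset.sum_le_sum fun z _ =>
      mul_le_of_le_one_right (hQ x y z) (ind_le_one _)
  have hpY0 : ∀ y, 0 ≤ pY y := fun y => by
    rw [← hpY]
    exact Finset.sum_nonneg fun x _ => Finset.sum_nonneg fun z _ => hQ x y z
  -- `G` asks that, besides joint typicality with `y`, the conditional probability of an atypical
  -- `(x, z)` be at most `η'`. By Markov's inequality few pairs fail this, which does the work of a
  -- Markov lemma.
  set G : V → Y → Prop := fun v y => JT v y ∧ bad v y ≤ η' * pY y with hG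
  have hbadG : ∀ v y, pY y * ind (¬ G v y) ≤ bad v y / η' := by
    intro v y
    by_cases hg : G v y
    · rw [ind_false (not_not.mpr hg), mul_zero]
      exact div_nonneg (hbad0 v y) hη'.le
    · rw [ind_true hg, mul_one, le_div_iff₀ hη']
      by_cases hj : JT v y
      · have : ¬ bad v y ≤ η' * pY y := fun h => hg ⟨hj, h⟩
        linarith
      · have : bad v y = pY y := by
          rw [← hpY]
          exact Finset.sum_congr rfl fun x _ => Finset.sum_congr rfl fun z _ => by
            rw [ind_true fun h => hj (hTJ v x y z h), mul_one]
        rw [this]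
        exact mul_le_of_le_one_right (hpY0 y) hη'1
  -- The probability that `A` independent codewords all miss `G`; the bound `kV ≤ D * q` transfers
  -- the covering mass from `kV` to the codeword law `q`.
  have hcover : ∀ y, (∑ v, q v * ind (¬ G v y)) ^ A ≤ 1 - ∑ v, kV y v * ind (G v y) + D / A := by
    intro y
    have e : ∑ v, q v * ind (¬ G v y) = 1 - ∑ v, q v * ind (G v y) := by
      rw [← hq1, ← Finset.sum_sub_distrib]
      refine Finset.sum_congr rfl fun v _ => ?_
      by_cases h : G v y <;> simp [ind, h]
    rw [e]
    refine one_sub_pow_le hA (Finset.sum_nonneg fun v _ => mul_nonneg (hq v) (ind_nonneg _)) ?_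
      (Finset.sum_nonneg fun v _ => mul_nonneg (hkV y v) (ind_nonneg _)) ?_ hD ?_
    · rw [← hq1]
      exact Finset.sum_le_sum fun v _ => mul_le_of_le_one_right (hq v) (ind_le_one _)
    · rw [← hkV1 y]
      exact Finset.sum_le_sum fun v _ => mul_le_of_le_one_right (hkV y v) (ind_le_one _)
    · rw [Finset.mul_sum]
      refine Finset.sum_le_sum fun v _ => ?_
      by_cases h : G v y
      · rw [ind_true h, mul_one, mul_one]
        exact hJT v y h.1
      · simp [ind_false h]
  have hexp : ∑ v : Fin A → V, (∏ i, q (v i)) * ∑ y, pY y * ind (∀ i, ¬ G (v i) y) ≤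
      η / η' + D / A := by
    have e : ∑ v : Fin A → V, (∏ i, q (v i)) * ∑ y, pY y * ind (∀ i, ¬ G (v i) y) =
        ∑ y, pY y * (∑ v, q v * ind (¬ G v y)) ^ A := by
      simp only [Finset.mul_sum]
      rw [Finset.sum_comm]
      refine Finset.sum_congr rfl fun y _ => ?_
      have := sum_prod_pi_const (ι := Fin A) (fun v => q v * ind (¬ G v y))
      rw [Fintype.card_fin] at this
      rw [← this, Finset.mul_sum]
      refine Finset.sum_congr rfl fun v _ => ?_
      rw [ind_forall, Finset.prod_mul_distrib]
      ring
    rw [e]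
    calc ∑ y, pY y * (∑ v, q v * ind (¬ G v y)) ^ A
        ≤ ∑ y, pY y * (1 - ∑ v, kV y v * ind (G v y) + D / A) :=
          Finset.sum_le_sum fun y _ => mul_le_mul_of_nonneg_left (hcover y) (hpY0 y)
      _ = ∑ y, (∑ v, kV y v * (pY y * ind (¬ G v y)) + pY y * (D / A)) := by
          refine Finset.sum_congr rfl fun y _ => ?_
          rw [mul_add]
          congr 1
          rw [← hkV1 y, ← Finset.sum_sub_distrib, Finset.mul_sum]
          refine Finset.sum_congr rfl fun v _ => ?_
          by_cases h : G v y
          · simp [ind, h]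
          · simp [ind, h]; ring
      _ ≤ ∑ y, (∑ v, kV y v * (bad v y / η') + pY y * (D / A)) := by
          refine Finset.sum_le_sum fun y _ => ?_
          gcongr with v _
          · exact hkV y v
          · exact hbadG v y
      _ ≤ η / η' + D / A := by
          rw [Finset.sum_add_distrib, ← Finset.sum_mul, hpY1, one_mul]
          have : ∑ y, ∑ v, kV y v * (bad v y / η') = (∑ y, ∑ v, kV y v * bad v y) / η' := by
            simp only [Finset.sum_div, mul_div_assoc]
          rw [this]
          gcongr
  obtain ⟨v, hv0, hv⟩ := exists_pos_le_of_sum_mul_le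
    (fun v : Fin A → V => Finset.prod_nonneg fun i _ => hq (v i))
    (by rw [sum_prod_pi_const, hq1, one_pow]) hexp
  -- The choice rule prefers a codeword in `G`, then any jointly typical one. As `G` implies joint
  -- typicality, the demand of the protocol is respected.
  have hpk : ∀ y, ∃ i, ((∃ i, JT (v i) y) → JT (v i) y) ∧ ((∃ i, G (v i) y) → G (v i) y) := by
    intro y
    by_cases h1 : ∃ i, G (v i) y
    · obtain ⟨i, hi⟩ := h1
      exact ⟨i, fun _ => hi.1, fun _ => hi⟩
    · by_cases h2 : ∃ i, JT (v i) y
      · obtain ⟨i, hi⟩ := h2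
        exact ⟨i, fun _ => hi, fun h => absurd h h1⟩
      · exact ⟨⟨0, hA⟩, fun h => absurd h h2, fun h => absurd h h1⟩
  choose pk hpk1 hpk2 using hpk
  -- The code was selected among those of positive weight, so every codeword lies in the support of
  -- `q`.
  refine ⟨v, pk, fun i => ?_, hpk1, ?_⟩
  · rcases (hq (v i)).eq_or_lt with h | h
    · rw [Finset.prod_eq_zero (mem_univ i) h.symm] at hv0
      exact absurd hv0 (lt_irrefl _)
    · exact h
  · have : ∀ y, bad (v (pk y)) y ≤ pY y * ind (∀ i, ¬ G (v i) y) + η' * pY y := by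
      intro y
      by_cases h : ∃ i, G (v i) y
      · have h1 := (hpk2 y h).2
        have h2 : 0 ≤ pY y * ind (∀ i, ¬ G (v i) y) := mul_nonneg (hpY0 y) (ind_nonneg _)
        linarith
      · rw [ind_true (not_exists.mp h), mul_one]
        have h1 := hbad1 (v (pk y)) y
        have h2 : 0 ≤ η' * pY y := mul_nonneg hη'.le (hpY0 y)
        linarith
    refine (Finset.sum_le_sum fun y _ => this y).trans ?_
    rw [Finset.sum_add_distrib, ← Finset.mul_sum, hpY1, mul_one]
    linarith

end Covering

/-! ### Superposition coding with random clouds -/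

section Superposition

variable {U W Y Z C S : Type*} [Fintype U] [Fintype W] [Fintype Y] [Fintype Z] [Fintype C]
  [Fintype S]

/-- Random superposition coding: `u` is a codebook of cloud centres, `w c` is a codeword of the
cloud `γ c`. -/
theorem exists_superposition_code {N : ℕ} (hN : 0 < N) {pU : U → ℝ} (hU : ∀ u, 0 ≤ pU u)
    (hU1 : ∑ u, pU u = 1) {κ : U → W → ℝ} (hκ : ∀ u w, 0 ≤ κ u w) (hκ1 : ∀ u, ∑ w, κ u w = 1)
    {k : W → Y → Z → ℝ} (hk : ∀ w y z, 0 ≤ k w y z) (hk1 : ∀ w, ∑ y, ∑ z, k w y z = 1)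
    (T : U → W → Y → Z → Prop) {η : ℝ}
    (hη : ∑ u, ∑ w, ∑ y, ∑ z, pU u * κ u w * k w y z * ind (¬ T u w y z) ≤ η)
    {pY : Y → ℝ} (hpY : ∀ y, ∑ u, ∑ w, pU u * κ u w * ∑ z, k w y z = pY y) {r : ℝ} (hr : 0 ≤ r)
    (hT : ∀ u w y z, T u w y z → ∑ w', κ u w' * ∑ z', k w' y z' ≤ r * pY y)
    {π : C → S → ℝ} (hπ : ∀ c s, 0 ≤ π c s) (hπ1 : ∑ c, ∑ s, π c s = 1)
    (Fit : C → W → S → Y → Prop) {ρ : C → S → ℝ} (hρ : ∀ c s, 0 ≤ ρ c s)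
    (hFit : ∀ c w s y, Fit c w s y → pY y ≤ ρ c s * ∑ z, k w y z) :
    ∃ (u : Fin N → U) (γ : C → Fin N) (w : C → W),
      ∑ c, ∑ s, π c s * ∑ y, ∑ z, k (w c) y z *
        ind (¬ (T (u (γ c)) (w c) y z ∧ ∀ c', c' ≠ c → ¬ Fit c' (w c') s y)) ≤
      η + (1 + r / N) * ∑ c, ∑ s, π c s * ∑ c', ρ c' s := by
  classical
  have hN' : (0 : ℝ) < N := by exact_mod_cast hN
  -- Given the cloud centres, each message independently receives a uniformly random cloud and a
  -- satellite drawn from it. Any two messages then share a cloud with probability `1 / N`, and no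
  -- separate cloud index is needed.
  set μ : (Fin N → U) → Fin N × W → ℝ := fun u a => 1 / N * κ (u a.1) a.2 with hμ
  have hμ0 : ∀ u a, 0 ≤ μ u a := fun u a => mul_nonneg (by positivity) (hκ _ _)
  have hμ1 : ∀ u, ∑ a, μ u a = 1 := by
    intro u
    rw [Fintype.sum_prod_type]
    simp only [hμ, ← Finset.mul_sum, hκ1]
    simp [hN'.ne']
  set cost : (Fin N → U) × (C → Fin N × W) → ℝ := fun x =>
    ∑ c, ∑ s, π c s * ∑ y, ∑ z, k (x.2 c).2 y z *
        ind (¬ (T (x.1 (x.2 c).1) (x.2 c).2 y z ∧ ∀ c', c' ≠ c → ¬ Fit c' (x.2 c').2 s y))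
    with hcost
  set wt : (Fin N → U) × (C → Fin N × W) → ℝ := fun x => (∏ j, pU (x.1 j)) * ∏ c, μ x.1 (x.2 c)
    with hwt
  have hwt0 : ∀ x, 0 ≤ wt x := fun x =>
    mul_nonneg (Finset.prod_nonneg fun j _ => hU _) (Finset.prod_nonneg fun c _ => hμ0 _ _)
  have hwt1 : ∑ x, wt x = 1 := by
    rw [Fintype.sum_prod_type]
    simp only [hwt, ← Finset.mul_sum]
    simp only [sum_prod_pi_const, hμ1, one_pow, mul_one, hU1]
  -- the two kinds of error
  set a : C → (Fin N → U) × (C → Fin N × W) → ℝ := fun c x =>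
    ∑ y, ∑ z, k (x.2 c).2 y z * ind (¬ T (x.1 (x.2 c).1) (x.2 c).2 y z) with ha
  set b : C → S → C → (Fin N → U) × (C → Fin N × W) → ℝ := fun c s c' x =>
    ∑ y, ∑ z, k (x.2 c).2 y z * (ind (T (x.1 (x.2 c).1) (x.2 c).2 y z) *
      ind (Fit c' (x.2 c').2 s y)) with hb
  have hsplit : ∀ x, cost x ≤ ∑ c, ∑ s, π c s * (a c x + ∑ c' ∈ univ.erase c, b c s c' x) := by
    intro x
    refine Finset.sum_le_sum fun c _ => Finset.sum_le_sum fun s _ =>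
      mul_le_mul_of_nonneg_left ?_ (hπ c s)
    simp only [ha, hb]
    rw [Finset.sum_comm (s := univ.erase c), ← Finset.sum_add_distrib]
    refine Finset.sum_le_sum fun y _ => ?_
    rw [Finset.sum_comm (s := univ.erase c), ← Finset.sum_add_distrib]
    refine Finset.sum_le_sum fun z _ => ?_
    rw [← Finset.mul_sum, ← mul_add]
    refine mul_le_mul_of_nonneg_left ?_ (hk _ _ _)
    have hnn : 0 ≤ ∑ c' ∈ univ.erase c, ind (T (x.1 (x.2 c).1) (x.2 c).2 y z) *
        ind (Fit c' (x.2 c').2 s y) :=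
      Finset.sum_nonneg fun c' _ => mul_nonneg (ind_nonneg _) (ind_nonneg _)
    by_cases h1 : T (x.1 (x.2 c).1) (x.2 c).2 y z
    · by_cases h2 : ∀ c', c' ≠ c → ¬ Fit c' (x.2 c').2 s y
      · rw [ind_false (not_not.mpr ⟨h1, h2⟩)]
        exact add_nonneg (ind_nonneg _) hnn
      · push Not at h2
        obtain ⟨c', hc', hf⟩ := h2
        have : 1 ≤ ∑ c' ∈ univ.erase c, ind (T (x.1 (x.2 c).1) (x.2 c).2 y z) *
            ind (Fit c' (x.2 c').2 s y) := by
          refine le_trans (le_of_eq ?_) (Finset.single_le_sum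
            (fun c' _ => mul_nonneg (ind_nonneg _) (ind_nonneg _))
            (Finset.mem_erase.mpr ⟨hc', mem_univ c'⟩))
          rw [ind_true h1, ind_true hf, one_mul]
        linarith [ind_le_one (¬ (T (x.1 (x.2 c).1) (x.2 c).2 y z ∧
          ∀ c', c' ≠ c → ¬ Fit c' (x.2 c').2 s y)), ind_nonneg (¬ T (x.1 (x.2 c).1) (x.2 c).2 y z)]
    · rw [ind_true h1]
      linarith [ind_le_one (¬ (T (x.1 (x.2 c).1) (x.2 c).2 y z ∧
          ∀ c', c' ≠ c → ¬ Fit c' (x.2 c').2 s y))]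
  have hEa : ∀ c, ∑ x, wt x * a c x ≤ η := by
    intro c
    set h : U → ℝ := fun u0 => ∑ w, κ u0 w * ∑ y, ∑ z, k w y z * ind (¬ T u0 w y z) with hh
    calc ∑ x, wt x * a c x
        = ∑ u : Fin N → U, (∏ j, pU (u j)) * ∑ t : C → Fin N × W, (∏ c, μ u (t c)) *
            ∑ y, ∑ z, k (t c).2 y z * ind (¬ T (u (t c).1) (t c).2 y z) := by
          rw [Fintype.sum_prod_type]
          simp only [hwt, ha, mul_assoc, Finset.mul_sum]
      _ = ∑ u : Fin N → U, (∏ j, pU (u j)) * ∑ j, 1 / N * h (u j) := by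
          refine Finset.sum_congr rfl fun u _ => ?_
          rw [sum_prod_mul_one (hμ1 u)
            (fun t => ∑ y, ∑ z, k t.2 y z * ind (¬ T (u t.1) t.2 y z)) c,
            Fintype.sum_prod_type]
          simp only [hμ, hh, mul_assoc, Finset.mul_sum]
      _ = ∑ j : Fin N, 1 / N * ∑ u : Fin N → U, (∏ j, pU (u j)) * h (u j) := by
          simp only [Finset.mul_sum]
          rw [Finset.sum_comm]
          exact Finset.sum_congr rfl fun j _ => Finset.sum_congr rfl fun u _ => by ring
      _ = ∑ u, pU u * h u := by
          simp only [sum_prod_mul_one hU1 h]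
          simp [hN'.ne']
      _ ≤ η := by
          refine le_trans (le_of_eq ?_) hη
          simp only [hh, Finset.mul_sum, mul_assoc]
  -- A wrong codeword from another cloud is independent of the output and fits with probability at
  -- most `ρ`. Within the same cloud it is only conditionally independent given the centre, which
  -- costs the factor `r` but happens with probability `1 / N`.
  have hEb : ∀ c s c', c' ≠ c → ∑ x, wt x * b c s c' x ≤ (1 + r / N) * ρ c' s := by
    intro c s c' hc
    set φ : U → Y → ℝ := fun u1 y => ∑ w, κ u1 w * ind (Fit c' w s y) with hφ
    have hφ0 : ∀ u y, 0 ≤ φ u y := fun u y =>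
      Finset.sum_nonneg fun w _ => mul_nonneg (hκ _ _) (ind_nonneg _)
    set f : U → U → ℝ := fun u0 u1 => ∑ w, ∑ y, ∑ z, κ u0 w * k w y z * ind (T u0 w y z) * φ u1 y
      with hf
    -- Change of measure: the fitting condition trades the law of an independent codeword against
    -- the channel law.
    have hφle : ∀ u y, pY y * φ u y ≤ ρ c' s * ∑ w, κ u w * ∑ z, k w y z := by
      intro u y
      simp only [hφ]
      rw [Finset.mul_sum, Finset.mul_sum]
      refine Finset.sum_le_sum fun w _ => ?_
      have hsk : 0 ≤ ∑ z, k w y z := Finset.sum_nonneg fun z _ => hk w y z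
      by_cases hfit : Fit c' w s y
      · rw [ind_true hfit, mul_one, mul_comm (pY y), mul_left_comm]
        exact mul_le_mul_of_nonneg_left (hFit c' w s y hfit) (hκ u w)
      · rw [ind_false hfit, mul_zero, mul_zero]
        exact mul_nonneg (hρ _ _) (mul_nonneg (hκ _ _) hsk)
    have hsupp : ∀ u w y z, 0 < pU u * κ u w * k w y z → 0 < pY y := by
      intro u w y z h
      rw [← hpY]
      have h0 : ∀ u w, 0 ≤ pU u * κ u w * ∑ z, k w y z := fun u w =>
        mul_nonneg (mul_nonneg (hU u) (hκ u w)) (Finset.sum_nonneg fun z _ => hk w y z)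
      calc 0 < pU u * κ u w * k w y z := h
        _ ≤ pU u * κ u w * ∑ z, k w y z := mul_le_mul_of_nonneg_left
            (Finset.single_le_sum (f := fun z => k w y z) (fun z _ => hk w y z) (mem_univ z))
            (mul_nonneg (hU u) (hκ u w))
        _ ≤ ∑ w, pU u * κ u w * ∑ z, k w y z :=
            Finset.single_le_sum (f := fun w => pU u * κ u w * ∑ z, k w y z)
              (fun w _ => h0 u w) (mem_univ w)
        _ ≤ _ := Finset.single_le_sum (f := fun u => ∑ w, pU u * κ u w * ∑ z, k w y z)
              (fun u _ => Finset.sum_nonneg fun w _ => h0 u w) (mem_univ u)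
    have hmass : ∀ t : ℝ, ∑ u, ∑ w, ∑ y, ∑ z, pU u * κ u w * k w y z * t = t := by
      intro t
      simp only [← Finset.sum_mul, ← Finset.mul_sum, hk1, mul_one, hκ1, hU1, one_mul]
    have hterm : ∀ u w y z (t M : ℝ), 0 ≤ M → 0 ≤ t → (0 < pY y → T u w y z → t ≤ M) →
        pU u * κ u w * k w y z * (ind (T u w y z) * t) ≤ pU u * κ u w * k w y z * M := by
      intro u w y z t M hM ht h
      rcases (mul_nonneg (mul_nonneg (hU u) (hκ u w)) (hk w y z)).eq_or_lt with h0 | h0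
      · simp [← h0]
      · refine mul_le_mul_of_nonneg_left ?_ h0.le
        by_cases hT' : T u w y z
        · rw [ind_true hT', one_mul]
          exact h (hsupp u w y z h0) hT'
        · rw [ind_false hT', zero_mul]; exact hM
    -- Shared cloud: `hT` bounds the output law given the centre by `r * pY` on typical runs.
    have hdiag : ∑ u, pU u * f u u ≤ r * ρ c' s := by
      calc ∑ u, pU u * f u u
          = ∑ u, ∑ w, ∑ y, ∑ z, pU u * κ u w * k w y z * (ind (T u w y z) * φ u y) := by
            simp only [hf, Finset.mul_sum, mul_assoc]
        _ ≤ ∑ u, ∑ w, ∑ y, ∑ z, pU u * κ u w * k w y z * (r * ρ c' s) := by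
            refine Finset.sum_le_sum fun u _ => Finset.sum_le_sum fun w _ =>
              Finset.sum_le_sum fun y _ => Finset.sum_le_sum fun z _ =>
              hterm u w y z _ _ (mul_nonneg hr (hρ _ _)) (hφ0 u y) fun hp hT' => ?_
            refine le_of_mul_le_mul_left ((hφle u y).trans ?_) hp
            calc _ ≤ ρ c' s * (r * pY y) :=
                  mul_le_mul_of_nonneg_left (hT u w y z hT') (hρ _ _)
              _ = _ := by ring
        _ = r * ρ c' s := hmass _
    -- Different clouds: averaging over the second centre restores the output law `pY` itself.
    have hoff : ∑ u, ∑ u', pU u * pU u' * f u u' ≤ ρ c' s := by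
      calc ∑ u, ∑ u', pU u * pU u' * f u u'
          = ∑ u, ∑ w, ∑ y, ∑ z, pU u * κ u w * k w y z *
              (ind (T u w y z) * ∑ u', pU u' * φ u' y) := by
            refine Finset.sum_congr rfl fun u _ => ?_
            simp only [hf, Finset.mul_sum]
            rw [Finset.sum_comm]
            refine Finset.sum_congr rfl fun w _ => ?_
            rw [Finset.sum_comm]
            refine Finset.sum_congr rfl fun y _ => ?_
            rw [Finset.sum_comm]
            refine Finset.sum_congr rfl fun z _ => ?_
            exact Finset.sum_congr rfl fun u' _ => by ring
        _ ≤ ∑ u, ∑ w, ∑ y, ∑ z, pU u * κ u w * k w y z * ρ c' s := by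
            refine Finset.sum_le_sum fun u _ => Finset.sum_le_sum fun w _ =>
              Finset.sum_le_sum fun y _ => Finset.sum_le_sum fun z _ =>
              hterm u w y z _ _ (hρ _ _)
                (Finset.sum_nonneg fun u' _ => mul_nonneg (hU u') (hφ0 u' y)) fun hp _ => ?_
            refine le_of_mul_le_mul_left ?_ hp
            rw [Finset.mul_sum]
            calc ∑ u', pY y * (pU u' * φ u' y)
                ≤ ∑ u', pU u' * (ρ c' s * ∑ w, κ u' w * ∑ z, k w y z) := by
                  refine Finset.sum_le_sum fun u' _ => ?_
                  rw [mul_left_comm]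
                  exact mul_le_mul_of_nonneg_left (hφle u' y) (hU u')
              _ = ρ c' s * ∑ u, ∑ w, pU u * κ u w * ∑ z, k w y z := by
                  rw [Finset.mul_sum]
                  refine Finset.sum_congr rfl fun u' _ => ?_
                  rw [mul_left_comm, Finset.mul_sum]
                  congr 1
                  exact Finset.sum_congr rfl fun w _ => by ring
              _ = pY y * ρ c' s := by rw [hpY, mul_comm]
        _ = ρ c' s := hmass _
    calc ∑ x, wt x * b c s c' x
        = ∑ u : Fin N → U, (∏ j, pU (u j)) * ∑ t : C → Fin N × W, (∏ c, μ u (t c)) *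
            ∑ y, ∑ z, k (t c).2 y z * (ind (T (u (t c).1) (t c).2 y z) *
              ind (Fit c' (t c').2 s y)) := by
          rw [Fintype.sum_prod_type]
          simp only [hwt, hb, mul_assoc, Finset.mul_sum]
      _ = ∑ u : Fin N → U, (∏ j, pU (u j)) * ∑ j, ∑ j', 1 / N * (1 / N) * f (u j) (u j') := by
          refine Finset.sum_congr rfl fun u _ => ?_
          rw [sum_prod_mul_two (hμ1 u) (fun t t' => ∑ y, ∑ z, k t.2 y z *
            (ind (T (u t.1) t.2 y z) * ind (Fit c' t'.2 s y))) hc.symm]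
          congr 1
          simp only [Fintype.sum_prod_type]
          refine Finset.sum_congr rfl fun j _ => ?_
          rw [Finset.sum_comm]
          refine Finset.sum_congr rfl fun j' _ => ?_
          simp only [hf, hφ, hμ, Finset.mul_sum]
          refine Finset.sum_congr rfl fun w _ => ?_
          rw [Finset.sum_comm]
          refine Finset.sum_congr rfl fun y _ => ?_
          rw [Finset.sum_comm]
          refine Finset.sum_congr rfl fun z _ => ?_
          exact Finset.sum_congr rfl fun w' _ => by ring
      _ = ∑ j : Fin N, ∑ j' : Fin N, 1 / N * (1 / N) *
            ∑ u : Fin N → U, (∏ j, pU (u j)) * f (u j) (u j') := by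
          simp only [Finset.mul_sum]
          rw [Finset.sum_comm]
          refine Finset.sum_congr rfl fun j _ => ?_
          rw [Finset.sum_comm]
          exact Finset.sum_congr rfl fun j' _ => Finset.sum_congr rfl fun u _ => by ring
      _ ≤ ∑ j : Fin N, ∑ j' : Fin N, 1 / N * (1 / N) * (ρ c' s + ind (j = j') * (r * ρ c' s)) := by
          refine Finset.sum_le_sum fun j _ => Finset.sum_le_sum fun j' _ =>
            mul_le_mul_of_nonneg_left ?_ (by positivity)
          by_cases hj : j = j'
          · subst hj
            rw [sum_prod_mul_one hU1 (fun u => f u u) j, ind_true rfl, one_mul]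
            linarith [hρ c' s]
          · rw [sum_prod_mul_two hU1 f hj, ind_false hj, zero_mul, add_zero]
            exact hoff
      _ = (1 + r / N) * ρ c' s := by
          simp only [← Finset.mul_sum, Finset.sum_add_distrib, sum_ind_eq_mul, ]
          simp only [sum_const, card_univ, Fintype.card_fin, nsmul_eq_mul]
          field_simp
  have hE : ∑ x, wt x * cost x ≤ η + (1 + r / N) * ∑ c, ∑ s, π c s * ∑ c', ρ c' s := by
    calc ∑ x, wt x * cost x
        ≤ ∑ x, wt x * ∑ c, ∑ s, π c s * (a c x + ∑ c' ∈ univ.erase c, b c s c' x) :=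
          Finset.sum_le_sum fun x _ => mul_le_mul_of_nonneg_left (hsplit x) (hwt0 x)
      _ = ∑ c, ∑ s, π c s * (∑ x, wt x * a c x +
            ∑ c' ∈ univ.erase c, ∑ x, wt x * b c s c' x) := by
          simp only [Finset.mul_sum]
          rw [Finset.sum_comm]
          refine Finset.sum_congr rfl fun c _ => ?_
          rw [Finset.sum_comm]
          refine Finset.sum_congr rfl fun s _ => ?_
          rw [Finset.sum_comm (s := univ.erase c), ← Finset.sum_add_distrib, Finset.mul_sum]
          refine Finset.sum_congr rfl fun x _ => ?_
          rw [← Finset.mul_sum]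
          ring
      _ ≤ ∑ c, ∑ s, π c s * (η + ∑ c', (1 + r / N) * ρ c' s) := by
          refine Finset.sum_le_sum fun c _ => Finset.sum_le_sum fun s _ =>
            mul_le_mul_of_nonneg_left (add_le_add (hEa c) ?_) (hπ c s)
          calc _ ≤ ∑ c' ∈ univ.erase c, (1 + r / N) * ρ c' s :=
                Finset.sum_le_sum fun c' hc' => hEb c s c' (Finset.ne_of_mem_erase hc')
            _ ≤ _ := Finset.sum_le_sum_of_subset_of_nonneg (Finset.erase_subset _ _)
                fun c' _ _ => mul_nonneg (by positivity) (hρ _ _)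
      _ = _ := by
          simp only [mul_add, Finset.sum_add_distrib, ← Finset.sum_mul, hπ1, one_mul,
            ← Finset.mul_sum]
          congr 1
          simp only [Finset.mul_sum]
          exact Finset.sum_congr rfl fun c _ => Finset.sum_congr rfl fun s _ =>
            Finset.sum_congr rfl fun c' _ => by ring
  obtain ⟨x, -, hx⟩ := exists_pos_le_of_sum_mul_le hwt0 hwt1 hE
  exact ⟨x.1, fun c => (x.2 c).1, fun c => (x.2 c).2, hx⟩

end Superposition
end SKE

namespace SKE

/-! ### Existence of a one-shot code -/

section OneShot

variable {V X Y Z U W Y' Z' : Type*} [Fintype V] [Fintype X] [Fintype Y] [Fintype Z]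
  [Fintype U] [Fintype W] [Fintype Y'] [Fintype Z']

/-- A covering code for the initiator's channel combined with a superposition code for the
responder's channel. -/
theorem exists_code {Q : X → Y → Z → ℝ} (hQ : ∀ x y z, 0 ≤ Q x y z) {pY : Y → ℝ}
    (hpY : ∀ y, ∑ x, ∑ z, Q x y z = pY y) (hpY1 : ∑ y, pY y = 1) {kV : Y → V → ℝ}
    (hkV : ∀ y v, 0 ≤ kV y v) (hkV1 : ∀ y, ∑ v, kV y v = 1) {q : V → ℝ} (hq : ∀ v, 0 ≤ q v)
    (hq1 : ∑ v, q v = 1) (JT : V → Y → Prop) {D : ℝ} (hD : 0 < D)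
    (hJT : ∀ v y, JT v y → kV y v ≤ D * q v) (T : V → X → Y → Z → Prop)
    (hTJ : ∀ v x y z, T v x y z → JT v y) {η₁ η' : ℝ}
    (hη₁ : ∑ y, ∑ v, kV y v * ∑ x, ∑ z, Q x y z * ind (¬ T v x y z) ≤ η₁)
    (hη' : 0 < η') (hη'1 : η' ≤ 1) {A : ℕ} (hA : 0 < A)
    {N : ℕ} (hN : 0 < N) {pU : U → ℝ} (hU : ∀ u, 0 ≤ pU u)
    (hU1 : ∑ u, pU u = 1) {κ : U → W → ℝ} (hκ : ∀ u w, 0 ≤ κ u w) (hκ1 : ∀ u, ∑ w, κ u w = 1)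
    {k : W → Y' → Z' → ℝ} (hk : ∀ w y z, 0 ≤ k w y z) (hk1 : ∀ w, ∑ y, ∑ z, k w y z = 1)
    (T' : U → W → Y' → Z' → Prop) {η₂ : ℝ}
    (hη₂ : ∑ u, ∑ w, ∑ y, ∑ z, pU u * κ u w * k w y z * ind (¬ T' u w y z) ≤ η₂)
    {pY' : Y' → ℝ} (hpY' : ∀ y, ∑ u, ∑ w, pU u * κ u w * ∑ z, k w y z = pY' y)
    {r : ℝ} (hr : 0 ≤ r)
    (hT' : ∀ u w y z, T' u w y z → ∑ w', κ u w' * ∑ z', k w' y z' ≤ r * pY' y)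
    (Fit : V → W → X → Y' → Prop) {ρ : V → X → ℝ} (hρ : ∀ v x, 0 ≤ ρ v x)
    (hρ1 : ∀ v, ∑ x, (∑ y, ∑ z, Q x y z) * ρ v x ≤ 1) {θ : ℝ} (hθ : 0 < θ)
    (hFit : ∀ v w x y, Fit v w x y → θ * pY' y ≤ ρ v x * ∑ z, k w y z) {B : ℕ} (hB : 0 < B) :
    ∃ (v : Fin A → V) (pk : Y → Fin A) (u : Fin N → U) (γ : Fin A × Fin B → Fin N)
      (w : Fin A × Fin B → W), (∀ i, 0 < q (v i)) ∧
      (∀ y, (∃ i, JT (v i) y) → JT (v (pk y)) y) ∧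
      ∑ y, ∑ x, ∑ z, Q x y z * ∑ j, 1 / (B : ℝ) * ∑ y', ∑ z', k (w (pk y, j)) y' z' *
        ind (¬ (T (v (pk y)) x y z ∧ T' (u (γ (pk y, j))) (w (pk y, j)) y' z' ∧
          ∀ c', c' ≠ (pk y, j) → ¬ Fit (v c'.1) (w c') x y')) ≤
        η₁ / η' + D / A + η' + (η₂ + (1 + r / N) * (A * B / θ)) := by
  classical
  have hB' : (0 : ℝ) < B := by exact_mod_cast hB
  obtain ⟨v, pk, hv, hpk, herr⟩ := exists_covering_code hQ hpY hpY1 hkV hkV1 hq hq1 JT hD hJT T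
    hTJ hη₁ hη' hη'1 hA
  -- The joint law of the message and of the initiator's sequence `x`, which is the side information
  -- of the decoder.
  set π : Fin A × Fin B → X → ℝ := fun c x => ∑ y, ∑ z, Q x y z * (ind (pk y = c.1) * (1 / B))
    with hπ
  have hπF : ∀ F : Fin A × Fin B → X → ℝ, ∑ c, ∑ x, π c x * F c x =
      ∑ y, ∑ x, ∑ z, Q x y z * ∑ j, 1 / (B : ℝ) * F (pk y, j) x := by
    intro F
    calc ∑ c, ∑ x, π c x * F c x
        = ∑ c : Fin A × Fin B, ∑ y, ∑ x, ∑ z,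
            Q x y z * (ind (pk y = c.1) * (1 / B)) * F c x := by
          refine Finset.sum_congr rfl fun c _ => ?_
          simp only [hπ, Finset.sum_mul]
          rw [Finset.sum_comm]
      _ = ∑ y, ∑ x, ∑ z, ∑ c : Fin A × Fin B,
            Q x y z * (ind (pk y = c.1) * (1 / B)) * F c x := by
          rw [Finset.sum_comm]
          refine Finset.sum_congr rfl fun y _ => ?_
          rw [Finset.sum_comm]
          refine Finset.sum_congr rfl fun x _ => ?_
          rw [Finset.sum_comm]
      _ = _ := by
          refine Finset.sum_congr rfl fun y _ => Finset.sum_congr rfl fun x _ =>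
            Finset.sum_congr rfl fun z _ => ?_
          rw [Fintype.sum_prod_type, ← sum_ind_eq_mul (pk y)
            (fun i => ∑ j, 1 / (B : ℝ) * F (i, j) x), Finset.mul_sum]
          refine Finset.sum_congr rfl fun i _ => ?_
          rw [Finset.mul_sum, Finset.mul_sum]
          exact Finset.sum_congr rfl fun j _ => by ring
  have hπ0 : ∀ c x, 0 ≤ π c x := fun c x => Finset.sum_nonneg fun y _ =>
    Finset.sum_nonneg fun z _ => mul_nonneg (hQ x y z) (mul_nonneg (ind_nonneg _) (by positivity))
  have hQ1 : ∑ y, ∑ x, ∑ z, Q x y z = 1 := by simp only [hpY, hpY1]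
  have hπ1 : ∑ c, ∑ x, π c x = 1 := by
    have := hπF fun _ _ => 1
    simp only [mul_one] at this
    have hone : ∑ _j : Fin B, 1 / (B : ℝ) = 1 := by simp [hB'.ne']
    simp only [this, hone, mul_one, hQ1]
  obtain ⟨u, γ, w, hcode⟩ := exists_superposition_code (C := Fin A × Fin B) (S := X) hN hU hU1 hκ
    hκ1 hk hk1 T' hη₂ hpY' hr hT' hπ0 hπ1 (fun c w x y => Fit (v c.1) w x y)
    (ρ := fun c x => ρ (v c.1) x / θ) (fun c x => div_nonneg (hρ _ _) hθ.le)
    (fun c w x y h => by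
      rw [div_mul_eq_mul_div, le_div_iff₀ hθ, mul_comm]
      exact hFit _ _ _ _ h)
  refine ⟨v, pk, u, γ, w, hv, hpk, ?_⟩
  -- The sum over competitors depends on `x` only, so just the marginal law of `x` enters and `hρ1`
  -- applies to each competitor. Competitors with the same covering codeword need no separate
  -- treatment.
  have hconf : ∑ c, ∑ x, π c x * ∑ c' : Fin A × Fin B, ρ (v c'.1) x / θ ≤ A * B / θ := by
    rw [hπF fun _ x => ∑ c' : Fin A × Fin B, ρ (v c'.1) x / θ]
    calc _ = ∑ c' : Fin A × Fin B, (∑ x, (∑ y, ∑ z, Q x y z) * ρ (v c'.1) x) / θ := by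
          simp only [sum_const, card_univ, Fintype.card_fin, nsmul_eq_mul]
          rw [Finset.sum_comm]
          simp only [Finset.sum_div]
          rw [Finset.sum_comm (s := (univ : Finset (Fin A × Fin B)))]
          refine Finset.sum_congr rfl fun x _ => ?_
          simp only [← Finset.sum_mul, ← Finset.sum_div, ← Finset.mul_sum]
          field_simp
      _ ≤ ∑ c' : Fin A × Fin B, 1 / θ := by
          refine Finset.sum_le_sum fun c' _ => ?_
          gcongr
          exact hρ1 _
      _ = A * B / θ := by simp [div_eq_mul_inv]
  rw [hπF fun c x => ∑ y', ∑ z', k (w c) y' z' * ind (¬ (T' (u (γ c)) (w c) y' z' ∧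
    ∀ c', c' ≠ c → ¬ Fit (v c'.1) (w c') x y'))] at hcode
  have hmass : ∀ (t : ℝ) (i : Fin A), ∑ j : Fin B, 1 / (B : ℝ) *
      ∑ y', ∑ z', k (w (i, j)) y' z' * t = t := by
    intro t i
    simp only [← Finset.sum_mul, hk1]
    simp [hB'.ne']
  calc _ ≤ ∑ y, ∑ x, ∑ z, Q x y z * (ind (¬ T (v (pk y)) x y z) +
        ∑ j, 1 / (B : ℝ) * ∑ y', ∑ z', k (w (pk y, j)) y' z' *
          ind (¬ (T' (u (γ (pk y, j))) (w (pk y, j)) y' z' ∧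
          ∀ c', c' ≠ (pk y, j) → ¬ Fit (v c'.1) (w c') x y'))) := by
        refine Finset.sum_le_sum fun y _ => Finset.sum_le_sum fun x _ =>
          Finset.sum_le_sum fun z _ => mul_le_mul_of_nonneg_left ?_ (hQ x y z)
        rw [← hmass (ind (¬ T (v (pk y)) x y z)) (pk y), ← Finset.sum_add_distrib]
        refine Finset.sum_le_sum fun j _ => ?_
        rw [← mul_add]
        refine mul_le_mul_of_nonneg_left ?_ (by positivity)
        rw [← Finset.sum_add_distrib]
        refine Finset.sum_le_sum fun y' _ => ?_
        rw [← Finset.sum_add_distrib]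
        refine Finset.sum_le_sum fun z' _ => ?_
        rw [← mul_add]
        refine mul_le_mul_of_nonneg_left ?_ (hk _ _ _)
        refine le_trans (ind_mono fun h => ?_) (ind_or_le _ _)
        by_contra hc
        push Not at hc
        exact h ⟨hc.1, hc.2.1, hc.2.2⟩
    _ ≤ _ := by
        simp only [mul_add, Finset.sum_add_distrib]
        have hN' : 0 ≤ 1 + r / N := by positivity
        exact add_le_add herr (hcode.trans
          (add_le_add le_rfl (mul_le_mul_of_nonneg_left hconf hN')))

end OneShot

/-! ### Joint law of the chosen covering codeword and the eavesdropper's observation -/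

section Picked

variable {V X Y Z : Type*} [Fintype X] [Fintype Y]

/-- The joint probability of a picked covering codeword and of the eavesdropper's observation. -/
theorem sum_picked_le {A : Type*} {Q : X → Y → Z → ℝ} (hQ : ∀ x y z, 0 ≤ Q x y z)
    {kV : Y → V → ℝ} (hkV : ∀ y v, 0 ≤ kV y v) {pV : V → ℝ} {pZ : Z → ℝ} (hpZ : ∀ z, 0 ≤ pZ z)
    (T : V → X → Y → Z → Prop) {s₁ s₂ : ℝ} (hs₁ : 0 < s₁) (hs₂ : 0 ≤ s₂)
    (hT0 : ∀ v x y z, T v x y z → 0 < pV v)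
    (hT1 : ∀ v x y z, T v x y z → s₁ * pV v ≤ kV y v)
    (hT2 : ∀ v x y z, T v x y z → ∑ y, ∑ x, Q x y z * kV y v ≤ s₂ * (pV v * pZ z))
    (v : A → V) (pk : Y → A) (i : A) (z : Z) :
    ∑ y, ∑ x, Q x y z * (ind (pk y = i) * ind (T (v i) x y z)) ≤ s₂ / s₁ * pZ z := by
  by_cases h : ∃ x y, T (v i) x y z
  · obtain ⟨x₀, y₀, h₀⟩ := h
    have hp := hT0 _ _ _ _ h₀
    -- On `T` the indicator of the choice is at most `kV y v / (s₁ * pV v)`. So an arbitrary choice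
    -- rule is dominated by the test channel `kV`, and the sum becomes the joint law of codeword and
    -- observation.
    calc _ ≤ ∑ y, ∑ x, Q x y z * kV y (v i) * (1 / (s₁ * pV (v i))) := by
          refine Finset.sum_le_sum fun y _ => Finset.sum_le_sum fun x _ => ?_
          rw [mul_assoc]
          refine mul_le_mul_of_nonneg_left ?_ (hQ x y z)
          by_cases hT : T (v i) x y z
          · rw [ind_true hT, mul_one, mul_one_div, le_div_iff₀ (by positivity)]
            calc ind (pk y = i) * (s₁ * pV (v i)) ≤ 1 * (s₁ * pV (v i)) := by
                  gcongr
                  exact ind_le_one _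
              _ ≤ _ := by rw [one_mul]; exact hT1 _ _ _ _ hT
          · rw [ind_false hT, mul_zero]
            exact mul_nonneg (hkV _ _) (by positivity)
      _ = (∑ y, ∑ x, Q x y z * kV y (v i)) * (1 / (s₁ * pV (v i))) := by
          simp only [Finset.sum_mul]
      _ ≤ (s₂ * (pV (v i) * pZ z)) * (1 / (s₁ * pV (v i))) := by
          gcongr
          exact hT2 _ _ _ _ h₀
      _ = s₂ / s₁ * pZ z := by field_simp
  · have : ∑ y, ∑ x, Q x y z * (ind (pk y = i) * ind (T (v i) x y z)) = 0 :=
      Finset.sum_eq_zero fun y _ => Finset.sum_eq_zero fun x _ => by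
        rw [ind_false fun hT => h ⟨x, y, hT⟩, mul_zero, mul_zero]
    rw [this]
    exact mul_nonneg (div_nonneg hs₂ hs₁.le) (hpZ z)

end Picked

/-! ### Sequences -/

section Sequences

theorem sum_pi_prod {ι α β : Type*} [Fintype ι] [DecidableEq ι] [Fintype α] [Fintype β]
    (F : (ι → α × β) → ℝ) :
    ∑ f, F f = ∑ a : ι → α, ∑ b : ι → β, F fun i => (a i, b i) := by
  rw [← Fintype.sum_prod_type']
  exact Fintype.sum_equiv (Equiv.arrowProdEquivProdArrow ι (fun _ => α) fun _ => β) _ _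
    fun f => rfl

theorem sum_fin_add {α : Type*} [Fintype α] {m n : ℕ} (F : (Fin (m + n) → α) → ℝ) :
    ∑ f, F f = ∑ a : Fin m → α, ∑ b : Fin n → α, F (Fin.append a b) := by
  rw [← Fintype.sum_prod_type', ← Equiv.sum_comp (Fin.appendEquiv m n)]
  rfl

variable {Ω α : Type*} [Fintype Ω]

/-- The entries of `ω` have positive probability and the empirical means of the functions `f t`
are `ε`-close to their expectations. -/
def EmpTypical {ι : Type*} (P : Ω → ℝ) (f : ι → Ω → ℝ) (ε : ℝ) {n : ℕ} (ω : Fin n → Ω) : Prop :=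
  (∀ i, 0 < P (ω i)) ∧ ∀ t, |∑ i, f t (ω i) - n * ∑ a, P a * f t a| ≤ n * ε

/-- Chebyshev's inequality and a union bound over `ι`; the constant is independent of `n`. -/
theorem exists_sum_not_empTypical_le {ι : Type*} [Fintype ι] {P : Ω → ℝ} (hP : ∀ a, 0 ≤ P a)
    (h1 : ∑ a, P a = 1) (f : ι → Ω → ℝ) {ε : ℝ} (hε : 0 < ε) :
    ∃ c : ℝ, 0 ≤ c ∧ ∀ n : ℕ,
      ∑ ω : Fin n → Ω, (∏ i, P (ω i)) * ind (¬ EmpTypical P f ε ω) ≤ c / n := by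
  refine ⟨∑ t, (∑ a, P a * (f t a - ∑ b, P b * f t b) ^ 2) / ε ^ 2,
    Finset.sum_nonneg fun t _ => div_nonneg
      (Finset.sum_nonneg fun a _ => mul_nonneg (hP a) (sq_nonneg _)) (sq_nonneg _), fun n => ?_⟩
  calc ∑ ω : Fin n → Ω, (∏ i, P (ω i)) * ind (¬ EmpTypical P f ε ω)
      ≤ ∑ ω : Fin n → Ω, ∑ t, (∏ i, P (ω i)) *
          ind (n * ε < |∑ i, f t (ω i) - n * ∑ a, P a * f t a|) := by
        refine Finset.sum_le_sum fun ω _ => ?_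
        rw [← Finset.mul_sum]
        by_cases hpos : ∀ i, 0 < P (ω i)
        · refine mul_le_mul_of_nonneg_left ?_ (Finset.prod_nonneg fun i _ => hP _)
          refine le_trans (ind_mono fun h => ?_) (ind_exists_le _)
          by_contra hc
          push Not at hc
          exact h ⟨hpos, hc⟩
        · push Not at hpos
          obtain ⟨i, hi⟩ := hpos
          rw [Finset.prod_eq_zero (mem_univ i) (le_antisymm hi (hP _)), zero_mul, zero_mul]
    _ ≤ ∑ t, (∑ a, P a * (f t a - ∑ b, P b * f t b) ^ 2) / (n * ε ^ 2) := by
        rw [Finset.sum_comm]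
        exact Finset.sum_le_sum fun t _ => sum_prod_mul_ind_lt_abs_le hP h1 (f t) n hε
    _ = _ := by
        rw [Finset.sum_div]
        exact Finset.sum_congr rfl fun t _ => by rw [div_div, mul_comm (ε ^ 2)]

theorem seqProb_pos {p : α → ℝ} {n : ℕ} {u : Fin n → α} (h : ∀ i, 0 < p (u i)) :
    0 < seqProb p u := Finset.prod_pos fun _ _ => h _

theorem seqProb_nonneg {p : α → ℝ} (hp : ∀ a, 0 ≤ p a) {n : ℕ} (u : Fin n → α) :
    0 ≤ seqProb p u := Finset.prod_nonneg fun _ _ => hp _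

theorem sum_seqProb [Fintype α] (p : α → ℝ) (h : ∑ a, p a = 1) (n : ℕ) :
    ∑ u : Fin n → α, seqProb p u = 1 := by
  simp only [seqProb, sum_prod_pi_const, h, one_pow]

theorem logb_seqProb {p : α → ℝ} {n : ℕ} {u : Fin n → α} (h : ∀ i, 0 < p (u i)) :
    Real.logb 2 (seqProb p u) = ∑ i, Real.logb 2 (p (u i)) :=
  Real.logb_prod _ _ fun i _ => (h i).ne'

theorem seqProb_append {p : α → ℝ} {m n : ℕ} (u : Fin m → α) (t : Fin n → α) :
    seqProb p (Fin.append u t) = seqProb p u * seqProb p t := by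
  simp [seqProb, Fin.prod_univ_add]

theorem pos_of_seqProb_pos {p : α → ℝ} (hp : ∀ a, 0 ≤ p a) {n : ℕ} {u : Fin n → α}
    (h : 0 < seqProb p u) (i : Fin n) : 0 < p (u i) := by
  rcases (hp (u i)).eq_or_lt with h0 | h0
  · rw [seqProb, Finset.prod_eq_zero (mem_univ i) h0.symm] at h
    exact absurd h (lt_irrefl _)
  · exact h0

/-- Typicality controls the probability of a sequence of values of a random variable. -/
theorem EmpTypical.abs_logb_le {ι β : Type*} [Fintype β] {P : Ω → ℝ} (hP : ∀ a, 0 ≤ P a)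
    {f : ι → Ω → ℝ}
    {ε : ℝ} {n : ℕ} {ω : Fin n → Ω} (h : EmpTypical P f ε ω) (A : Ω → β) (t : ι)
    (hA : f t = surp P A) :
    |Real.logb 2 (seqProb (law P A) fun i => A (ω i)) + n * ent P A| ≤ n * ε := by
  have h2 := h.2 t
  rw [logb_seqProb fun i => law_pos hP A (h.1 i)]
  rw [hA, ← ent_eq_sum] at h2
  simp only [surp, Finset.sum_neg_distrib] at h2
  rw [← abs_neg]
  convert h2 using 2
  ring

theorem NearEntropy.abs_logb_le {ε P h : ℝ} {N : ℕ} (hN : 0 < N) (H : NearEntropy ε N P h) :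
    |Real.logb 2 P + h| ≤ N * ε := by
  have hN' : (0 : ℝ) < N := by exact_mod_cast hN
  have := H.2.le
  rw [show -(1 / (N : ℝ)) * Real.logb 2 P - h / N = -((Real.logb 2 P + h) / N) by ring, abs_neg,
    abs_div, abs_of_pos hN', div_le_iff₀ hN'] at this
  linarith

theorem nearEntropy_of_abs_logb_lt {ε P h : ℝ} {N : ℕ} (hN : 0 < N) (hP : 0 < P)
    (H : |Real.logb 2 P + h| < N * ε) : NearEntropy ε N P h := by
  have hN' : (0 : ℝ) < N := by exact_mod_cast hN
  refine ⟨hP, ?_⟩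
  rw [show -(1 / (N : ℝ)) * Real.logb 2 P - h / N = -((Real.logb 2 P + h) / N) by ring, abs_neg,
    abs_div, abs_of_pos hN', div_lt_iff₀ hN']
  linarith

/-- Comparison of products of positive numbers through their logarithms. -/
theorem le_rpow_mul_of_logb_le {a b x : ℝ} (ha : 0 < a) (hb : 0 < b)
    (h : Real.logb 2 a ≤ x + Real.logb 2 b) : a ≤ (2 : ℝ) ^ x * b := by
  rw [← Real.logb_le_logb one_lt_two ha (by positivity),
    Real.logb_mul (by positivity) hb.ne', Real.logb_rpow two_pos (by norm_num)]
  exact h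

end Sequences
end SKE

namespace SKE

/-! ### Laws of product form -/

theorem sum_mul_ind_eq {α : Type*} [Fintype α] (a : α) (F : α → ℝ) :
    ∑ b, F b * ind (b = a) = F a := by
  rw [← sum_ind_eq_mul a F]
  exact Finset.sum_congr rfl fun b _ => by
    rw [mul_comm, show (b = a) = (a = b) from propext eq_comm]

theorem sum_sum_prod_pi {ι α β : Type*} [Fintype ι] [DecidableEq ι] [Fintype α] [Fintype β]
    (F : ι → α → β → ℝ) :
    ∑ x : ι → α, ∑ z : ι → β, ∏ i, F i (x i) (z i) = ∏ i, ∑ a, ∑ b, F i a b := by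
  rw [← sum_prod_pi fun i a => ∑ b, F i a b]
  exact Finset.sum_congr rfl fun x _ => sum_prod_pi fun i b => F i (x i) b

theorem stdSimplex_nonneg {α : Type*} [Fintype α] (p : stdSimplex ℝ α) (a : α) : 0 ≤ p.1 a :=
  p.2.1 a

theorem stdSimplex_sum {α : Type*} [Fintype α] (p : stdSimplex ℝ α) : ∑ a, p.1 a = 1 := p.2.2

/-! ### The initiator's channel -/

namespace Selection

variable {X₁ Y₁ Z₁ X₂ : Type*} [Fintype X₁] [Fintype Y₁] [Fintype Z₁] [Fintype X₂]
  (s : Selection X₁ Y₁ X₂) (C₁ : DMBC X₁ Y₁ Z₁)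

theorem law₁_nonneg (ω : Fin s.v × X₁ × Y₁ × Z₁) : 0 ≤ s.law₁ C₁ ω :=
  mul_nonneg (mul_nonneg (stdSimplex_nonneg _ _) (stdSimplex_nonneg _ _)) (stdSimplex_nonneg _ _)

theorem sum_sum_channel (x : X₁) : ∑ y, ∑ z, (C₁ x).1 (y, z) = 1 := by
  rw [← Fintype.sum_prod_type']
  exact stdSimplex_sum _

theorem sum_law₁ : ∑ ω, s.law₁ C₁ ω = 1 := by
  simp only [Fintype.sum_prod_type, law₁]
  rw [Finset.sum_comm]
  simp only [Finset.sum_comm (s := (univ : Finset (Fin s.v)))]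
  simp only [← Finset.mul_sum, stdSimplex_sum, mul_one, sum_sum_channel]

/-- `I(V; X₁)`. -/
noncomputable def infoVX : ℝ :=
  ent (s.law₁ C₁) (fun ω => ω.1) + ent (s.law₁ C₁) (fun ω => ω.2.1) -
    ent (s.law₁ C₁) (fun ω => (ω.1, ω.2.1))

/-- `I(V; Y₁)`. -/
noncomputable def infoVY : ℝ :=
  ent (s.law₁ C₁) (fun ω => ω.1) + ent (s.law₁ C₁) (fun ω => ω.2.2.1) -
    ent (s.law₁ C₁) (fun ω => (ω.1, ω.2.2.1))

/-- `I(V; Z₁)`. -/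
noncomputable def infoVZ : ℝ :=
  ent (s.law₁ C₁) (fun ω => ω.1) + ent (s.law₁ C₁) (fun ω => ω.2.2.2) -
    ent (s.law₁ C₁) (fun ω => (ω.1, ω.2.2.2))

theorem Rs₁_eq : s.Rs₁ C₁ = s.infoVX C₁ - s.infoVZ C₁ := by
  have h1 : mutInfo (s.law₁ C₁) (fun (v, _, _, _) => v) (fun (_, x, _, _) => x) =
      s.infoVX C₁ := by
    unfold mutInfo condEnt infoVX
    change ent (s.law₁ C₁) (fun ω => ω.1) - (ent (s.law₁ C₁) (fun ω => (ω.1, ω.2.1)) -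
      ent (s.law₁ C₁) (fun ω => ω.2.1)) = _
    ring
  have h2 : mutInfo (s.law₁ C₁) (fun (v, _, _, _) => v) (fun (_, _, _, z) => z) =
      s.infoVZ C₁ := by
    unfold mutInfo condEnt infoVZ
    change ent (s.law₁ C₁) (fun ω => ω.1) - (ent (s.law₁ C₁) (fun ω => (ω.1, ω.2.2.2)) -
      ent (s.law₁ C₁) (fun ω => ω.2.2.2)) = _
    ring
  rw [Rs₁, h1, h2]

theorem law₁_Y (y : Y₁) :
    law (s.law₁ C₁) (fun ω => ω.2.2.1) y = ∑ x, ∑ z, s.pX.1 x * (C₁ x).1 (y, z) := by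
  rw [law_eq_sum]
  simp only [Fintype.sum_prod_type, law₁]
  rw [Finset.sum_comm]
  refine Finset.sum_congr rfl fun x _ => ?_
  simp only [← Finset.sum_mul]
  rw [Finset.sum_comm]
  simp only [sum_mul_ind_eq, ← Finset.sum_mul]
  simp only [← Finset.mul_sum, stdSimplex_sum, mul_one]

theorem law₁_X (x : X₁) :
    law (s.law₁ C₁) (fun ω => ω.2.1) x = ∑ y, ∑ z, s.pX.1 x * (C₁ x).1 (y, z) := by
  rw [law_eq_sum]
  simp only [Fintype.sum_prod_type, law₁]
  rw [Finset.sum_comm]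
  simp only [← Finset.sum_mul, sum_mul_ind_eq]
  rw [Finset.sum_comm]
  refine Finset.sum_congr rfl fun y _ => ?_
  rw [← Finset.mul_sum, stdSimplex_sum, mul_one]

theorem law₁_VY (v : Fin s.v) (y : Y₁) :
    law (s.law₁ C₁) (fun ω => (ω.1, ω.2.2.1)) (v, y) =
      law (s.law₁ C₁) (fun ω => ω.2.2.1) y * (s.pV y).1 v := by
  rw [law_eq_sum, law₁_Y]
  simp only [Fintype.sum_prod_type, law₁, Prod.mk.injEq, ind_and, Finset.sum_mul]
  simp only [← mul_assoc, ← Finset.sum_mul]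
  calc ∑ v', ∑ x, ∑ y', (∑ z, s.pX.1 x * (C₁ x).1 (y', z)) * (s.pV y').1 v' * ind (v' = v) *
        ind (y' = y)
      = ∑ v', (∑ x, (∑ z, s.pX.1 x * (C₁ x).1 (y, z)) * (s.pV y).1 v') * ind (v' = v) := by
        simp only [sum_mul_ind_eq, ← Finset.sum_mul]
    _ = _ := by rw [sum_mul_ind_eq, Finset.sum_mul]

theorem law₁_VZ (v : Fin s.v) (z : Z₁) :
    law (s.law₁ C₁) (fun ω => (ω.1, ω.2.2.2)) (v, z) =
      ∑ y, ∑ x, s.pX.1 x * (C₁ x).1 (y, z) * (s.pV y).1 v := by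
  rw [law_eq_sum]
  simp only [Fintype.sum_prod_type, law₁, Prod.mk.injEq, ind_and, ← mul_assoc]
  calc ∑ v', ∑ x, ∑ y, ∑ z', s.pX.1 x * (C₁ x).1 (y, z') * (s.pV y).1 v' * ind (v' = v) *
        ind (z' = z)
      = ∑ v', (∑ x, ∑ y, s.pX.1 x * (C₁ x).1 (y, z) * (s.pV y).1 v') * ind (v' = v) := by
        simp only [sum_mul_ind_eq, ← Finset.sum_mul]
    _ = _ := by rw [sum_mul_ind_eq, Finset.sum_comm]

theorem law₁_XY (x : X₁) (y : Y₁) :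
    law (s.law₁ C₁) (fun ω => (ω.2.1, ω.2.2.1)) (x, y) = ∑ z, s.pX.1 x * (C₁ x).1 (y, z) := by
  rw [law_eq_sum]
  simp only [Fintype.sum_prod_type, law₁, Prod.mk.injEq, ind_and, ← mul_assoc]
  calc ∑ v, ∑ x', ∑ y', ∑ z, s.pX.1 x' * (C₁ x').1 (y', z) * (s.pV y').1 v * ind (x' = x) *
        ind (y' = y)
      = ∑ v, ∑ z, s.pX.1 x * (C₁ x).1 (y, z) * (s.pV y).1 v := by
        simp only [← Finset.sum_mul, sum_mul_ind_eq]
    _ = _ := by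
        rw [Finset.sum_comm]
        simp only [← Finset.mul_sum, stdSimplex_sum, mul_one]

theorem law₁_VXY (v : Fin s.v) (x : X₁) (y : Y₁) :
    law (s.law₁ C₁) (fun ω => (ω.1, ω.2.2.1, ω.2.1)) (v, y, x) =
      ∑ z, s.pX.1 x * (C₁ x).1 (y, z) * (s.pV y).1 v := by
  rw [law_eq_sum]
  simp only [Fintype.sum_prod_type, law₁, Prod.mk.injEq, ind_and]
  calc ∑ v', ∑ x', ∑ y', ∑ z, s.pX.1 x' * (C₁ x').1 (y', z) * (s.pV y').1 v' *
        (ind (v' = v) * (ind (y' = y) * ind (x' = x)))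
      = ∑ v', (∑ x', (∑ y', (∑ z, s.pX.1 x' * (C₁ x').1 (y', z) * (s.pV y').1 v') *
          ind (y' = y)) * ind (x' = x)) * ind (v' = v) := by
        simp only [Finset.sum_mul]
        refine Finset.sum_congr rfl fun v' _ => Finset.sum_congr rfl fun x' _ =>
          Finset.sum_congr rfl fun y' _ => Finset.sum_congr rfl fun z _ => by ring
    _ = _ := by simp only [sum_mul_ind_eq]

/-- By the Markov chain `V ↔ Y₁ ↔ X₁`, in the form `P(v,y,x) P(y) = P(v,y) P(x,y)`. In this form the
feasibility constraint compares the covering rate with the decoding rate. -/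
theorem condMutInfo_VYX : condMutInfo (s.law₁ C₁) (fun (v, _, _, _) => v)
    (fun (_, _, y, _) => y) (fun (_, x, _, _) => x) = s.infoVY C₁ - s.infoVX C₁ := by
  unfold condMutInfo condEnt infoVX infoVY
  change ent (s.law₁ C₁) (fun ω => (ω.1, ω.2.1)) - ent (s.law₁ C₁) (fun ω => ω.2.1) -
    (ent (s.law₁ C₁) (fun ω => (ω.1, ω.2.2.1, ω.2.1)) -
      ent (s.law₁ C₁) (fun ω => (ω.2.2.1, ω.2.1))) = _
  have h1 := ent_add_ent_eq (s.law₁_nonneg C₁) (A := fun ω => (ω.1, ω.2.2.1, ω.2.1))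
    (B := fun ω => ω.2.2.1) (C := fun ω => (ω.1, ω.2.2.1)) (D := fun ω => (ω.2.1, ω.2.2.1))
    fun ω _ => by
      rw [law₁_VXY, law₁_VY, law₁_XY, ← Finset.sum_mul]
      ring
  have h2 : ent (s.law₁ C₁) (fun ω => (ω.2.2.1, ω.2.1)) =
      ent (s.law₁ C₁) (fun ω => (ω.2.1, ω.2.2.1)) := by
    rw [ent_eq_sum, ent_eq_sum]
    refine Finset.sum_congr rfl fun ω _ => ?_
    have : law (s.law₁ C₁) (fun ω => (ω.2.2.1, ω.2.1)) (ω.2.2.1, ω.2.1) =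
        law (s.law₁ C₁) (fun ω => (ω.2.1, ω.2.2.1)) (ω.2.1, ω.2.2.1) := by
      rw [law_eq_sum, law_eq_sum]
      refine Finset.sum_congr rfl fun ω' _ => ?_
      simp only [Prod.mk.injEq, ind_and]
      ring
    simp only [surp, this]
  rw [h2]
  linarith

/-- The probability that the initiator's channel carries the sequences `x, y, z`. -/
noncomputable def seqQ {n : ℕ} (x : Fin n → X₁) (y : Fin n → Y₁) (z : Fin n → Z₁) : ℝ :=
  ∏ i, s.pX.1 (x i) * (C₁ (x i)).1 (y i, z i)

/-- The memoryless channel `P_{V|Y₁}`. -/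
noncomputable def seqV {n : ℕ} (y : Fin n → Y₁) (v : Fin n → Fin s.v) : ℝ :=
  ∏ i, (s.pV (y i)).1 (v i)

variable {n : ℕ}

theorem seqQ_nonneg (x : Fin n → X₁) (y : Fin n → Y₁) (z : Fin n → Z₁) : 0 ≤ s.seqQ C₁ x y z :=
  Finset.prod_nonneg fun _ _ => mul_nonneg (stdSimplex_nonneg _ _) (stdSimplex_nonneg _ _)

theorem seqV_nonneg (y : Fin n → Y₁) (v : Fin n → Fin s.v) : 0 ≤ s.seqV y v :=
  Finset.prod_nonneg fun _ _ => stdSimplex_nonneg _ _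

theorem sum_seqV (y : Fin n → Y₁) : ∑ v, s.seqV y v = 1 := by
  unfold seqV
  rw [sum_prod_pi fun i a => (s.pV (y i)).1 a]
  simp [stdSimplex_sum]

theorem sum_sum_seqQ_Y (y : Fin n → Y₁) : ∑ x, ∑ z, s.seqQ C₁ x y z =
    seqProb (law (s.law₁ C₁) fun ω => ω.2.2.1) y := by
  unfold seqQ seqProb
  rw [sum_sum_prod_pi fun i a b => s.pX.1 a * (C₁ a).1 (y i, b)]
  simp only [law₁_Y]

theorem sum_sum_seqQ_X (x : Fin n → X₁) : ∑ y, ∑ z, s.seqQ C₁ x y z =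
    seqProb (law (s.law₁ C₁) fun ω => ω.2.1) x := by
  unfold seqQ seqProb
  rw [sum_sum_prod_pi fun i a b => s.pX.1 (x i) * (C₁ (x i)).1 (a, b)]
  simp only [law₁_X]

theorem sum_sum_seqQ_mul_seqV (v : Fin n → Fin s.v) (z : Fin n → Z₁) :
    ∑ y, ∑ x, s.seqQ C₁ x y z * s.seqV y v =
      seqProb (law (s.law₁ C₁) fun ω => (ω.1, ω.2.2.2)) fun i => (v i, z i) := by
  unfold seqQ seqProb seqV
  simp only [← Finset.prod_mul_distrib]
  rw [sum_sum_prod_pi fun i a b => s.pX.1 b * (C₁ b).1 (a, z i) * (s.pV a).1 (v i)]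
  simp only [law₁_VZ]

theorem seqProb_VY (v : Fin n → Fin s.v) (y : Fin n → Y₁) :
    (seqProb (law (s.law₁ C₁) fun ω => (ω.1, ω.2.2.1)) fun i => (v i, y i)) =
      seqProb (law (s.law₁ C₁) fun ω => ω.2.2.1) y * s.seqV y v := by
  simp only [seqProb, seqV, law₁_VY, Finset.prod_mul_distrib]

/-- The surprisals that typicality on the initiator's channel has to control. -/
noncomputable def surps₁ : Fin 7 → Fin s.v × X₁ × Y₁ × Z₁ → ℝ :=
  ![surp (s.law₁ C₁) fun ω => ω.1, surp (s.law₁ C₁) fun ω => ω.2.1,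
    surp (s.law₁ C₁) fun ω => ω.2.2.1, surp (s.law₁ C₁) fun ω => ω.2.2.2,
    surp (s.law₁ C₁) fun ω => (ω.1, ω.2.1), surp (s.law₁ C₁) fun ω => (ω.1, ω.2.2.1),
    surp (s.law₁ C₁) fun ω => (ω.1, ω.2.2.2)]

/-- Typicality of the sequences on the initiator's side. -/
def Typ₁ (ε : ℝ) (v : Fin n → Fin s.v) (x : Fin n → X₁) (y : Fin n → Y₁) (z : Fin n → Z₁) :
    Prop :=
  EmpTypical (s.law₁ C₁) (s.surps₁ C₁) ε fun i => (v i, x i, y i, z i)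

/-- The weights multiply to the i.i.d. law of `(V, X₁, Y₁, Z₁)`, with `V` generated from `Y₁` by the
test channel; Chebyshev applies. -/
theorem exists_sum_not_typ₁_le {ε : ℝ} (hε : 0 < ε) : ∃ c : ℝ, 0 ≤ c ∧ ∀ n : ℕ,
    ∑ y : Fin n → Y₁, ∑ v, s.seqV y v * ∑ x, ∑ z, s.seqQ C₁ x y z * ind (¬ s.Typ₁ C₁ ε v x y z) ≤
      c / n := by
  obtain ⟨c, hc0, hc⟩ := exists_sum_not_empTypical_le (s.law₁_nonneg C₁) (s.sum_law₁ C₁)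
    (s.surps₁ C₁) hε
  refine ⟨c, hc0, fun n => le_trans (le_of_eq ?_) (hc n)⟩
  rw [sum_pi_prod]
  simp only [sum_pi_prod (β := Y₁ × Z₁), sum_pi_prod (α := Y₁), Finset.mul_sum]
  rw [Finset.sum_comm]
  refine Finset.sum_congr rfl fun v _ => ?_
  rw [Finset.sum_comm]
  refine Finset.sum_congr rfl fun x _ => Finset.sum_congr rfl fun y _ =>
    Finset.sum_congr rfl fun z _ => ?_
  simp only [Typ₁, law₁, seqV, seqQ, Finset.prod_mul_distrib]
  ring

/-- Ensures that typical sequences exist, so that the law of `V` can be conditioned on typicality.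
-/
theorem exists_not_typ₁_lt {ε c : ℝ} (hc : ∑ y : Fin n → Y₁, ∑ v, s.seqV y v *
    ∑ x, ∑ z, s.seqQ C₁ x y z * ind (¬ s.Typ₁ C₁ ε v x y z) ≤ c) (hc1 : c < 1) :
    ∃ v x y z, s.Typ₁ (n := n) C₁ ε v x y z := by
  by_contra! hno
  have : ∑ y : Fin n → Y₁, ∑ v, s.seqV y v *
    ∑ x, ∑ z, s.seqQ C₁ x y z * ind (¬ s.Typ₁ C₁ ε v x y z) = 1 := by
    simp only [ind_true (hno _ _ _ _), mul_one, sum_sum_seqQ_Y, ← Finset.sum_mul, sum_seqV,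
      one_mul]
    exact sum_seqProb _ (by rw [sum_law, sum_law₁]) n
  linarith

end Selection
end SKE

namespace SKE

/-! ### The responder's channel -/

namespace Selection

variable {X₁ Y₁ X₂ Y₂ Z₂ β : Type*} [Fintype X₁] [Fintype X₂] [Fintype Y₂] [Fintype Z₂] [Fintype β]
  (s : Selection X₁ Y₁ X₂) (C₂ : DMBC X₂ Y₂ Z₂)

/-- The channel `W₁ → (Y₂, Z₂)`. -/
noncomputable def chan (w : Fin s.w₁) (o : Y₂ × Z₂) : ℝ := ∑ x, (s.pXW w).1 x * (C₂ x).1 o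

theorem chan_nonneg (w : Fin s.w₁) (o : Y₂ × Z₂) : 0 ≤ s.chan C₂ w o :=
  Finset.sum_nonneg fun _ _ => mul_nonneg (stdSimplex_nonneg _ _) (stdSimplex_nonneg _ _)

theorem sum_chan (w : Fin s.w₁) : ∑ o, s.chan C₂ w o = 1 := by
  unfold chan
  rw [Finset.sum_comm]
  simp only [← Finset.mul_sum, stdSimplex_sum, mul_one]

/-- The joint law of `(W₂, W₁, (Y₂, Z₂))`. -/
noncomputable def lawR : Fin s.w₂ × Fin s.w₁ × Y₂ × Z₂ → ℝ :=
  fun ω => s.pW.1 (ω.1, ω.2.1) * s.chan C₂ ω.2.1 ω.2.2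

theorem lawR_nonneg (ω : Fin s.w₂ × Fin s.w₁ × Y₂ × Z₂) : 0 ≤ s.lawR C₂ ω :=
  mul_nonneg (stdSimplex_nonneg _ _) (s.chan_nonneg C₂ _ _)

theorem sum_sum_pW : ∑ u, ∑ w, s.pW.1 (u, w) = 1 := by
  rw [← Fintype.sum_prod_type']
  exact stdSimplex_sum _

theorem sum_lawR : ∑ ω, s.lawR C₂ ω = 1 := by
  simp only [Fintype.sum_prod_type (γ := ℝ) (α₁ := Fin s.w₂),
    Fintype.sum_prod_type (γ := ℝ) (α₁ := Fin s.w₁), lawR]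
  simp only [← Finset.mul_sum, sum_chan, mul_one, sum_sum_pW]

/-- `X₂` enters none of the information quantities, so it is summed out once and absorbed into the
channel `chan`. -/
theorem law_law₂ : law (s.law₂ C₂) (fun ω => (ω.1, ω.2.1, ω.2.2.2)) = s.lawR C₂ := by
  funext ω
  rw [law_eq_sum]
  simp only [Fintype.sum_prod_type (γ := ℝ) (α₁ := Fin s.w₂),
    Fintype.sum_prod_type (γ := ℝ) (α₁ := Fin s.w₁), Fintype.sum_prod_type (γ := ℝ) (α₁ := X₂),
    law₂]
  obtain ⟨u, w, o⟩ := ω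
  simp only [Prod.mk.injEq, ind_and, ← mul_assoc]
  calc ∑ u', ∑ w', ∑ x, ∑ o' : Y₂ × Z₂, s.pW.1 (u', w') * (s.pXW w').1 x * (C₂ x).1 (o'.1, o'.2) *
        ind (u' = u) * ind (w' = w) * ind (o' = o)
      = ∑ u' : Fin s.w₂, (∑ w' : Fin s.w₁, (∑ x, s.pW.1 (u', w') * (s.pXW w').1 x * (C₂ x).1 o) *
          ind (w' = w)) * ind (u' = u) := by
        simp only [sum_mul_ind_eq]
        simp only [← Finset.sum_mul, sum_mul_ind_eq]
    _ = _ := by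
        simp only [sum_mul_ind_eq, lawR, chan, Finset.mul_sum, mul_assoc]

theorem ent_law₂ (A : Fin s.w₂ × Fin s.w₁ × Y₂ × Z₂ → β) :
    ent (s.law₂ C₂) (fun ω => A (ω.1, ω.2.1, ω.2.2.2)) = ent (s.lawR C₂) A := by
  unfold ent
  rw [← law_law₂, law_law]

/-- The law of `W₂`. -/
noncomputable def pU (u : Fin s.w₂) : ℝ := ∑ w, s.pW.1 (u, w)

/-- The law of `W₁`. -/
noncomputable def pW₁ (w : Fin s.w₁) : ℝ := ∑ u, s.pW.1 (u, w)

/-- The conditional law of `W₁` given `W₂`. -/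
noncomputable def condW (u : Fin s.w₂) (w : Fin s.w₁) : ℝ :=
  -- On letters of probability zero any probability vector would do as a default; one is needed
  -- because the rows of the kernel have to sum to 1 for every `u`.
  if s.pU u = 0 then s.pW₁ w else s.pW.1 (u, w) / s.pU u

theorem pU_nonneg (u : Fin s.w₂) : 0 ≤ s.pU u :=
  Finset.sum_nonneg fun _ _ => stdSimplex_nonneg _ _

theorem pW₁_nonneg (w : Fin s.w₁) : 0 ≤ s.pW₁ w :=
  Finset.sum_nonneg fun _ _ => stdSimplex_nonneg _ _

theorem sum_pU : ∑ u, s.pU u = 1 := s.sum_sum_pW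

theorem condW_nonneg (u : Fin s.w₂) (w : Fin s.w₁) : 0 ≤ s.condW u w := by
  unfold condW
  split_ifs
  · exact s.pW₁_nonneg w
  · exact div_nonneg (stdSimplex_nonneg _ _) (s.pU_nonneg u)

theorem sum_condW (u : Fin s.w₂) : ∑ w, s.condW u w = 1 := by
  unfold condW
  split_ifs with h
  · unfold pW₁
    rw [Finset.sum_comm]
    exact s.sum_sum_pW
  · rw [← Finset.sum_div]
    exact div_self h

theorem pU_mul_condW (u : Fin s.w₂) (w : Fin s.w₁) : s.pU u * s.condW u w = s.pW.1 (u, w) := by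
  unfold condW
  split_ifs with h
  · rw [h, zero_mul]
    refine le_antisymm (stdSimplex_nonneg _ _) ?_
    rw [← h]
    exact Finset.single_le_sum (f := fun w => s.pW.1 (u, w)) (fun _ _ => stdSimplex_nonneg _ _)
      (mem_univ w)
  · exact mul_div_cancel₀ _ h

/-- Sums over the joint law of `(W₂, W₁, (Y₂, Z₂))`. -/
theorem sum_lawR_mul (f : Fin s.w₂ → ℝ) (g : Fin s.w₁ → ℝ) (h : Y₂ × Z₂ → ℝ) :
    ∑ ω, s.lawR C₂ ω * (f ω.1 * g ω.2.1 * h ω.2.2) =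
      ∑ u, (∑ w, s.pW.1 (u, w) * (∑ o, s.chan C₂ w o * h o) * g w) * f u := by
  simp only [Fintype.sum_prod_type (γ := ℝ) (α₁ := Fin s.w₂),
    Fintype.sum_prod_type (γ := ℝ) (α₁ := Fin s.w₁), lawR, Finset.mul_sum, Finset.sum_mul]
  refine Finset.sum_congr rfl fun u _ => Finset.sum_congr rfl fun w _ =>
    Finset.sum_congr rfl fun o _ => by ring

theorem lawR_U (u : Fin s.w₂) : law (s.lawR C₂) (fun ω => ω.1) u = s.pU u := by
  rw [law_eq_sum]
  have := s.sum_lawR_mul C₂ (fun u' => ind (u' = u)) (fun _ => 1) (fun _ => 1)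
  simp only [mul_one, sum_chan, sum_mul_ind_eq] at this
  exact this

theorem lawR_W (w : Fin s.w₁) : law (s.lawR C₂) (fun ω => ω.2.1) w = s.pW₁ w := by
  rw [law_eq_sum]
  have := s.sum_lawR_mul C₂ (fun _ => 1) (fun w' => ind (w' = w)) (fun _ => 1)
  simp only [mul_one, one_mul, sum_chan, sum_mul_ind_eq] at this
  exact this

theorem lawR_WU (w : Fin s.w₁) (u : Fin s.w₂) :
    law (s.lawR C₂) (fun ω => (ω.2.1, ω.1)) (w, u) = s.pW.1 (u, w) := by
  rw [law_eq_sum]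
  have := s.sum_lawR_mul C₂ (fun u' => ind (u' = u)) (fun w' => ind (w' = w)) (fun _ => 1)
  simp only [mul_one, sum_chan, sum_mul_ind_eq] at this
  rw [← this]
  exact Finset.sum_congr rfl fun ω _ => by rw [Prod.mk.injEq, ind_and]; ring

variable (F : Y₂ × Z₂ → β)

theorem lawR_F (b : β) : law (s.lawR C₂) (fun ω => F ω.2.2) b =
    ∑ u, ∑ w, s.pW.1 (u, w) * law (s.chan C₂ w) F b := by
  rw [law_eq_sum]
  have := s.sum_lawR_mul C₂ (fun _ => 1) (fun _ => 1) (fun o => ind (F o = b))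
  simp only [mul_one, one_mul] at this
  simp only [this, law_eq_sum]

theorem lawR_UF (u : Fin s.w₂) (b : β) : law (s.lawR C₂) (fun ω => (ω.1, F ω.2.2)) (u, b) =
    ∑ w, s.pW.1 (u, w) * law (s.chan C₂ w) F b := by
  rw [law_eq_sum]
  have := s.sum_lawR_mul C₂ (fun u' => ind (u' = u)) (fun _ => 1) (fun o => ind (F o = b))
  simp only [mul_one, sum_mul_ind_eq] at this
  simp only [law_eq_sum, Prod.mk.injEq, ind_and, this]

theorem lawR_WF (w : Fin s.w₁) (b : β) : law (s.lawR C₂) (fun ω => (ω.2.1, F ω.2.2)) (w, b) =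
    s.pW₁ w * law (s.chan C₂ w) F b := by
  rw [law_eq_sum]
  have := s.sum_lawR_mul C₂ (fun _ => 1) (fun w' => ind (w' = w)) (fun o => ind (F o = b))
  simp only [mul_one, one_mul, sum_mul_ind_eq, ← Finset.sum_mul] at this
  simp only [law_eq_sum (s.chan C₂ w), Prod.mk.injEq, ind_and, this]
  rfl

theorem lawR_WFU (w : Fin s.w₁) (b : β) (u : Fin s.w₂) :
    law (s.lawR C₂) (fun ω => (ω.2.1, F ω.2.2, ω.1)) (w, b, u) =
      s.pW.1 (u, w) * law (s.chan C₂ w) F b := by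
  rw [law_eq_sum]
  have := s.sum_lawR_mul C₂ (fun u' => ind (u' = u)) (fun w' => ind (w' = w))
    (fun o => ind (F o = b))
  simp only [sum_mul_ind_eq] at this
  rw [law_eq_sum, ← this]
  exact Finset.sum_congr rfl fun ω _ => by rw [Prod.mk.injEq, Prod.mk.injEq, ind_and, ind_and]; ring

/-- The information between `W₁` and an observation of the channel output. -/
noncomputable def infoW : ℝ :=
  ent (s.lawR C₂) (fun ω => ω.2.1) + ent (s.lawR C₂) (fun ω => F ω.2.2) -
    ent (s.lawR C₂) (fun ω => (ω.2.1, F ω.2.2))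

/-- The information between `W₂` and an observation of the channel output. -/
noncomputable def infoU : ℝ :=
  ent (s.lawR C₂) (fun ω => ω.1) + ent (s.lawR C₂) (fun ω => F ω.2.2) -
    ent (s.lawR C₂) (fun ω => (ω.1, F ω.2.2))

/-- The chain `W₂ ↔ W₁ ↔ (Y₂, Z₂)` turns the conditional information into a difference: the rate of
the satellites minus the rate of the clouds. -/
theorem condMutInfo_WFU : condMutInfo (s.law₂ C₂) (fun ω => ω.2.1) (fun ω => F ω.2.2.2)
    (fun ω => ω.1) = s.infoW C₂ F - s.infoU C₂ F := by
  unfold condMutInfo condEnt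
  rw [s.ent_law₂ C₂ fun ω => (ω.2.1, ω.1), s.ent_law₂ C₂ fun ω => ω.1,
    s.ent_law₂ C₂ fun ω => (ω.2.1, F ω.2.2, ω.1), s.ent_law₂ C₂ fun ω => (F ω.2.2, ω.1)]
  have h1 := ent_add_ent_eq (s.lawR_nonneg C₂) (A := fun ω => (ω.2.1, F ω.2.2, ω.1))
    (B := fun ω => ω.2.1) (C := fun ω => (ω.2.1, F ω.2.2)) (D := fun ω => (ω.2.1, ω.1))
    fun ω _ => by
      rw [lawR_WFU, lawR_W, lawR_WF, lawR_WU]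
      ring
  have h2 : ent (s.lawR C₂) (fun ω => (F ω.2.2, ω.1)) =
      ent (s.lawR C₂) (fun ω => (ω.1, F ω.2.2)) := by
    rw [ent_eq_sum, ent_eq_sum]
    refine Finset.sum_congr rfl fun ω _ => ?_
    have : law (s.lawR C₂) (fun ω => (F ω.2.2, ω.1)) (F ω.2.2, ω.1) =
        law (s.lawR C₂) (fun ω => (ω.1, F ω.2.2)) (ω.1, F ω.2.2) := by
      rw [law_eq_sum, law_eq_sum]
      refine Finset.sum_congr rfl fun ω' _ => ?_
      simp only [Prod.mk.injEq, ind_and]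
      ring
    simp only [surp, this]
  rw [h2]
  unfold infoW infoU
  linarith

theorem Rs₂_eq : s.Rs₂ C₂ = s.infoW C₂ Prod.fst - s.infoU C₂ Prod.fst -
    (s.infoW C₂ Prod.snd - s.infoU C₂ Prod.snd) := by
  rw [← condMutInfo_WFU, ← condMutInfo_WFU]
  rfl

theorem mutInfo_WY : mutInfo (s.law₂ C₂) (fun (_, w₁, _, _, _) => w₁)
    (fun (_, _, _, y, _) => y) = s.infoW C₂ Prod.fst := by
  change mutInfo (s.law₂ C₂) (fun ω => ω.2.1) (fun ω => ω.2.2.2.1) = _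
  unfold mutInfo condEnt infoW
  rw [s.ent_law₂ C₂ fun ω => (ω.2.1, ω.2.2.1), s.ent_law₂ C₂ fun ω => ω.2.1,
    s.ent_law₂ C₂ fun ω => ω.2.2.1]
  ring

/-! ### Memoryless extensions on the responder's side -/

variable {m n : ℕ}

/-- The memoryless extension of the channel from `W₁` to an observation of the output. -/
noncomputable def seqF (w : Fin n → Fin s.w₁) (b : Fin n → β) : ℝ :=
  ∏ i, law (s.chan C₂ (w i)) F (b i)

/-- The memoryless extension of the channel `W₁ → (Y₂, Z₂)`. -/
noncomputable def seqK (w : Fin n → Fin s.w₁) (y : Fin n → Y₂) (z : Fin n → Z₂) : ℝ :=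
  ∏ i, s.chan C₂ (w i) (y i, z i)

/-- The memoryless extension of the conditional law of `W₁` given `W₂`. -/
noncomputable def seqW (u : Fin n → Fin s.w₂) (w : Fin n → Fin s.w₁) : ℝ :=
  ∏ i, s.condW (u i) (w i)

theorem seqF_nonneg (w : Fin n → Fin s.w₁) (b : Fin n → β) : 0 ≤ s.seqF C₂ F w b :=
  Finset.prod_nonneg fun _ _ => law_nonneg (s.chan_nonneg C₂ _) _ _

theorem seqF_le_one (w : Fin n → Fin s.w₁) (b : Fin n → β) : s.seqF C₂ F w b ≤ 1 := by
  refine Finset.prod_le_one (fun _ _ => law_nonneg (s.chan_nonneg C₂ _) _ _) fun i _ => ?_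
  rw [← s.sum_chan C₂ (w i), ← sum_law _ F]
  exact Finset.single_le_sum (f := fun b => law (s.chan C₂ (w i)) F b)
    (fun _ _ => law_nonneg (s.chan_nonneg C₂ _) _ _) (mem_univ (b i))

theorem sum_seqF (w : Fin n → Fin s.w₁) : ∑ b, s.seqF C₂ F w b = 1 := by
  unfold seqF
  rw [sum_prod_pi fun i b => law (s.chan C₂ (w i)) F b]
  simp [sum_law, sum_chan]

theorem seqK_nonneg (w : Fin n → Fin s.w₁) (y : Fin n → Y₂) (z : Fin n → Z₂) :
    0 ≤ s.seqK C₂ w y z := Finset.prod_nonneg fun _ _ => s.chan_nonneg C₂ _ _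

theorem seqW_nonneg (u : Fin n → Fin s.w₂) (w : Fin n → Fin s.w₁) : 0 ≤ s.seqW u w :=
  Finset.prod_nonneg fun _ _ => s.condW_nonneg _ _

theorem sum_seqW (u : Fin n → Fin s.w₂) : ∑ w, s.seqW u w = 1 := by
  unfold seqW
  rw [sum_prod_pi fun i a => s.condW (u i) a]
  simp [sum_condW]

theorem law_chan_fst (w : Fin s.w₁) (y : Y₂) :
    law (s.chan C₂ w) Prod.fst y = ∑ z, s.chan C₂ w (y, z) := by
  rw [law_eq_sum, Fintype.sum_prod_type]
  simp only [← Finset.sum_mul, sum_mul_ind_eq]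

theorem law_chan_snd (w : Fin s.w₁) (z : Z₂) :
    law (s.chan C₂ w) Prod.snd z = ∑ y, s.chan C₂ w (y, z) := by
  rw [law_eq_sum, Fintype.sum_prod_type]
  simp only [sum_mul_ind_eq]

theorem sum_seqK_right (w : Fin n → Fin s.w₁) (y : Fin n → Y₂) :
    ∑ z, s.seqK C₂ w y z = s.seqF C₂ Prod.fst w y := by
  unfold seqK seqF
  rw [sum_prod_pi fun i z => s.chan C₂ (w i) (y i, z)]
  simp only [law_chan_fst]

theorem sum_seqK_left (w : Fin n → Fin s.w₁) (z : Fin n → Z₂) :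
    ∑ y, s.seqK C₂ w y z = s.seqF C₂ Prod.snd w z := by
  unfold seqK seqF
  rw [sum_prod_pi fun i y => s.chan C₂ (w i) (y, z i)]
  simp only [law_chan_snd]

theorem sum_sum_seqK (w : Fin n → Fin s.w₁) : ∑ y, ∑ z, s.seqK C₂ w y z = 1 := by
  simp only [sum_seqK_right, sum_seqF]

theorem seqF_append (w₀ : Fin m → Fin s.w₁) (w : Fin n → Fin s.w₁) (b : Fin (m + n) → β) :
    s.seqF C₂ F (Fin.append w₀ w) b =
      s.seqF C₂ F w₀ (fun i => b (Fin.castAdd n i)) * s.seqF C₂ F w (fun i => b (Fin.natAdd m i)) := by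
  simp [seqF, Fin.prod_univ_add]

theorem seqK_append (w₀ : Fin m → Fin s.w₁) (w : Fin n → Fin s.w₁) (y : Fin (m + n) → Y₂)
    (z : Fin (m + n) → Z₂) :
    s.seqK C₂ (Fin.append w₀ w) y z =
      s.seqK C₂ w₀ (fun i => y (Fin.castAdd n i)) (fun i => z (Fin.castAdd n i)) *
      s.seqK C₂ w (fun i => y (Fin.natAdd m i)) (fun i => z (Fin.natAdd m i)) := by
  simp [seqK, Fin.prod_univ_add]

theorem seqProb_mul_sum_seqW (u : Fin n → Fin s.w₂) (b : Fin n → β) :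
    seqProb s.pU u * ∑ w, s.seqW u w * s.seqF C₂ F w b =
      seqProb (law (s.lawR C₂) fun ω => (ω.1, F ω.2.2)) fun i => (u i, b i) := by
  unfold seqProb seqW seqF
  simp only [← Finset.prod_mul_distrib]
  rw [sum_prod_pi fun i w => s.condW (u i) w * law (s.chan C₂ w) F (b i),
    ← Finset.prod_mul_distrib]
  simp only [lawR_UF, Finset.mul_sum, ← mul_assoc, pU_mul_condW]

theorem seqProb_WF (w : Fin n → Fin s.w₁) (b : Fin n → β) :
    (seqProb (law (s.lawR C₂) fun ω => (ω.2.1, F ω.2.2)) fun i => (w i, b i)) =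
      seqProb (law (s.lawR C₂) fun ω => ω.2.1) w * s.seqF C₂ F w b := by
  simp only [seqProb, seqF, lawR_WF, lawR_W, Finset.prod_mul_distrib]

theorem sum_seqProb_UF (b : Fin n → β) :
    ∑ u : Fin n → Fin s.w₂,
      (seqProb (law (s.lawR C₂) fun ω => (ω.1, F ω.2.2)) fun i => (u i, b i)) =
      seqProb (law (s.lawR C₂) fun ω => F ω.2.2) b := by
  unfold seqProb
  rw [sum_prod_pi fun i u => law (s.lawR C₂) (fun ω => (ω.1, F ω.2.2)) (u, b i)]
  simp only [lawR_UF, lawR_F]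

/-- The surprisals that typicality on the responder's channel has to control. -/
noncomputable def surps₂ : Fin 7 → Fin s.w₂ × Fin s.w₁ × Y₂ × Z₂ → ℝ :=
  ![surp (s.lawR C₂) fun ω => ω.1, surp (s.lawR C₂) fun ω => ω.2.1,
    surp (s.lawR C₂) fun ω => ω.2.2.1, surp (s.lawR C₂) fun ω => (ω.1, ω.2.2.1),
    surp (s.lawR C₂) fun ω => (ω.1, ω.2.2.2), surp (s.lawR C₂) fun ω => (ω.2.1, ω.2.2.1),
    surp (s.lawR C₂) fun ω => (ω.2.1, ω.2.2.2)]

/-- Typicality of the sequences on the responder's side, for a transmission that starts with the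
sequence `w₀`. -/
def Typ₂ (ε : ℝ) (w₀ : Fin m → Fin s.w₁) (u : Fin n → Fin s.w₂) (w : Fin n → Fin s.w₁)
    (y : Fin (m + n) → Y₂) (z : Fin (m + n) → Z₂) : Prop :=
  0 < s.seqF C₂ Prod.fst w₀ (fun i => y (Fin.castAdd n i)) ∧
  EmpTypical (s.lawR C₂) (s.surps₂ C₂) ε
    fun i => (u i, w i, y (Fin.natAdd m i), z (Fin.natAdd m i))

/-- The constant is uniform in the prefix `w₀`: the outputs of the prefix have positive probability
almost surely and sum out, and Chebyshev is applied to the remaining `n` letters only. -/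
theorem exists_sum_not_typ₂_le {ε : ℝ} (hε : 0 < ε) : ∃ c : ℝ, 0 ≤ c ∧
    ∀ (m n : ℕ) (w₀ : Fin m → Fin s.w₁),
    ∑ u : Fin n → Fin s.w₂, ∑ w, ∑ y, ∑ z, seqProb s.pU u * s.seqW u w *
      s.seqK C₂ (Fin.append w₀ w) y z * ind (¬ s.Typ₂ C₂ ε w₀ u w y z) ≤ c / n := by
  obtain ⟨c, hc0, hc⟩ := exists_sum_not_empTypical_le (s.lawR_nonneg C₂) (s.sum_lawR C₂)
    (s.surps₂ C₂) hε
  refine ⟨c, hc0, fun m n w₀ => le_trans (le_of_eq ?_) (hc n)⟩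
  rw [sum_pi_prod]
  simp only [sum_pi_prod (β := Y₂ × Z₂), sum_pi_prod (α := Y₂)]
  refine Finset.sum_congr rfl fun u _ => Finset.sum_congr rfl fun w _ => ?_
  have h1 : ∀ y z, seqProb s.pU u * s.seqW u w *
      s.seqK C₂ (Fin.append w₀ w) y z * ind (¬ s.Typ₂ C₂ ε w₀ u w y z) =
      seqProb s.pU u * s.seqW u w * s.seqK C₂ (Fin.append w₀ w) y z *
        ind (¬ EmpTypical (s.lawR C₂) (s.surps₂ C₂) ε
          fun i => (u i, w i, y (Fin.natAdd m i), z (Fin.natAdd m i))) := by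
    intro y z
    rw [seqK_append]
    by_cases h : 0 < s.seqF C₂ Prod.fst w₀ (fun i => y (Fin.castAdd n i))
    · simp only [Typ₂, h, true_and]
    -- A prefix output of probability zero has weight zero, so the positivity clause of `Typ₂` is
    -- free.
    · have h2 : s.seqK C₂ w₀ (fun i => y (Fin.castAdd n i)) (fun i => z (Fin.castAdd n i)) = 0 := by
        refine le_antisymm ?_ (s.seqK_nonneg C₂ _ _ _)
        refine le_trans ?_ (not_lt.mp h)
        rw [← sum_seqK_right]
        exact Finset.single_le_sum (f := fun z' => s.seqK C₂ w₀ (fun i => y (Fin.castAdd n i)) z')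
          (fun _ _ => s.seqK_nonneg C₂ _ _ _) (mem_univ _)
      rw [h2]; ring
  simp only [h1]
  rw [sum_fin_add]
  simp only [sum_fin_add (α := Z₂), seqK_append, Fin.append_left, Fin.append_right]
  calc ∑ y₀, ∑ y, ∑ z₀, ∑ z, seqProb s.pU u * s.seqW u w *
        (s.seqK C₂ w₀ y₀ z₀ * s.seqK C₂ w y z) *
        ind (¬ EmpTypical (s.lawR C₂) (s.surps₂ C₂) ε fun i => (u i, w i, y i, z i))
      = ∑ y₀, ∑ z₀, s.seqK C₂ w₀ y₀ z₀ * ∑ y, ∑ z, seqProb s.pU u * s.seqW u w *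
        s.seqK C₂ w y z *
        ind (¬ EmpTypical (s.lawR C₂) (s.surps₂ C₂) ε fun i => (u i, w i, y i, z i)) := by
        refine Finset.sum_congr rfl fun y₀ _ => ?_
        rw [Finset.sum_comm]
        refine Finset.sum_congr rfl fun z₀ _ => ?_
        simp only [Finset.mul_sum]
        exact Finset.sum_congr rfl fun y _ => Finset.sum_congr rfl fun z _ => by ring
    _ = _ := by
        simp only [← Finset.sum_mul, sum_sum_seqK, one_mul]
        refine Finset.sum_congr rfl fun y _ => Finset.sum_congr rfl fun z _ => ?_
        simp only [lawR, seqProb, seqW, seqK, Finset.prod_mul_distrib, ← pU_mul_condW]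

end Selection
end SKE

namespace SKE

/-! ### Probabilities of typical sequences -/

theorem rpow_mul_le_of_le_logb {a b x : ℝ} (ha : 0 < a) (hb : 0 < b)
    (h : x + Real.logb 2 b ≤ Real.logb 2 a) : (2 : ℝ) ^ x * b ≤ a := by
  rw [← Real.logb_le_logb one_lt_two (by positivity) ha,
    Real.logb_mul (by positivity) hb.ne', Real.logb_rpow two_pos (by norm_num)]
  exact h

/-- A letterwise worst-case bound, used for the fixed prefix `w₀`, to which no law of large numbers
is applied. -/
theorem abs_logb_seqProb_le {α : Type*} {p : α → ℝ} {h c : ℝ}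
    (hc : ∀ a, |Real.logb 2 (p a) + h| ≤ c) {n : ℕ} {u : Fin n → α} (hu : ∀ i, 0 < p (u i)) :
    |Real.logb 2 (seqProb p u) + n * h| ≤ n * c := by
  rw [logb_seqProb hu]
  have : ∑ i, Real.logb 2 (p (u i)) + n * h = ∑ i, (Real.logb 2 (p (u i)) + h) := by
    simp [Finset.sum_add_distrib]
  rw [this]
  refine (Finset.abs_sum_le_sum_abs _ _).trans ((Finset.sum_le_sum fun i _ => hc (u i)).trans ?_)
  simp

namespace Selection

variable {X₁ Y₁ Z₁ X₂ Y₂ Z₂ : Type*} [Fintype X₁] [Fintype Y₁] [Fintype Z₁]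
  [Fintype X₂] [Fintype Y₂] [Fintype Z₂]
  (s : Selection X₁ Y₁ X₂) (C₁ : DMBC X₁ Y₁ Z₁) (C₂ : DMBC X₂ Y₂ Z₂) {n m l : ℕ}

/-- The law of `(V, X₁)`. -/
noncomputable abbrev lawVX : Fin s.v × X₁ → ℝ := law (s.law₁ C₁) fun ω => (ω.1, ω.2.1)

/-- The law of `(V, Y₁)`. -/
noncomputable abbrev lawVY : Fin s.v × Y₁ → ℝ := law (s.law₁ C₁) fun ω => (ω.1, ω.2.2.1)

/-- The law of `V`. -/
noncomputable abbrev lawV : Fin s.v → ℝ := law (s.law₁ C₁) fun ω => ω.1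

/-- The law of `(W₁, Y₂)`. -/
noncomputable abbrev lawWY : Fin s.w₁ × Y₂ → ℝ := law (s.lawR C₂) fun ω => (ω.2.1, ω.2.2.1)

/-- The law of `W₁`. -/
noncomputable abbrev lawW : Fin s.w₁ → ℝ := law (s.lawR C₂) fun ω => ω.2.1

/-- The law of `Y₂`. -/
noncomputable abbrev lawY₂ : Y₂ → ℝ := law (s.lawR C₂) fun ω => ω.2.2.1

theorem jointlyTypical_iff {ε : ℝ} (v : Fin n → Fin s.v) (y : Fin n → Y₁) :
    JointlyTypical ε (s.lawVY C₁) v y ↔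
      NearEntropy ε n (seqProb (s.lawV C₁) v) (n * ent (s.law₁ C₁) fun ω => ω.1) ∧
      NearEntropy ε n (seqProb (law (s.law₁ C₁) fun ω => ω.2.2.1) y)
        (n * ent (s.law₁ C₁) fun ω => ω.2.2.1) ∧
      NearEntropy ε n (seqProb (s.lawVY C₁) fun i => (v i, y i))
        (n * ent (s.law₁ C₁) fun ω => (ω.1, ω.2.2.1)) := by
  simp only [JointlyTypical, Typical, law_law]
  rfl

theorem bipJointlyTypical_iff {ε : ℝ} {d : ℕ} (v : Fin n → Fin s.v) (x : Fin n → X₁)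
    (w : Fin d → Fin s.w₁) (y : Fin d → Y₂) :
    BipJointlyTypical ε (s.lawVX C₁) (s.lawWY C₂) v w x y ↔
      NearEntropy ε (n + d) (seqProb (s.lawV C₁) v * seqProb (s.lawW C₂) w)
        (n * (ent (s.law₁ C₁) fun ω => ω.1) + d * ent (s.lawR C₂) fun ω => ω.2.1) ∧
      NearEntropy ε (n + d) (seqProb (law (s.law₁ C₁) fun ω => ω.2.1) x *
          seqProb (s.lawY₂ C₂) y)
        (n * (ent (s.law₁ C₁) fun ω => ω.2.1) + d * ent (s.lawR C₂) fun ω => ω.2.2.1) ∧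
      NearEntropy ε (n + d) ((seqProb (s.lawVX C₁) fun i => (v i, x i)) *
          seqProb (s.lawWY C₂) fun i => (w i, y i))
        (n * (ent (s.law₁ C₁) fun ω => (ω.1, ω.2.1)) +
          d * ent (s.lawR C₂) fun ω => (ω.2.1, ω.2.2.1)) := by
  simp only [BipJointlyTypical, BipTypical, law_law]
  rfl

/-! ### Exponents on the initiator's channel -/

section Initiator

/-- Three entropy estimates applied to `P(v|y) = P(v,y) / P(y)`. It uses only the protocol's own
notion of typicality, as the covering bound must hold for every jointly typical pair. -/
theorem jointlyTypical_seqV_le {ε : ℝ} (hn : 0 < n) {v : Fin n → Fin s.v} {y : Fin n → Y₁}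
    (h : JointlyTypical ε (s.lawVY C₁) v y) :
    s.seqV y v ≤ (2 : ℝ) ^ (n * (s.infoVY C₁ + 3 * ε)) * seqProb (s.lawV C₁) v := by
  obtain ⟨h1, h2, h3⟩ := (s.jointlyTypical_iff C₁ v y).mp h
  have pV := h1.1
  have pY := h2.1
  have pVY := h3.1
  have a1 := abs_le.mp (h1.abs_logb_le hn)
  have a2 := abs_le.mp (h2.abs_logb_le hn)
  have a3 := abs_le.mp (h3.abs_logb_le hn)
  rw [seqProb_VY] at pVY a3
  have pk : 0 < s.seqV y v := pos_of_mul_pos_right pVY pY.le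
  rw [Real.logb_mul pY.ne' pk.ne'] at a3
  refine le_rpow_mul_of_logb_le pk pV ?_
  unfold infoVY
  linarith [a1.1, a2.1, a3.2]

variable {s C₁}

/-- The argument `t` selects the entry of `surps₁` that is the surprisal of `A`, so that `hA` is
closed by `rfl`. -/
theorem Typ₁.logb {ε : ℝ} {v : Fin n → Fin s.v} {x : Fin n → X₁} {y : Fin n → Y₁}
    {z : Fin n → Z₁} (h : s.Typ₁ C₁ ε v x y z) {β : Type*} [Fintype β]
    (A : Fin s.v × X₁ × Y₁ × Z₁ → β) (t : Fin 7) (hA : s.surps₁ C₁ t = surp (s.law₁ C₁) A) :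
    0 < seqProb (law (s.law₁ C₁) A) (fun i => A (v i, x i, y i, z i)) ∧
    |Real.logb 2 (seqProb (law (s.law₁ C₁) A) fun i => A (v i, x i, y i, z i)) +
      n * ent (s.law₁ C₁) A| ≤ n * ε :=
  ⟨seqProb_pos fun i => law_pos (s.law₁_nonneg C₁) A (h.1 i),
    EmpTypical.abs_logb_le (s.law₁_nonneg C₁) h A t hA⟩

theorem Typ₁.jointlyTypical {ε ε' : ℝ} (hε : ε < ε') (hn : 0 < n) {v : Fin n → Fin s.v}
    {x : Fin n → X₁} {y : Fin n → Y₁} {z : Fin n → Z₁} (h : s.Typ₁ C₁ ε v x y z) :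
    JointlyTypical ε' (s.lawVY C₁) v y := by
  have hn' : (0 : ℝ) < n := by exact_mod_cast hn
  have hlt : (n : ℝ) * ε < n * ε' := by gcongr
  have h1 := h.logb (fun ω => ω.1) 0 rfl
  have h2 := h.logb (fun ω => ω.2.2.1) 2 rfl
  have h3 := h.logb (fun ω => (ω.1, ω.2.2.1)) 5 rfl
  exact (s.jointlyTypical_iff C₁ v y).mpr
    ⟨nearEntropy_of_abs_logb_lt hn h1.1 (h1.2.trans_lt hlt),
      nearEntropy_of_abs_logb_lt hn h2.1 (h2.2.trans_lt hlt),
      nearEntropy_of_abs_logb_lt hn h3.1 (h3.2.trans_lt hlt)⟩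

theorem Typ₁.le_seqV {ε : ℝ} {v : Fin n → Fin s.v} {x : Fin n → X₁} {y : Fin n → Y₁}
    {z : Fin n → Z₁} (h : s.Typ₁ C₁ ε v x y z) :
    (2 : ℝ) ^ (n * (s.infoVY C₁ - 3 * ε)) * seqProb (s.lawV C₁) v ≤ s.seqV y v := by
  obtain ⟨pV, a1⟩ := h.logb (fun ω => ω.1) 0 rfl
  obtain ⟨pY, a2⟩ := h.logb (fun ω => ω.2.2.1) 2 rfl
  obtain ⟨pVY, a3⟩ := h.logb (fun ω => (ω.1, ω.2.2.1)) 5 rfl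
  rw [seqProb_VY] at pVY a3
  have pk : 0 < s.seqV y v := pos_of_mul_pos_right pVY pY.le
  rw [Real.logb_mul pY.ne' pk.ne'] at a3
  refine rpow_mul_le_of_le_logb pk pV ?_
  unfold infoVY
  linarith [(abs_le.mp a1).2, (abs_le.mp a2).2, (abs_le.mp a3).1]

/-- The sum is the joint law of `(V, Z₁)`. Together with `Typ₁.le_seqV` it gives the exponent
`I(V;Y₁) - I(V;Z₁)` of the secrecy of the covering codeword. -/
theorem Typ₁.lawVZ_le {ε : ℝ} {v : Fin n → Fin s.v} {x : Fin n → X₁} {y : Fin n → Y₁}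
    {z : Fin n → Z₁} (h : s.Typ₁ C₁ ε v x y z) :
    ∑ y, ∑ x, s.seqQ C₁ x y z * s.seqV y v ≤ (2 : ℝ) ^ (n * (s.infoVZ C₁ + 3 * ε)) *
      (seqProb (s.lawV C₁) v * seqProb (law (s.law₁ C₁) fun ω => ω.2.2.2) z) := by
  rw [sum_sum_seqQ_mul_seqV]
  obtain ⟨pV, a1⟩ := h.logb (fun ω => ω.1) 0 rfl
  obtain ⟨pZ, a2⟩ := h.logb (fun ω => ω.2.2.2) 3 rfl
  obtain ⟨pVZ, a3⟩ := h.logb (fun ω => (ω.1, ω.2.2.2)) 6 rfl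
  refine le_rpow_mul_of_logb_le pVZ (mul_pos pV pZ) ?_
  rw [Real.logb_mul pV.ne' pZ.ne']
  unfold infoVZ
  linarith [(abs_le.mp a1).1, (abs_le.mp a2).1, (abs_le.mp a3).2]

end Initiator

/-! ### Exponents on the responder's channel -/

section Responder

variable {s C₂}

theorem Typ₂.logb {ε : ℝ} {w₀ : Fin l → Fin s.w₁} {u : Fin m → Fin s.w₂} {w : Fin m → Fin s.w₁}
    {y : Fin (l + m) → Y₂} {z : Fin (l + m) → Z₂} (h : s.Typ₂ C₂ ε w₀ u w y z) {β : Type*}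
    [Fintype β] (A : Fin s.w₂ × Fin s.w₁ × Y₂ × Z₂ → β) (t : Fin 7)
    (hA : s.surps₂ C₂ t = surp (s.lawR C₂) A) :
    0 < seqProb (law (s.lawR C₂) A)
      (fun i => A (u i, w i, y (Fin.natAdd l i), z (Fin.natAdd l i))) ∧
    |Real.logb 2 (seqProb (law (s.lawR C₂) A)
        fun i => A (u i, w i, y (Fin.natAdd l i), z (Fin.natAdd l i))) +
      m * ent (s.lawR C₂) A| ≤ m * ε :=
  ⟨seqProb_pos fun i => law_pos (s.lawR_nonneg C₂) A (h.2.1 i),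
    EmpTypical.abs_logb_le (s.lawR_nonneg C₂) h.2 A t hA⟩

theorem lawR_U_eq : law (s.lawR C₂) (fun ω => ω.1) = s.pU := funext fun u => s.lawR_U C₂ u

theorem sum_seqW_mul_seqF_append {β : Type*} [Fintype β] (F : Y₂ × Z₂ → β)
    (w₀ : Fin l → Fin s.w₁) (u : Fin m → Fin s.w₂) (b : Fin (l + m) → β) :
    ∑ w, s.seqW u w * s.seqF C₂ F (Fin.append w₀ w) b =
      s.seqF C₂ F w₀ (fun i => b (Fin.castAdd m i)) *
        ∑ w, s.seqW u w * s.seqF C₂ F w fun i => b (Fin.natAdd l i) := by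
  rw [Finset.mul_sum]
  exact Finset.sum_congr rfl fun w _ => by rw [seqF_append]; ring

theorem sum_sum_seqProb_mul_seqF {β : Type*} [Fintype β] (F : Y₂ × Z₂ → β)
    (w₀ : Fin l → Fin s.w₁) (b : Fin (l + m) → β) :
    ∑ u, ∑ w, seqProb s.pU u * s.seqW u w * s.seqF C₂ F (Fin.append w₀ w) b =
      s.seqF C₂ F w₀ (fun i => b (Fin.castAdd m i)) *
        seqProb (law (s.lawR C₂) fun ω => F ω.2.2) fun i => b (Fin.natAdd l i) := by
  simp only [mul_assoc, ← Finset.mul_sum, sum_seqW_mul_seqF_append]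
  rw [← sum_seqProb_UF, Finset.mul_sum]
  refine Finset.sum_congr rfl fun u _ => ?_
  rw [← seqProb_mul_sum_seqW]
  ring

/-- The output law of one cloud exceeds the overall output law by at most `2^(m I(U;Y₂))`. This is
the ratio `r` of the superposition code and dictates the number of clouds. -/
theorem Typ₂.sum_seqF_fst_le {ε : ℝ} {w₀ : Fin l → Fin s.w₁} {u : Fin m → Fin s.w₂}
    {w : Fin m → Fin s.w₁} {y : Fin (l + m) → Y₂} {z : Fin (l + m) → Z₂}
    (h : s.Typ₂ C₂ ε w₀ u w y z) :
    ∑ w, s.seqW u w * s.seqF C₂ Prod.fst (Fin.append w₀ w) y ≤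
      (2 : ℝ) ^ (m * (s.infoU C₂ Prod.fst + 3 * ε)) *
        (s.seqF C₂ Prod.fst w₀ (fun i => y (Fin.castAdd m i)) *
        seqProb (s.lawY₂ C₂) fun i => y (Fin.natAdd l i)) := by
  rw [sum_seqW_mul_seqF_append, mul_left_comm]
  refine mul_le_mul_of_nonneg_left ?_ (s.seqF_nonneg C₂ _ _ _)
  obtain ⟨pU, a1⟩ := h.logb (fun ω => ω.1) 0 rfl
  obtain ⟨pY, a2⟩ := h.logb (fun ω => ω.2.2.1) 2 rfl
  obtain ⟨pUY, a3⟩ := h.logb (fun ω => (ω.1, ω.2.2.1)) 3 rfl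
  rw [lawR_U_eq] at pU a1
  refine le_of_mul_le_mul_left ?_ pU
  rw [mul_left_comm]
  refine le_trans (le_of_eq (s.seqProb_mul_sum_seqW C₂ Prod.fst u
    fun i => y (Fin.natAdd l i))) ?_
  refine le_rpow_mul_of_logb_le pUY (mul_pos pU pY) ?_
  rw [Real.logb_mul pU.ne' pY.ne']
  unfold infoU
  linarith [(abs_le.mp a1).1, (abs_le.mp a2).1, (abs_le.mp a3).2]

/-- The prefix cancels, and what remains is the ratio of the satellite law and the cloud law of
`Z₂`, of exponent `I(W;Z₂) - I(U;Z₂) = I(W;Z₂|U)`. -/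
theorem Typ₂.seqF_snd_le {ε : ℝ} {w₀ : Fin l → Fin s.w₁} {u : Fin m → Fin s.w₂}
    {w : Fin m → Fin s.w₁} {y : Fin (l + m) → Y₂} {z : Fin (l + m) → Z₂}
    (h : s.Typ₂ C₂ ε w₀ u w y z) :
    s.seqF C₂ Prod.snd (Fin.append w₀ w) z ≤
      (2 : ℝ) ^ (m * (s.infoW C₂ Prod.snd - s.infoU C₂ Prod.snd + 4 * ε)) *
        ∑ w, s.seqW u w * s.seqF C₂ Prod.snd (Fin.append w₀ w) z := by
  rw [sum_seqW_mul_seqF_append, mul_left_comm, seqF_append]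
  refine mul_le_mul_of_nonneg_left ?_ (s.seqF_nonneg C₂ _ _ _)
  obtain ⟨pU, a1⟩ := h.logb (fun ω => ω.1) 0 rfl
  obtain ⟨pW, a2⟩ := h.logb (fun ω => ω.2.1) 1 rfl
  obtain ⟨pUZ, a3⟩ := h.logb (fun ω => (ω.1, ω.2.2.2)) 4 rfl
  obtain ⟨pWZ, a4⟩ := h.logb (fun ω => (ω.2.1, ω.2.2.2)) 6 rfl
  rw [lawR_U_eq] at pU a1
  have e1 := s.seqProb_mul_sum_seqW C₂ Prod.snd u fun i => z (Fin.natAdd l i)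
  have e2 := s.seqProb_WF C₂ Prod.snd w fun i => z (Fin.natAdd l i)
  rw [← e1] at pUZ a3
  rw [e2] at pWZ a4
  have p1 := pos_of_mul_pos_right pUZ pU.le
  have p2 := pos_of_mul_pos_right pWZ pW.le
  rw [Real.logb_mul pU.ne' p1.ne'] at a3
  rw [Real.logb_mul pW.ne' p2.ne'] at a4
  refine le_rpow_mul_of_logb_le p2 p1 ?_
  unfold infoU infoW
  linarith [(abs_le.mp a1).2, (abs_le.mp a2).1, (abs_le.mp a3).1, (abs_le.mp a4).2]

end Responder

/-! ### Bipartite typicality: wrong codewords and the true codeword -/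

section Bipartite

/-- The information ratio of `V` and `X₁`. -/
noncomputable def ratioVX (v : Fin n → Fin s.v) (x : Fin n → X₁) : ℝ :=
  (seqProb (s.lawVX C₁) fun i => (v i, x i)) /
    (seqProb (s.lawV C₁) v * seqProb (law (s.law₁ C₁) fun ω => ω.2.1) x)

theorem ratioVX_nonneg (v : Fin n → Fin s.v) (x : Fin n → X₁) : 0 ≤ s.ratioVX C₁ v x :=
  div_nonneg (seqProb_nonneg (law_nonneg (s.law₁_nonneg C₁) _) _)
    (mul_nonneg (seqProb_nonneg (law_nonneg (s.law₁_nonneg C₁) _) _)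
      (seqProb_nonneg (law_nonneg (s.law₁_nonneg C₁) _) _))

/-- The ratio is a density of `P(x|v)` with respect to `P(x)`. Only an inequality holds, since
divisions by zero may lose mass. -/
theorem sum_mul_ratioVX_le (v : Fin n → Fin s.v) :
    ∑ x, (∑ y, ∑ z, s.seqQ C₁ x y z) * s.ratioVX C₁ v x ≤ 1 := by
  have hV : 0 ≤ seqProb (s.lawV C₁) v := seqProb_nonneg (law_nonneg (s.law₁_nonneg C₁) _) _
  have hsum : ∑ x : Fin n → X₁, (seqProb (s.lawVX C₁) fun i => (v i, x i)) =
      seqProb (s.lawV C₁) v := by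
    unfold seqProb
    rw [sum_prod_pi fun i x => s.lawVX C₁ (v i, x)]
    refine Finset.prod_congr rfl fun i _ => ?_
    simp only [law_eq_sum]
    rw [Finset.sum_comm]
    refine Finset.sum_congr rfl fun ω _ => ?_
    simp only [Prod.mk.injEq, ind_and, ← Finset.mul_sum, sum_ind_eq, mul_one]
  calc _ ≤ ∑ x : Fin n → X₁, (seqProb (s.lawVX C₁) fun i => (v i, x i)) /
          seqProb (s.lawV C₁) v := by
        refine Finset.sum_le_sum fun x _ => ?_
        rw [sum_sum_seqQ_X, ratioVX]
        have hX : 0 ≤ seqProb (law (s.law₁ C₁) fun ω => ω.2.1) x :=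
          seqProb_nonneg (law_nonneg (s.law₁_nonneg C₁) _) _
        rcases hX.eq_or_lt with h0 | h0
        · rw [← h0, zero_mul]
          exact div_nonneg (seqProb_nonneg (law_nonneg (s.law₁_nonneg C₁) _) _) hV
        · refine le_of_eq ?_
          rw [mul_div_assoc', mul_comm (seqProb (s.lawV C₁) v)]
          exact mul_div_mul_left _ _ h0.ne'
    _ ≤ 1 := by
        rw [← Finset.sum_div, hsum]
        exact div_self_le_one _

/-- Typicality bounds the likelihood ratio of the pair from below by the exponents of `I(V;X₁)` and
`I(W;Y₂)`. On the prefix, the actual output law is that given `w₀` rather than the law of `Y₂`;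
comparing the two costs `c₀` per letter. -/
theorem bipJointlyTypical_le {ε c₀ : ℝ} (hc₀ : 1 ≤ c₀)
    (hY : ∀ y, 0 < s.lawY₂ C₂ y → 1 ≤ c₀ * s.lawY₂ C₂ y) (hn : 0 < n) {v : Fin n → Fin s.v}
    {x : Fin n → X₁} {w₀ : Fin l → Fin s.w₁} {w : Fin m → Fin s.w₁} {y : Fin (l + m) → Y₂}
    (h : BipJointlyTypical ε (s.lawVX C₁) (s.lawWY C₂) v (Fin.append w₀ w) x y) :
    (2 : ℝ) ^ (n * s.infoVX C₁ + ((l + m : ℕ) : ℝ) * s.infoW C₂ Prod.fst -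
        3 * ((n + (l + m) : ℕ) * ε)) / c₀ ^ l *
      (s.seqF C₂ Prod.fst w₀ (fun i => y (Fin.castAdd m i)) *
        seqProb (s.lawY₂ C₂) fun i => y (Fin.natAdd l i)) ≤
      s.ratioVX C₁ v x * s.seqF C₂ Prod.fst (Fin.append w₀ w) y := by
  obtain ⟨h1, h2, h3⟩ := (s.bipJointlyTypical_iff C₁ C₂ _ _ _ _).mp h
  have hN : 0 < n + (l + m) := by omega
  have a1 := (abs_le.mp (h1.abs_logb_le hN)).2
  have a2 := (abs_le.mp (h2.abs_logb_le hN)).2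
  have a3 := (abs_le.mp (h3.abs_logb_le hN)).1
  have n1 : ∀ v : Fin n → Fin s.v, 0 ≤ seqProb (s.lawV C₁) v := fun v =>
    seqProb_nonneg (law_nonneg (s.law₁_nonneg C₁) _) _
  have n2 : 0 ≤ seqProb (law (s.law₁ C₁) fun ω => ω.2.1) x :=
    seqProb_nonneg (law_nonneg (s.law₁_nonneg C₁) _) _
  have n3 : 0 ≤ seqProb (s.lawVX C₁) fun i => (v i, x i) :=
    seqProb_nonneg (law_nonneg (s.law₁_nonneg C₁) _) _
  have pW := pos_of_mul_pos_right h1.1 (n1 v)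
  have pV := pos_of_mul_pos_left h1.1 pW.le
  have pY := pos_of_mul_pos_right h2.1 n2
  have pX := pos_of_mul_pos_left h2.1 pY.le
  have pWY := pos_of_mul_pos_right h3.1 n3
  have pVX := pos_of_mul_pos_left h3.1 pWY.le
  have eWY := s.seqProb_WF C₂ Prod.fst (Fin.append w₀ w) y
  have key : (2 : ℝ) ^ (n * s.infoVX C₁ + ((l + m : ℕ) : ℝ) * s.infoW C₂ Prod.fst -
        3 * ((n + (l + m) : ℕ) * ε)) *
      ((seqProb (s.lawV C₁) v * seqProb (s.lawW C₂) (Fin.append w₀ w)) *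
        (seqProb (law (s.law₁ C₁) fun ω => ω.2.1) x * seqProb (s.lawY₂ C₂) y)) ≤
      (seqProb (s.lawVX C₁) fun i => (v i, x i)) *
          seqProb (s.lawWY C₂) fun i => (Fin.append w₀ w i, y i) := by
    refine rpow_mul_le_of_le_logb (mul_pos pVX pWY) (mul_pos (mul_pos pV pW) (mul_pos pX pY)) ?_
    rw [Real.logb_mul (mul_pos pV pW).ne' (mul_pos pX pY).ne']
    unfold infoVX infoW
    linarith
  set θ := (2 : ℝ) ^ (n * s.infoVX C₁ + ((l + m : ℕ) : ℝ) * s.infoW C₂ Prod.fst -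
        3 * ((n + (l + m) : ℕ) * ε)) with hθ
  have hθ0 : 0 < θ := by positivity
  have key2 : θ * seqProb (s.lawY₂ C₂) y ≤
      s.ratioVX C₁ v x * s.seqF C₂ Prod.fst (Fin.append w₀ w) y := by
    rw [ratioVX, div_mul_eq_mul_div, le_div_iff₀ (mul_pos pV pX)]
    refine le_of_mul_le_mul_left ?_ pW
    calc _ = θ * ((seqProb (s.lawV C₁) v * seqProb (s.lawW C₂) (Fin.append w₀ w)) *
        (seqProb (law (s.law₁ C₁) fun ω => ω.2.1) x * seqProb (s.lawY₂ C₂) y)) := by ring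
      _ ≤ _ := key
      _ = (seqProb (s.lawVX C₁) fun i => (v i, x i)) * (seqProb (s.lawW C₂) (Fin.append w₀ w) *
          s.seqF C₂ Prod.fst (Fin.append w₀ w) y) := by rw [← eWY]
      _ = _ := by ring
  have hYn : ∀ y, 0 ≤ s.lawY₂ C₂ y := law_nonneg (s.lawR_nonneg C₂) _
  have hsplit : seqProb (s.lawY₂ C₂) y = seqProb (s.lawY₂ C₂) (fun i => y (Fin.castAdd m i)) *
      seqProb (s.lawY₂ C₂) fun i => y (Fin.natAdd l i) := by
    simp [seqProb, Fin.prod_univ_add]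
  have hbd : s.seqF C₂ Prod.fst w₀ (fun i => y (Fin.castAdd m i)) ≤
      c₀ ^ l * seqProb (s.lawY₂ C₂) (fun i => y (Fin.castAdd m i)) := by
    refine (s.seqF_le_one C₂ _ _ _).trans ?_
    have : c₀ ^ l * seqProb (s.lawY₂ C₂) (fun i => y (Fin.castAdd m i)) =
        ∏ i : Fin l, c₀ * s.lawY₂ C₂ (y (Fin.castAdd m i)) := by
      simp [seqProb, Finset.prod_mul_distrib]
    rw [this]
    calc (1 : ℝ) = ∏ _i : Fin l, (1 : ℝ) := by simp
      _ ≤ _ := Finset.prod_le_prod (fun _ _ => zero_le_one)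
        fun i _ => hY _ (pos_of_seqProb_pos hYn pY _)
  refine le_trans ?_ key2
  rw [hsplit, div_mul_eq_mul_div, div_le_iff₀ (by positivity)]
  have n4 : 0 ≤ seqProb (s.lawY₂ C₂) fun i => y (Fin.natAdd l i) := seqProb_nonneg hYn _
  calc _ ≤ θ * (c₀ ^ l * seqProb (s.lawY₂ C₂) (fun i => y (Fin.castAdd m i)) *
        seqProb (s.lawY₂ C₂) fun i => y (Fin.natAdd l i)) := by gcongr
    _ = _ := by ring

/-- The prefix may deviate by `c₁` per letter. The decoder's tolerance `ε'`, averaged over the whole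
length, absorbs this when the prefix is a small part. -/
theorem bipJointlyTypical_of_typ {ε ε' c₁ : ℝ}
    (hcW : ∀ w, |Real.logb 2 (s.lawW C₂ w) + ent (s.lawR C₂) (fun ω => ω.2.1)| ≤ c₁)
    (hcY : ∀ y, |Real.logb 2 (s.lawY₂ C₂ y) + ent (s.lawR C₂) (fun ω => ω.2.2.1)| ≤ c₁)
    (hcWY : ∀ a, |Real.logb 2 (s.lawWY C₂ a) +
      ent (s.lawR C₂) (fun ω => (ω.2.1, ω.2.2.1))| ≤ c₁) (hn : 0 < n)
    (hN : n * ε + m * ε + l * c₁ < (n + (l + m) : ℕ) * ε') {v : Fin n → Fin s.v}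
    {x : Fin n → X₁} {y₁ : Fin n → Y₁} {z₁ : Fin n → Z₁} {w₀ : Fin l → Fin s.w₁}
    (hw₀ : ∀ i, 0 < s.lawW C₂ (w₀ i)) {u : Fin m → Fin s.w₂} {w : Fin m → Fin s.w₁}
    {y : Fin (l + m) → Y₂} {z : Fin (l + m) → Z₂} (h₁ : s.Typ₁ C₁ ε v x y₁ z₁)
    (h₂ : s.Typ₂ C₂ ε w₀ u w y z) :
    BipJointlyTypical ε' (s.lawVX C₁) (s.lawWY C₂) v (Fin.append w₀ w) x y := by
  obtain ⟨pV, aV⟩ := h₁.logb (fun ω => ω.1) 0 rfl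
  obtain ⟨pX, aX⟩ := h₁.logb (fun ω => ω.2.1) 1 rfl
  obtain ⟨pVX, aVX⟩ := h₁.logb (fun ω => (ω.1, ω.2.1)) 4 rfl
  obtain ⟨pW, aW⟩ := h₂.logb (fun ω => ω.2.1) 1 rfl
  obtain ⟨pY, aY⟩ := h₂.logb (fun ω => ω.2.2.1) 2 rfl
  obtain ⟨pWY, aWY⟩ := h₂.logb (fun ω => (ω.2.1, ω.2.2.1)) 5 rfl
  have hWY₀ : ∀ i : Fin l, 0 < s.lawWY C₂ (w₀ i, y (Fin.castAdd m i)) := by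
    intro i
    have := s.lawR_WF C₂ Prod.fst (w₀ i) (y (Fin.castAdd m i))
    refine lt_of_lt_of_eq (mul_pos ?_ ?_) this.symm
    · rw [← lawR_W s C₂]; exact hw₀ i
    · exact pos_of_seqProb_pos (p := fun a : Fin s.w₁ × Y₂ => law (s.chan C₂ a.1) Prod.fst a.2)
        (fun a => law_nonneg (s.chan_nonneg C₂ _) _ _)
        (u := fun i => (w₀ i, y (Fin.castAdd m i))) h₂.1 i
  have hY₀ : ∀ i : Fin l, 0 < s.lawY₂ C₂ (y (Fin.castAdd m i)) := fun i =>
    (hWY₀ i).trans_le (law_comp_le (s.lawR_nonneg C₂) (fun ω => (ω.2.1, ω.2.2.1)) Prod.snd _)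
  have bW := abs_logb_seqProb_le hcW hw₀
  have bY := abs_logb_seqProb_le hcY hY₀
  have bWY := abs_logb_seqProb_le (u := fun i => (w₀ i, y (Fin.castAdd m i))) hcWY hWY₀
  have qW := seqProb_pos hw₀
  have qY := seqProb_pos hY₀
  have qWY := seqProb_pos (u := fun i => (w₀ i, y (Fin.castAdd m i))) hWY₀
  have eY : seqProb (s.lawY₂ C₂) y = seqProb (s.lawY₂ C₂) (fun i => y (Fin.castAdd m i)) *
      seqProb (s.lawY₂ C₂) fun i => y (Fin.natAdd l i) := by
    simp [seqProb, Fin.prod_univ_add]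
  have eWY : (seqProb (s.lawWY C₂) fun i => (Fin.append w₀ w i, y i)) =
      (seqProb (s.lawWY C₂) fun i => (w₀ i, y (Fin.castAdd m i))) *
      seqProb (s.lawWY C₂) fun i => (w i, y (Fin.natAdd l i)) := by
    simp [seqProb, Fin.prod_univ_add]
  have hN0 : 0 < n + (l + m) := by omega
  rw [bipJointlyTypical_iff, seqProb_append, eY, eWY]
  have hd : ((l + m : ℕ) : ℝ) = l + m := by push_cast; ring
  have step : ∀ a b c ha hb : ℝ, 0 < a → 0 < b → 0 < c → |Real.logb 2 a + n * ha| ≤ n * ε →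
      |Real.logb 2 b + l * hb| ≤ l * c₁ → |Real.logb 2 c + m * hb| ≤ m * ε →
      NearEntropy ε' (n + (l + m)) (a * (b * c)) (n * ha + (l + m : ℕ) * hb) := by
    intro a b c ha hb pa pb pc h1 h2 h3
    refine nearEntropy_of_abs_logb_lt hN0 (by positivity) (lt_of_le_of_lt ?_ hN)
    rw [Real.logb_mul pa.ne' (by positivity), Real.logb_mul pb.ne' pc.ne', hd]
    rw [abs_le] at h1 h2 h3 ⊢
    constructor <;> linarith [h1.1, h1.2, h2.1, h2.2, h3.1, h3.2]
  exact ⟨step _ _ _ _ _ pV qW pW aV bW aW, step _ _ _ _ _ pX qY pY aX bY aY,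
    step _ _ _ _ _ pVX qWY pWY aVX bWY aWY⟩

end Bipartite
end Selection
end SKE

namespace SKE

/-! ### Codes for the two channels -/

variable {X₁ Y₁ Z₁ X₂ Y₂ Z₂ : Type*} [Fintype X₁] [Fintype Y₁] [Fintype Z₁]
  [Fintype X₂] [Fintype Y₂] [Fintype Z₂]

/-- A code for the two channels: covering codewords `v` with a choice rule `pk`, a fixed initial
sequence `w₀`, cloud centres `u`, an assignment `γ` of clouds and satellite codewords `w`. -/
structure SeqCode (s : Selection X₁ Y₁ X₂) (n l m A B N : ℕ) where
  /-- the covering codewords -/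
  v : Fin A → Fin n → Fin s.v
  /-- the choice rule -/
  pk : (Fin n → Y₁) → Fin A
  /-- the initial part of the transmission -/
  w₀ : Fin l → Fin s.w₁
  /-- the cloud centres -/
  u : Fin N → Fin m → Fin s.w₂
  /-- the assignment of clouds -/
  γ : Fin A × Fin B → Fin N
  /-- the satellite codewords -/
  w : Fin A × Fin B → Fin m → Fin s.w₁

namespace SeqCode

variable {s : Selection X₁ Y₁ X₂} {n l m A B N : ℕ}

/-- The sequences are typical and no wrong codeword fits. -/
def Good (D : SeqCode s n l m A B N) (C₁ : DMBC X₁ Y₁ Z₁) (C₂ : DMBC X₂ Y₂ Z₂) (ε ε' : ℝ)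
    (x : Fin n → X₁) (y₁ : Fin n → Y₁) (z₁ : Fin n → Z₁) (j : Fin B) (y : Fin (l + m) → Y₂)
    (z : Fin (l + m) → Z₂) : Prop :=
  s.Typ₁ C₁ ε (D.v (D.pk y₁)) x y₁ z₁ ∧
  s.Typ₂ C₂ ε D.w₀ (D.u (D.γ (D.pk y₁, j))) (D.w (D.pk y₁, j)) y z ∧
  ∀ c', c' ≠ (D.pk y₁, j) → ¬ BipJointlyTypical ε' (s.lawVX C₁) (s.lawWY C₂)
    (D.v c'.1) (Fin.append D.w₀ (D.w c')) x y

/-- The expectation of a function of a run that uses the code. -/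
noncomputable def expect (D : SeqCode s n l m A B N) (C₁ : DMBC X₁ Y₁ Z₁) (C₂ : DMBC X₂ Y₂ Z₂)
    (f : (Fin n → X₁) → (Fin n → Y₁) → (Fin n → Z₁) → Fin B → (Fin (l + m) → Y₂) →
      (Fin (l + m) → Z₂) → ℝ) : ℝ :=
  ∑ y₁, ∑ x, ∑ z₁, s.seqQ C₁ x y₁ z₁ * ∑ j, 1 / (B : ℝ) * ∑ y, ∑ z,
    s.seqK C₂ (Fin.append D.w₀ (D.w (D.pk y₁, j))) y z * f x y₁ z₁ j y z

/-- A dominating law of the eavesdropper's view: the observation of the initiator's channel and a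
mixture over the cloud centres. -/
noncomputable def viewLaw (D : SeqCode s n l m A B N) (C₁ : DMBC X₁ Y₁ Z₁) (C₂ : DMBC X₂ Y₂ Z₂)
    (z : (Fin n → Z₁) × (Fin (l + m) → Z₂)) : ℝ :=
  seqProb (law (s.law₁ C₁) fun ω => ω.2.2.2) z.1 *
    ∑ k, 1 / (N : ℝ) * ∑ w, s.seqW (D.u k) w * s.seqF C₂ Prod.snd (Fin.append D.w₀ w) z.2

theorem viewLaw_nonneg (D : SeqCode s n l m A B N) (C₁ : DMBC X₁ Y₁ Z₁) (C₂ : DMBC X₂ Y₂ Z₂)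
    (z : (Fin n → Z₁) × (Fin (l + m) → Z₂)) : 0 ≤ D.viewLaw C₁ C₂ z :=
  mul_nonneg (seqProb_nonneg (law_nonneg (s.law₁_nonneg C₁) _) _) <|
    Finset.sum_nonneg fun _ _ => mul_nonneg (by positivity) <|
      Finset.sum_nonneg fun _ _ => mul_nonneg (s.seqW_nonneg _ _) (s.seqF_nonneg C₂ _ _ _)

theorem sum_viewLaw_le (D : SeqCode s n l m A B N) (C₁ : DMBC X₁ Y₁ Z₁) (C₂ : DMBC X₂ Y₂ Z₂) :
    ∑ z, D.viewLaw C₁ C₂ z ≤ 1 := by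
  simp only [viewLaw, Fintype.sum_prod_type, ← Finset.mul_sum, ← Finset.sum_mul]
  rw [sum_seqProb _ (by rw [sum_law, s.sum_law₁]), one_mul, Finset.sum_comm]
  have : ∀ k : Fin N, ∑ z, ∑ w, s.seqW (D.u k) w * s.seqF C₂ Prod.snd (Fin.append D.w₀ w) z =
      1 := by
    intro k
    rw [Finset.sum_comm]
    simp only [← Finset.mul_sum, Selection.sum_seqF, mul_one, Selection.sum_seqW]
  simp only [this]
  rcases Nat.eq_zero_or_pos N with rfl | h
  · simp
  · have : (0 : ℝ) < N := by exact_mod_cast h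
    simp [this.ne']

/-- On good runs, a message and a view of the eavesdropper are almost independent. -/
theorem expect_view_le (D : SeqCode s n l m A B N) (C₁ : DMBC X₁ Y₁ Z₁) (C₂ : DMBC X₂ Y₂ Z₂)
    {ε ε' : ℝ} (c : Fin A × Fin B) (z : (Fin n → Z₁) × (Fin (l + m) → Z₂)) :
    D.expect C₁ C₂ (fun x y₁ z₁ j y z₂ => ind ((D.pk y₁, j) = c) * ind ((z₁, z₂) = z) *
      ind (D.Good C₁ C₂ ε ε' x y₁ z₁ j y z₂)) ≤
    ((2 : ℝ) ^ (n * (s.infoVZ C₁ + 3 * ε)) / 2 ^ (n * (s.infoVY C₁ - 3 * ε)) * (1 / B) *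
      (2 ^ (m * (s.infoW C₂ Prod.snd - s.infoU C₂ Prod.snd + 4 * ε)) * N)) *
      D.viewLaw C₁ C₂ z := by
  obtain ⟨i, j⟩ := c
  obtain ⟨z₁, z₂⟩ := z
  set s₃ : ℝ := 2 ^ (m * (s.infoW C₂ Prod.snd - s.infoU C₂ Prod.snd + 4 * ε)) with hs₃
  set κ : ℝ := ∑ w, s.seqW (D.u (D.γ (i, j))) w * s.seqF C₂ Prod.snd (Fin.append D.w₀ w) z₂
    with hκ
  -- The law of one cloud is at most `N` times the average over all clouds. This makes the reference
  -- law independent of the message, at a price of `log N ≈ m I(U;Y₂)` bits.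
  have hmix : κ ≤ N * ∑ k, 1 / (N : ℝ) * ∑ w, s.seqW (D.u k) w *
      s.seqF C₂ Prod.snd (Fin.append D.w₀ w) z₂ := by
    have hN : (0 : ℝ) < N := by exact_mod_cast (D.γ (i, j)).pos
    rw [← Finset.mul_sum, ← mul_assoc, mul_one_div_cancel hN.ne', one_mul]
    exact Finset.single_le_sum (f := fun k => ∑ w, s.seqW (D.u k) w *
      s.seqF C₂ Prod.snd (Fin.append D.w₀ w) z₂) (fun k _ => Finset.sum_nonneg fun w _ =>
        mul_nonneg (s.seqW_nonneg _ _) (s.seqF_nonneg C₂ _ _ _)) (mem_univ (D.γ (i, j)))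
  have hκ0 : 0 ≤ κ := Finset.sum_nonneg fun w _ =>
    mul_nonneg (s.seqW_nonneg _ _) (s.seqF_nonneg C₂ _ _ _)
  have hs0 : 0 < s₃ := by positivity
  have hin : ∀ (x : Fin n → X₁) (y₁ : Fin n → Y₁) (z₁' : Fin n → Z₁),
      ∑ j', 1 / (B : ℝ) * ∑ y, ∑ z, s.seqK C₂ (Fin.append D.w₀ (D.w (D.pk y₁, j'))) y z *
        (ind ((D.pk y₁, j') = (i, j)) * ind ((z₁', z) = (z₁, z₂)) *
          ind (D.Good C₁ C₂ ε ε' x y₁ z₁' j' y z)) ≤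
      ind (z₁' = z₁) * (ind (D.pk y₁ = i) * ind (s.Typ₁ C₁ ε (D.v i) x y₁ z₁)) *
        (1 / B * (s₃ * κ)) := by
    intro x y₁ z₁'
    by_cases hz : z₁' = z₁
    swap
    · rw [ind_false hz]
      refine le_of_eq ?_
      rw [zero_mul, zero_mul]
      refine Finset.sum_eq_zero fun j' _ => ?_
      rw [Finset.sum_eq_zero fun y _ => Finset.sum_eq_zero fun z _ => ?_, mul_zero]
      rw [ind_false fun h : (z₁', z) = (z₁, z₂) => hz (congrArg Prod.fst h), mul_zero, zero_mul,
        mul_zero]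
    by_cases hi : D.pk y₁ = i
    swap
    · rw [ind_false hi]
      refine le_of_eq ?_
      rw [zero_mul, mul_zero, zero_mul]
      refine Finset.sum_eq_zero fun j' _ => ?_
      rw [Finset.sum_eq_zero fun y _ => Finset.sum_eq_zero fun z _ => ?_, mul_zero]
      rw [ind_false fun h : (D.pk y₁, j') = (i, j) => hi (congrArg Prod.fst h), zero_mul, zero_mul,
        mul_zero]
    subst hz
    rw [ind_true rfl, ind_true hi, one_mul, one_mul]
    by_cases hT : s.Typ₁ C₁ ε (D.v i) x y₁ z₁'
    swap
    · rw [ind_false hT, zero_mul]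
      refine le_of_eq (Finset.sum_eq_zero fun j' _ => ?_)
      rw [Finset.sum_eq_zero fun y _ => Finset.sum_eq_zero fun z _ => ?_, mul_zero]
      rw [ind_false (p := D.Good C₁ C₂ ε ε' x y₁ z₁' j' y z)
        (fun h => hT (by rw [← hi]; exact h.1)), mul_zero, mul_zero]
    rw [ind_true hT, one_mul]
    calc _ ≤ ∑ j', ind (j = j') * (1 / (B : ℝ) * (s₃ * κ)) := by
          refine Finset.sum_le_sum fun j' _ => ?_
          by_cases hj : j = j'
          swap
          · rw [ind_false hj, zero_mul]
            refine le_of_eq ?_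
            rw [Finset.sum_eq_zero fun y _ => Finset.sum_eq_zero fun z _ => ?_, mul_zero]
            rw [ind_false fun h : (D.pk y₁, j') = (i, j) => hj (congrArg Prod.snd h).symm,
              zero_mul, zero_mul, mul_zero]
          subst hj
          rw [ind_true rfl, one_mul]
          refine mul_le_mul_of_nonneg_left ?_ (by positivity)
          -- The satellite estimate depends on `z₂` only: one typical `y` makes it available for the
          -- whole sum over `y`; without one the sum vanishes.
          by_cases hne : ∃ y, s.Typ₂ C₂ ε D.w₀ (D.u (D.γ (i, j))) (D.w (i, j)) y z₂
          · obtain ⟨y₀, hy₀⟩ := hne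
            calc _ ≤ ∑ y, s.seqK C₂ (Fin.append D.w₀ (D.w (i, j))) y z₂ := by
                  refine Finset.sum_le_sum fun y _ => ?_
                  rw [← sum_mul_ind_eq z₂
                    (fun z => s.seqK C₂ (Fin.append D.w₀ (D.w (i, j))) y z)]
                  refine Finset.sum_le_sum fun z _ => ?_
                  rw [hi]
                  refine mul_le_mul_of_nonneg_left ?_ (s.seqK_nonneg C₂ _ _ _)
                  rw [ind_true rfl, one_mul, show ((z₁', z) = (z₁', z₂)) = (z = z₂) by simp]
                  exact mul_le_of_le_one_right (ind_nonneg _) (ind_le_one _)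
              _ = s.seqF C₂ Prod.snd (Fin.append D.w₀ (D.w (i, j))) z₂ := s.sum_seqK_left C₂ _ _
              _ ≤ _ := hy₀.seqF_snd_le
          · refine le_trans (le_of_eq ?_) (mul_nonneg hs0.le hκ0)
            refine Finset.sum_eq_zero fun y _ => Finset.sum_eq_zero fun z _ => ?_
            by_cases hz : z = z₂
            · subst hz
              rw [ind_false (p := D.Good C₁ C₂ ε ε' x y₁ z₁' j y z)
                (fun h => hne ⟨y, by rw [← hi]; exact h.2.1⟩), mul_zero, mul_zero]
            · rw [ind_false fun h : (z₁', z) = (z₁', z₂) => hz (congrArg Prod.snd h), mul_zero,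
                zero_mul, mul_zero]
      _ = _ := by rw [sum_ind_eq_mul]
  have hpick := sum_picked_le (s.seqQ_nonneg C₁) s.seqV_nonneg
    (pV := seqProb (s.lawV C₁)) (pZ := seqProb (law (s.law₁ C₁) fun ω => ω.2.2.2))
    (fun _ => seqProb_nonneg (law_nonneg (s.law₁_nonneg C₁) _) _) (s.Typ₁ C₁ ε)
    (s₁ := (2 : ℝ) ^ (n * (s.infoVY C₁ - 3 * ε))) (s₂ := (2 : ℝ) ^ (n * (s.infoVZ C₁ + 3 * ε)))
    (by positivity) (by positivity) (fun v x y z h => (h.logb (fun ω => ω.1) 0 rfl).1)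
    (fun v x y z h => h.le_seqV) (fun v x y z h => h.lawVZ_le) D.v D.pk i z₁
  calc _ ≤ ∑ y₁, ∑ x, ∑ z₁', s.seqQ C₁ x y₁ z₁' * (ind (z₁' = z₁) *
        (ind (D.pk y₁ = i) * ind (s.Typ₁ C₁ ε (D.v i) x y₁ z₁)) * (1 / B * (s₃ * κ))) := by
        refine Finset.sum_le_sum fun y₁ _ => Finset.sum_le_sum fun x _ =>
          Finset.sum_le_sum fun z₁' _ => mul_le_mul_of_nonneg_left (hin x y₁ z₁')
          (s.seqQ_nonneg C₁ _ _ _)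
    _ = (∑ y₁, ∑ x, s.seqQ C₁ x y₁ z₁ * (ind (D.pk y₁ = i) *
          ind (s.Typ₁ C₁ ε (D.v i) x y₁ z₁))) * (1 / B * (s₃ * κ)) := by
        simp only [Finset.sum_mul]
        refine Finset.sum_congr rfl fun y₁ _ => Finset.sum_congr rfl fun x _ => ?_
        rw [← sum_mul_ind_eq z₁ (fun z₁' => s.seqQ C₁ x y₁ z₁'), Finset.sum_mul, Finset.sum_mul]
        exact Finset.sum_congr rfl fun z₁' _ => by ring
    _ ≤ (2 ^ (n * (s.infoVZ C₁ + 3 * ε)) / 2 ^ (n * (s.infoVY C₁ - 3 * ε)) *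
          seqProb (law (s.law₁ C₁) fun ω => ω.2.2.2) z₁) * (1 / B * (s₃ * (N *
            ∑ k, 1 / (N : ℝ) * ∑ w, s.seqW (D.u k) w *
              s.seqF C₂ Prod.snd (Fin.append D.w₀ w) z₂))) := by
        refine mul_le_mul hpick ?_ (by positivity) (mul_nonneg (by positivity)
          (seqProb_nonneg (law_nonneg (s.law₁_nonneg C₁) _) _))
        gcongr
    _ = _ := by rw [viewLaw]; ring

end SeqCode

theorem exists_forall_one_le_mul {α : Type*} [Fintype α] {p : α → ℝ} :
    ∃ c : ℝ, 1 ≤ c ∧ ∀ a, 0 < p a → 1 ≤ c * p a := by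
  classical
  refine ⟨1 + ∑ a, |1 / p a|, by
    have := Finset.sum_nonneg (s := univ) fun a _ => abs_nonneg (1 / p a)
    linarith, fun a ha => ?_⟩
  have h1 : 1 / p a ≤ ∑ a, |1 / p a| := (le_abs_self _).trans
    (Finset.single_le_sum (f := fun a => |1 / p a|) (fun a _ => abs_nonneg _) (mem_univ a))
  calc 1 = 1 / p a * p a := by field_simp
    _ ≤ (1 + ∑ a, |1 / p a|) * p a := by
      gcongr
      linarith

theorem exists_forall_abs_le {α : Type*} [Fintype α] (f : α → ℝ) : ∃ c : ℝ, 0 ≤ c ∧ ∀ a, |f a| ≤ c :=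
  ⟨∑ a, |f a|, Finset.sum_nonneg fun _ _ => abs_nonneg _, fun a =>
    Finset.single_le_sum (f := fun a => |f a|) (fun _ _ => abs_nonneg _) (mem_univ a)⟩

/-- Existence of a code for which runs are mostly good. -/
theorem exists_seqCode (s : Selection X₁ Y₁ X₂) (C₁ : DMBC X₁ Y₁ Z₁) (C₂ : DMBC X₂ Y₂ Z₂)
    {ε ε' c c₀ η' : ℝ} (hε : ε < ε') {n l m A B N : ℕ} (hn : 0 < n) (hA : 0 < A) (hB : 0 < B)
    (hN : 0 < N) (w₀ : Fin l → Fin s.w₁) (hc1 : c / n < 1)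
    (h₁ : ∑ y : Fin n → Y₁, ∑ v, s.seqV y v *
      ∑ x, ∑ z, s.seqQ C₁ x y z * ind (¬ s.Typ₁ C₁ ε v x y z) ≤ c / n)
    (h₂ : ∑ u : Fin m → Fin s.w₂, ∑ w, ∑ y, ∑ z, seqProb s.pU u * s.seqW u w *
      s.seqK C₂ (Fin.append w₀ w) y z * ind (¬ s.Typ₂ C₂ ε w₀ u w y z) ≤ c / m)
    (hc₀ : 1 ≤ c₀) (hY : ∀ y, 0 < s.lawY₂ C₂ y → 1 ≤ c₀ * s.lawY₂ C₂ y)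
    (hη' : 0 < η') (hη'1 : η' ≤ 1) :
    ∃ D : SeqCode s n l m A B N, D.w₀ = w₀ ∧ (∀ i, Typical ε' (s.lawV C₁) (D.v i)) ∧
      (∀ y, (∃ i, JointlyTypical ε' (s.lawVY C₁) (D.v i) y) →
        JointlyTypical ε' (s.lawVY C₁) (D.v (D.pk y)) y) ∧
      D.expect C₁ C₂ (fun x y₁ z₁ j y z => ind (¬ D.Good C₁ C₂ ε ε' x y₁ z₁ j y z)) ≤
        c / n / η' + (2 : ℝ) ^ (n * (s.infoVY C₁ + 3 * ε')) / A + η' + (c / m +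
          (1 + (2 : ℝ) ^ (m * (s.infoU C₂ Prod.fst + 3 * ε)) / N) * (A * B /
            ((2 : ℝ) ^ (n * s.infoVX C₁ + ((l + m : ℕ) : ℝ) * s.infoW C₂ Prod.fst -
              3 * ((n + (l + m) : ℕ) * ε')) / c₀ ^ l))) := by
  -- Codewords are drawn from the law of `V` conditioned on typicality, as every member of the
  -- codebook has to be typical. Normalising by `M ≤ 1` only increases the weights, so the covering
  -- bound survives.
  set q₀ : (Fin n → Fin s.v) → ℝ := fun v => seqProb (s.lawV C₁) v *
    ind (Typical ε' (s.lawV C₁) v) with hq₀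
  have hV0 : ∀ v : Fin n → Fin s.v, 0 ≤ seqProb (s.lawV C₁) v := fun v =>
    seqProb_nonneg (law_nonneg (s.law₁_nonneg C₁) _) v
  have hq₀0 : ∀ v, 0 ≤ q₀ v := fun v => mul_nonneg (hV0 v) (ind_nonneg _)
  set M := ∑ v, q₀ v with hM
  have hM1 : M ≤ 1 := by
    rw [← sum_seqProb (s.lawV C₁) (by rw [sum_law, s.sum_law₁]) n]
    exact Finset.sum_le_sum fun v _ => mul_le_of_le_one_right (hV0 v) (ind_le_one _)
  have hM0 : 0 < M := by
    obtain ⟨v, x, y, z, h⟩ := s.exists_not_typ₁_lt C₁ h₁ hc1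
    have hj := h.jointlyTypical hε hn
    have ht := ((s.jointlyTypical_iff C₁ v y).mp hj).1
    refine lt_of_lt_of_le ht.1 (le_trans ?_
      (Finset.single_le_sum (fun v _ => hq₀0 v) (mem_univ v)))
    simp only [hq₀]
    rw [ind_true (show Typical ε' (s.lawV C₁) v from ht), mul_one]
  have hJT : ∀ (v : Fin n → Fin s.v) (y : Fin n → Y₁), JointlyTypical ε' (s.lawVY C₁) v y →
      s.seqV y v ≤ (2 : ℝ) ^ (n * (s.infoVY C₁ + 3 * ε')) * (q₀ v / M) := by
    intro v y h
    refine (s.jointlyTypical_seqV_le C₁ hn h).trans ?_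
    gcongr
    rw [le_div_iff₀ hM0]
    have ht := ((s.jointlyTypical_iff C₁ v y).mp h).1
    simp only [hq₀]
    rw [ind_true (show Typical ε' (s.lawV C₁) v from ht), mul_one]
    exact mul_le_of_le_one_right (hV0 v) hM1
  obtain ⟨v, pk, u, γ, w, hv, hpk, herr⟩ := exists_code (s.seqQ_nonneg C₁)
    (s.sum_sum_seqQ_Y C₁) (sum_seqProb _ (by rw [sum_law, s.sum_law₁]) n) s.seqV_nonneg s.sum_seqV
    (q := fun v => q₀ v / M) (fun v => div_nonneg (hq₀0 v) hM0.le)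
    (by rw [← Finset.sum_div]; exact div_self hM0.ne')
    (fun v y => JointlyTypical ε' (s.lawVY C₁) v y) (by positivity) hJT (s.Typ₁ C₁ ε)
    (fun v x y z h => h.jointlyTypical hε hn) h₁ hη' hη'1 hA hN
    (fun u => seqProb_nonneg s.pU_nonneg u) (sum_seqProb _ s.sum_pU m) s.seqW_nonneg s.sum_seqW
    (k := fun w => s.seqK C₂ (Fin.append w₀ w)) (fun w => s.seqK_nonneg C₂ _)
    (fun w => s.sum_sum_seqK C₂ _) (s.Typ₂ C₂ ε w₀) h₂
    (pY' := fun y => s.seqF C₂ Prod.fst w₀ (fun i => y (Fin.castAdd m i)) *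
        seqProb (s.lawY₂ C₂) fun i => y (Fin.natAdd l i))
    (fun y => by
      simp only [Selection.sum_seqK_right]
      exact Selection.sum_sum_seqProb_mul_seqF Prod.fst w₀ y)
    (r := (2 : ℝ) ^ (m * (s.infoU C₂ Prod.fst + 3 * ε))) (by positivity)
    (fun u w y z h => by
      simp only [Selection.sum_seqK_right]
      exact h.sum_seqF_fst_le)
    (fun v w x y => BipJointlyTypical ε' (s.lawVX C₁) (s.lawWY C₂) v (Fin.append w₀ w) x y)
    (ρ := s.ratioVX C₁) (s.ratioVX_nonneg C₁) (s.sum_mul_ratioVX_le C₁)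
    (θ := (2 : ℝ) ^ (n * s.infoVX C₁ + ((l + m : ℕ) : ℝ) * s.infoW C₂ Prod.fst -
              3 * ((n + (l + m) : ℕ) * ε')) / c₀ ^ l)
    (by have : 0 < c₀ := by linarith
        positivity)
    (fun v w x y h => by
      rw [Selection.sum_seqK_right]
      exact s.bipJointlyTypical_le C₁ C₂ hc₀ hY hn h) hB
  refine ⟨⟨v, pk, w₀, u, γ, w⟩, rfl, fun i => ?_, hpk, herr⟩
  by_contra hno
  have := hv i
  simp only [hq₀] at this
  rw [ind_false hno, mul_zero, zero_div] at this
  exact lt_irrefl _ this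

end SKE

namespace SKE

/-! ### Labelled alphabets -/

section Label

/-- The letter of a labelled letter. -/
def unlabel {k t : ℕ} (a : Fin (k * t)) : Fin k := (finProdFinEquiv.symm a).1

/-- The letter `i` with the label `j`. -/
def label {k t : ℕ} (i : Fin k) (j : Fin t) : Fin (k * t) := finProdFinEquiv (i, j)

theorem unlabel_label {k t : ℕ} (i : Fin k) (j : Fin t) : unlabel (label i j) = i := by
  simp [unlabel, label]

theorem label_injective {k t : ℕ} {i i' : Fin k} {j j' : Fin t} (h : label i j = label i' j') :
    j = j' := (Prod.mk.inj (finProdFinEquiv.injective h)).2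

theorem sum_unlabel {k t : ℕ} (F : Fin k → ℝ) :
    ∑ a : Fin (k * t), F (unlabel a) = t * ∑ i, F i := by
  rw [← Equiv.sum_comp finProdFinEquiv, Fintype.sum_prod_type]
  simp [unlabel, Finset.mul_sum]

variable {k t : ℕ} {β : Type*} [Fintype β]

/-- The joint law when the first component carries a uniform label. -/
noncomputable def blow (t : ℕ) (p : Fin k × β → ℝ) : Fin (k * t) × β → ℝ :=
  fun x => p (unlabel x.1, x.2) / t

theorem law_prod_fst {α : Type*} [Fintype α] (p : α × β → ℝ) (a : α) :
    law p Prod.fst a = ∑ b, p (a, b) := by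
  rw [law_eq_sum, Fintype.sum_prod_type]
  simp only [← Finset.sum_mul, sum_mul_ind_eq]

theorem law_prod_snd {α : Type*} [Fintype α] (p : α × β → ℝ) (b : β) :
    law p Prod.snd b = ∑ a, p (a, b) := by
  rw [law_eq_sum, Fintype.sum_prod_type]
  simp only [sum_mul_ind_eq]

theorem law_blow_fst (p : Fin k × β → ℝ) (a : Fin (k * t)) :
    law (blow t p) Prod.fst a = law p Prod.fst (unlabel a) / t := by
  rw [law_prod_fst, law_prod_fst, Finset.sum_div]
  rfl

theorem law_blow_snd (ht : 0 < t) (p : Fin k × β → ℝ) :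
    law (blow t p) Prod.snd = law p Prod.snd := by
  have ht' : (0 : ℝ) < t := by exact_mod_cast ht
  funext b
  rw [law_prod_snd, law_prod_snd]
  simp only [blow, ← Finset.sum_div]
  rw [sum_unlabel (fun i => p (i, b)), mul_div_cancel_left₀ _ ht'.ne']

/-- A uniform label adds `log t` bits; `hf` says that `f` is `t`-to-one as far as sums are
concerned. -/
theorem entropy_of_label {α α' : Type*} [Fintype α] [Fintype α'] {f : α' → α} (ht : 0 < t)
    (hf : ∀ F : α → ℝ, ∑ a, F (f a) = t * ∑ i, F i) {p : α → ℝ} (hp : ∀ a, 0 ≤ p a)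
    (h1 : ∑ a, p a = 1) : entropy (fun a => p (f a) / t) = entropy p + Real.logb 2 t := by
  have ht' : (0 : ℝ) < t := by exact_mod_cast ht
  unfold entropy
  rw [hf (fun a => -(p a / t * Real.logb 2 (p a / t))), Finset.mul_sum]
  have : ∑ a, p a * Real.logb 2 t = Real.logb 2 t := by rw [← Finset.sum_mul, h1, one_mul]
  rw [← this, ← Finset.sum_add_distrib]
  refine Finset.sum_congr rfl fun a _ => ?_
  rcases (hp a).eq_or_lt with h0 | h0
  · simp [← h0]
  · rw [Real.logb_div h0.ne' ht'.ne']
    field_simp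
    ring

theorem seqProb_of_label {α α' : Type*} {f : α' → α} (p : α → ℝ) {n : ℕ} (u : Fin n → α') :
    seqProb (fun a => p (f a) / t) u = seqProb p (fun i => f (u i)) / t ^ n := by
  simp [seqProb, Finset.prod_div_distrib]

/-- Labels divide the probability by `T` and raise the entropy by `log T`, and the two effects
cancel. Hence labelled and unlabelled sequences have the same typicality. -/
theorem nearEntropy_div_iff {ε P h T h' : ℝ} {N : ℕ} (hT : 0 < T) (hh : h' = h + Real.logb 2 T) :
    NearEntropy ε N (P / T) h' ↔ NearEntropy ε N P h := by
  unfold NearEntropy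
  have h1 : 0 < P / T ↔ 0 < P := ⟨fun h => by
    have := mul_pos h hT
    rwa [div_mul_cancel₀ _ hT.ne'] at this, fun h => div_pos h hT⟩
  rw [h1]
  refine and_congr_right fun hP => ?_
  rw [Real.logb_div hP.ne' hT.ne', hh]
  refine iff_of_eq ?_
  congr 2
  ring

theorem sum_unlabel_prod (F : Fin k × β → ℝ) :
    ∑ a : Fin (k * t) × β, F (unlabel a.1, a.2) = t * ∑ i, F i := by
  rw [Fintype.sum_prod_type, Fintype.sum_prod_type, ← sum_unlabel]

variable {p : Fin k × β → ℝ}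

theorem entropy_blow (ht : 0 < t) (hp : ∀ a, 0 ≤ p a) (h1 : ∑ a, p a = 1) :
    entropy (blow t p) = entropy p + Real.logb 2 t :=
  entropy_of_label (f := fun a : Fin (k * t) × β => (unlabel a.1, a.2)) ht sum_unlabel_prod hp h1

theorem entropy_law_blow_fst (ht : 0 < t) (hp : ∀ a, 0 ≤ p a) (h1 : ∑ a, p a = 1) :
    entropy (law (blow t p) Prod.fst) = entropy (law p Prod.fst) + Real.logb 2 t := by
  rw [← entropy_of_label (f := unlabel) ht sum_unlabel (law_nonneg hp _) (by rw [sum_law, h1])]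
  congr 1
  funext a
  exact law_blow_fst p a

theorem seqProb_law_blow_fst {n : ℕ} (u : Fin n → Fin (k * t)) :
    seqProb (law (blow t p) Prod.fst) u =
      seqProb (law p Prod.fst) (fun i => unlabel (u i)) / t ^ n := by
  rw [← seqProb_of_label]
  congr 1
  funext a
  exact law_blow_fst p a

theorem seqProb_blow {n : ℕ} (u : Fin n → Fin (k * t)) (y : Fin n → β) :
    (seqProb (blow t p) fun i => (u i, y i)) =
      (seqProb p fun i => (unlabel (u i), y i)) / t ^ n :=
  seqProb_of_label (f := fun a : Fin (k * t) × β => (unlabel a.1, a.2)) p _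

theorem typical_blow_iff (ht : 0 < t) (hp : ∀ a, 0 ≤ p a) (h1 : ∑ a, p a = 1) {ε : ℝ} {n : ℕ}
    (u : Fin n → Fin (k * t)) : Typical ε (law (blow t p) Prod.fst) u ↔
      Typical ε (law p Prod.fst) fun i => unlabel (u i) := by
  have ht' : (0 : ℝ) < t := by exact_mod_cast ht
  unfold Typical
  rw [seqProb_law_blow_fst, entropy_law_blow_fst ht hp h1]
  exact nearEntropy_div_iff (by positivity) (by rw [Real.logb_pow]; ring)

theorem jointlyTypical_blow_iff (ht : 0 < t) (hp : ∀ a, 0 ≤ p a) (h1 : ∑ a, p a = 1) {ε : ℝ}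
    {n : ℕ} (u : Fin n → Fin (k * t)) (y : Fin n → β) : JointlyTypical ε (blow t p) u y ↔
      JointlyTypical ε p (fun i => unlabel (u i)) y := by
  have ht' : (0 : ℝ) < t := by exact_mod_cast ht
  unfold JointlyTypical
  rw [typical_blow_iff ht hp h1, law_blow_snd ht]
  refine and_congr_right fun _ => and_congr_right fun _ => ?_
  unfold Typical
  rw [seqProb_blow, entropy_blow ht hp h1]
  exact nearEntropy_div_iff (by positivity) (by rw [Real.logb_pow]; ring)

theorem bipJointlyTypical_blow_iff {k' t' : ℕ} {β' : Type*} [Fintype β'] {q : Fin k' × β' → ℝ}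
    (ht : 0 < t) (hp : ∀ a, 0 ≤ p a) (h1 : ∑ a, p a = 1) (ht' : 0 < t') (hq : ∀ a, 0 ≤ q a)
    (hq1 : ∑ a, q a = 1) {ε : ℝ} {n d : ℕ} (u : Fin n → Fin (k * t)) (w : Fin d → Fin (k' * t'))
    (x : Fin n → β) (y : Fin d → β') :
    BipJointlyTypical ε (blow t p) (blow t' q) u w x y ↔
      BipJointlyTypical ε p q (fun i => unlabel (u i)) (fun i => unlabel (w i)) x y := by
  have r1 : (0 : ℝ) < t := by exact_mod_cast ht
  have r2 : (0 : ℝ) < t' := by exact_mod_cast ht'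
  have hT : (0 : ℝ) < t ^ n * t' ^ d := by positivity
  have hl : Real.logb 2 ((t : ℝ) ^ n * (t' : ℝ) ^ d) = n * Real.logb 2 t + d * Real.logb 2 t' := by
    rw [Real.logb_mul (by positivity) (by positivity), Real.logb_pow, Real.logb_pow]
  unfold BipJointlyTypical
  rw [law_blow_snd ht, law_blow_snd ht']
  refine and_congr ?_ (and_congr_right fun _ => ?_)
  · unfold BipTypical
    rw [seqProb_law_blow_fst, seqProb_law_blow_fst, entropy_law_blow_fst ht hp h1,
      entropy_law_blow_fst ht' hq hq1, div_mul_div_comm]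
    exact nearEntropy_div_iff hT (by rw [hl]; ring)
  · unfold BipTypical
    rw [seqProb_blow, seqProb_blow, entropy_blow ht hp h1, entropy_blow ht' hq hq1,
      div_mul_div_comm]
    exact nearEntropy_div_iff hT (by rw [hl]; ring)

end Label

/-! ### Selections over labelled alphabets -/

namespace Selection

variable {X₁ Y₁ Z₁ X₂ Y₂ Z₂ : Type*} [Fintype X₁] [Fintype Y₁] [Fintype Z₁]
  [Fintype X₂] [Fintype Y₂] [Fintype Z₂]
  (s : Selection X₁ Y₁ X₂) (C₁ : DMBC X₁ Y₁ Z₁) (C₂ : DMBC X₂ Y₂ Z₂) (t₁ t₂ : ℕ)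

/-- The selection in which `V` and `W₁` carry independent uniform labels and `W₂` is constant. -/
noncomputable def labelled (h₁ : 0 < t₁) (h₂ : 0 < t₂) : Selection X₁ Y₁ X₂ where
  v := s.v * t₁
  w₁ := s.w₁ * t₂
  w₂ := 1
  pX := s.pX
  pV y := ⟨fun a => (s.pV y).1 (unlabel a) / t₁,
    fun _ => div_nonneg (stdSimplex_nonneg _ _) (Nat.cast_nonneg _), by
      have : (t₁ : ℝ) ≠ 0 := by exact_mod_cast h₁.ne'
      rw [← Finset.sum_div, sum_unlabel fun i => (s.pV y).1 i, stdSimplex_sum, mul_one,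
        div_self this]⟩
  pW := ⟨fun a => s.pW₁ (unlabel a.2) / t₂,
    fun _ => div_nonneg (s.pW₁_nonneg _) (Nat.cast_nonneg _), by
      have : (t₂ : ℝ) ≠ 0 := by exact_mod_cast h₂.ne'
      have h1 : ∑ w, s.pW₁ w = 1 := by
        unfold pW₁
        rw [Finset.sum_comm]
        exact s.sum_sum_pW
      rw [Fintype.sum_prod_type]
      simp only [← Finset.sum_div, sum_unlabel, h1]
      simp [this]⟩
  pXW a := s.pXW (unlabel a)

variable {t₁ t₂} (h₁ : 0 < t₁) (h₂ : 0 < t₂)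

theorem law₁_VX (v : Fin s.v) (x : X₁) :
    s.lawVX C₁ (v, x) = ∑ y, ∑ z, s.pX.1 x * (C₁ x).1 (y, z) * (s.pV y).1 v := by
  rw [lawVX, law_eq_sum]
  simp only [Fintype.sum_prod_type, law₁, Prod.mk.injEq, ind_and, ← mul_assoc]
  calc ∑ v', ∑ x', ∑ y, ∑ z, s.pX.1 x' * (C₁ x').1 (y, z) * (s.pV y).1 v' * ind (v' = v) *
        ind (x' = x)
      = ∑ v', (∑ y, ∑ z, s.pX.1 x * (C₁ x).1 (y, z) * (s.pV y).1 v') * ind (v' = v) := by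
        simp only [← Finset.sum_mul, sum_mul_ind_eq]
    _ = _ := by rw [sum_mul_ind_eq]

theorem lawVX_labelled : (s.labelled t₁ t₂ h₁ h₂).lawVX C₁ = blow t₁ (s.lawVX C₁) := by
  funext a
  obtain ⟨a, x⟩ := a
  change _ = s.lawVX C₁ (unlabel a, x) / t₁
  rw [law₁_VX, law₁_VX]
  simp only [labelled, Finset.sum_div, mul_div_assoc']

theorem lawVY_labelled : (s.labelled t₁ t₂ h₁ h₂).lawVY C₁ = blow t₁ (s.lawVY C₁) := by
  funext a
  obtain ⟨a, y⟩ := a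
  change _ = s.lawVY C₁ (unlabel a, y) / t₁
  rw [lawVY, law₁_VY, lawVY, law₁_VY, law₁_Y, law₁_Y]
  simp only [labelled, mul_div_assoc]

theorem lawWY_labelled : (s.labelled t₁ t₂ h₁ h₂).lawWY C₂ = blow t₂ (s.lawWY C₂) := by
  funext a
  obtain ⟨a, y⟩ := a
  have e1 := (s.labelled t₁ t₂ h₁ h₂).lawR_WF C₂ Prod.fst a y
  have e2 := s.lawR_WF C₂ Prod.fst (unlabel a) y
  refine e1.trans (Eq.trans ?_ (congrArg (· / (t₂ : ℝ)) e2).symm)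
  have e3 : (s.labelled t₁ t₂ h₁ h₂).pW₁ a = s.pW₁ (unlabel a) / t₂ := by
    change ∑ _u : Fin 1, s.pW₁ (unlabel a) / t₂ = _
    simp
  have e4 : (s.labelled t₁ t₂ h₁ h₂).chan C₂ a = s.chan C₂ (unlabel a) := rfl
  rw [e3, e4]
  ring

theorem law_law₂_WY :
    law (s.law₂ C₂) (fun (_, b, _, y, _) => (b, y)) = s.lawWY C₂ := by
  rw [lawWY, ← law_law₂, law_law]

theorem sum_lawVX : ∑ a, s.lawVX C₁ a = 1 := by rw [sum_law, s.sum_law₁]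

theorem sum_lawVY : ∑ a, s.lawVY C₁ a = 1 := by rw [sum_law, s.sum_law₁]

theorem sum_lawWY : ∑ a, s.lawWY C₂ a = 1 := by rw [sum_law, s.sum_lawR]

theorem lawV_eq : s.lawV C₁ = law (s.lawVY C₁) Prod.fst := by
  rw [lawVY, law_law]

theorem lawW_eq : s.lawW C₂ = law (s.lawWY C₂) Prod.fst := by
  rw [lawWY, law_law]

end Selection
end SKE

namespace SKE

/-! ### The protocol instance of a code -/

/-- The members of an indexed set, as a finite set. -/
noncomputable def rangeEquiv {ι β : Type*} [Fintype ι] (f : ι ↪ β) :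
    ι ≃ (univ.map f : Finset β) :=
  Equiv.ofBijective (fun i => ⟨f i, Finset.mem_map_of_mem _ (mem_univ i)⟩)
    ⟨fun _ _ h => f.injective (congrArg Subtype.val h), fun ⟨b, hb⟩ => by
      obtain ⟨i, -, rfl⟩ := Finset.mem_map.mp hb
      exact ⟨i, rfl⟩⟩

variable {X₁ Y₁ Z₁ X₂ Y₂ Z₂ : Type*} [Fintype X₁] [Fintype Y₁] [Fintype Z₁]
  [Fintype X₂] [Fintype Y₂] [Fintype Z₂]

namespace SeqCode

variable {s : Selection X₁ Y₁ X₂} {n l m A B N t₁ t₂ : ℕ}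

/-- The codewords with labels. -/
def wordV (D : SeqCode s n l m A B N) (τ : Fin A ↪ (Fin n → Fin t₁)) :
    Fin A ↪ (Fin n → Fin (s.v * t₁)) :=
  ⟨fun i k => label (D.v i k) (τ i k), fun _ _ h => τ.injective <|
    funext fun k => label_injective (congrFun h k)⟩

/-- The initial sequence with labels. -/
def wordW (D : SeqCode s n l m A B N) (τ : Fin B ↪ (Fin l → Fin t₂)) :
    Fin B ↪ (Fin l → Fin (s.w₁ * t₂)) :=
  ⟨fun i k => label (D.w₀ k) (τ i k), fun _ _ h => τ.injective <|
    funext fun k => label_injective (congrFun h k)⟩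

theorem unlabel_wordV (D : SeqCode s n l m A B N) (τ : Fin A ↪ (Fin n → Fin t₁)) (i : Fin A) :
    (fun k => unlabel (D.wordV τ i k)) = D.v i := funext fun _ => unlabel_label _ _

theorem unlabel_wordW (D : SeqCode s n l m A B N) (τ : Fin B ↪ (Fin l → Fin t₂)) (i : Fin B) :
    (fun k => unlabel (D.wordW τ i k)) = D.w₀ := funext fun _ => unlabel_label _ _

variable (C₁ : DMBC X₁ Y₁ Z₁) (C₂ : DMBC X₂ Y₂ Z₂)

/-- The requirements on a code that make it an instance of the protocol. -/
structure Admissible (D : SeqCode s n l m A B N) (ε' : ℝ) : Prop where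
  pos : 0 < ε'
  n_pos : 0 < n
  B_pos : 0 < B
  v_typical : ∀ i, Typical ε' (s.lawV C₁) (D.v i)
  w₀_typical : Typical ε' (s.lawW C₂) D.w₀
  pk_typical : ∀ y, (∃ i, JointlyTypical ε' (s.lawVY C₁) (D.v i) y) →
    JointlyTypical ε' (s.lawVY C₁) (D.v (D.pk y)) y

variable {C₁ C₂}

theorem wordV_typical {D : SeqCode s n l m A B N} {ε' : ℝ} (h : D.Admissible C₁ C₂ ε')
    (h₁ : 0 < t₁) (τ : Fin A ↪ (Fin n → Fin t₁)) (i : Fin A) {p : Fin (s.v * t₁) → ℝ}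
    (hp : p = law (blow t₁ (s.lawVY C₁)) Prod.fst) : Typical ε' p (D.wordV τ i) := by
  rw [hp]
  refine (typical_blow_iff h₁ (law_nonneg (s.law₁_nonneg C₁) _) (s.sum_lawVY C₁) _).mpr ?_
  rw [unlabel_wordV, ← Selection.lawV_eq]
  exact h.v_typical i

theorem wordV_jointlyTypical_iff {D : SeqCode s n l m A B N} {ε' : ℝ}
    (h₁ : 0 < t₁) (τ : Fin A ↪ (Fin n → Fin t₁)) (i : Fin A) (y : Fin n → Y₁)
    {p : Fin (s.v * t₁) × Y₁ → ℝ} (hp : p = blow t₁ (s.lawVY C₁)) :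
    JointlyTypical ε' p (D.wordV τ i) y ↔ JointlyTypical ε' (s.lawVY C₁) (D.v i) y := by
  rw [hp]
  refine (jointlyTypical_blow_iff h₁ (law_nonneg (s.law₁_nonneg C₁) _) (s.sum_lawVY C₁) _ _).trans ?_
  rw [unlabel_wordV]

theorem wordW_typical {D : SeqCode s n l m A B N} {ε' : ℝ} (h : D.Admissible C₁ C₂ ε')
    (h₂ : 0 < t₂) (τ : Fin B ↪ (Fin l → Fin t₂)) (i : Fin B) {p : Fin (s.w₁ * t₂) → ℝ}
    (hp : p = law (blow t₂ (s.lawWY C₂)) Prod.fst) : Typical ε' p (D.wordW τ i) := by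
  rw [hp]
  refine (typical_blow_iff h₂ (law_nonneg (s.lawR_nonneg C₂) _) (s.sum_lawWY C₂) _).mpr ?_
  rw [unlabel_wordW, ← Selection.lawW_eq]
  exact h.w₀_typical

theorem labelled_law_V (h₁ : 0 < t₁) (h₂ : 0 < t₂) :
    law ((s.labelled t₁ t₂ h₁ h₂).law₁ C₁) (fun (a, _, _, _) => a) =
      law (blow t₁ (s.lawVY C₁)) Prod.fst :=
  ((s.labelled t₁ t₂ h₁ h₂).lawV_eq C₁).trans <|
    congrArg (fun p => law p Prod.fst) (s.lawVY_labelled C₁ h₁ h₂)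

theorem law_law₂_W (s : Selection X₁ Y₁ X₂) :
    law (s.law₂ C₂) (fun (_, b, _, _, _) => b) = law (s.lawWY C₂) Prod.fst := by
  rw [← Selection.law_law₂_WY, law_law]

theorem labelled_law_W (h₁ : 0 < t₁) (h₂ : 0 < t₂) :
    law ((s.labelled t₁ t₂ h₁ h₂).law₂ C₂) (fun (_, b, _, _, _) => b) =
      law (blow t₂ (s.lawWY C₂)) Prod.fst :=
  (law_law₂_W (s.labelled t₁ t₂ h₁ h₂)).trans <|
    congrArg (fun p => law p Prod.fst) (s.lawWY_labelled C₂ h₁ h₂)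

variable {K M : ℕ}

/-- The protocol instance of a code. -/
noncomputable def toICC {D : SeqCode s n l m A B N} {ε' : ℝ} (h : D.Admissible C₁ C₂ ε')
    (h₁ : 0 < t₁) (h₂ : 0 < t₂) (τV : Fin A ↪ (Fin n → Fin t₁)) (τW : Fin B ↪ (Fin l → Fin t₂))
    (e : Fin A × Fin B ≃ Fin K × Fin M) : ICC C₁ C₂ where
  toSelection := s.labelled t₁ t₂ h₁ h₂
  ε := ε'
  ε_pos := h.pos
  n₁ := n
  n₂₁ := l
  n₂₂ := m
  length_pos := Nat.add_pos_left h.n_pos _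
  codeV := univ.map (D.wordV τV)
  codeV_typical c hc := by
    obtain ⟨i, -, rfl⟩ := Finset.mem_map.mp hc
    exact wordV_typical h h₁ τV i (labelled_law_V h₁ h₂)
  codeW := univ.map (D.wordW τW)
  codeW_typical c hc := by
    obtain ⟨i, -, rfl⟩ := Finset.mem_map.mp hc
    exact wordW_typical h h₂ τW i (labelled_law_W h₁ h₂)
  codeW_nonempty := ⟨_, Finset.mem_map_of_mem _ (mem_univ (⟨0, h.B_pos⟩ : Fin B))⟩
  pick y := rangeEquiv (D.wordV τV) (D.pk y)
  pick_typical y := by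
    rintro ⟨c, hc⟩
    obtain ⟨i, rfl⟩ := (rangeEquiv (D.wordV τV)).surjective c
    exact (wordV_jointlyTypical_iff h₁ τV _ y (s.lawVY_labelled C₁ h₁ h₂)).mpr
      (h.pk_typical y ⟨i, (wordV_jointlyTypical_iff h₁ τV _ y (s.lawVY_labelled C₁ h₁ h₂)).mp hc⟩)
  -- The superposition codeword of the pair is the parity part. It needs no distinguishing labels,
  -- so label `0` is used throughout.
  parity c d k := label (D.w ((rangeEquiv (D.wordV τV)).symm c, (rangeEquiv (D.wordW τW)).symm d) k)
    ⟨0, h₂⟩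
  K := K
  g c := (e ((rangeEquiv (D.wordV τV)).symm c.1, (rangeEquiv (D.wordW τW)).symm c.2)).1
  g_equal := by
    have key : ∀ i : Fin K, Nat.card {c : (univ.map (D.wordV τV) : Finset _) ×
        (univ.map (D.wordW τW) : Finset _) //
        (e ((rangeEquiv (D.wordV τV)).symm c.1, (rangeEquiv (D.wordW τW)).symm c.2)).1 = i} =
        Nat.card (Fin M) := by
      intro i
      refine Nat.card_congr ?_
      refine (Equiv.subtypeEquiv (((rangeEquiv (D.wordV τV)).symm.prodCongr
        (rangeEquiv (D.wordW τW)).symm).trans e) (q := fun c => c.1 = i) fun _ => Iff.rfl).trans ?_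
      exact ⟨fun c => c.1.2, fun b => ⟨(i, b), rfl⟩, fun ⟨⟨a, b⟩, hc⟩ => by
        simp only at hc; subst hc; rfl, fun _ => rfl⟩
    exact fun i j => (key i).trans (key j).symm

end SeqCode
end SKE

namespace SKE

/-! ### Runs of the protocol instance -/

variable {X₁ Y₁ Z₁ X₂ Y₂ Z₂ : Type*} [Fintype X₁] [Fintype Y₁] [Fintype Z₁]
  [Fintype X₂] [Fintype Y₂] [Fintype Z₂]

namespace SeqCode

variable {s : Selection X₁ Y₁ X₂} {n l m A B N t₁ t₂ K M : ℕ}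
  {C₁ : DMBC X₁ Y₁ Z₁} {C₂ : DMBC X₂ Y₂ Z₂}

theorem sum_mul_seqK (w : Fin n → Fin s.w₁) (F : (Fin n → Y₂) → (Fin n → Z₂) → ℝ) :
    ∑ x : Fin n → X₂, ∑ y, ∑ z, (∏ j, (s.pXW (w j)).1 (x j) * (C₂ (x j)).1 (y j, z j)) * F y z =
      ∑ y, ∑ z, s.seqK C₂ w y z * F y z := by
  rw [Finset.sum_comm]
  refine Finset.sum_congr rfl fun y _ => ?_
  rw [Finset.sum_comm]
  refine Finset.sum_congr rfl fun z _ => ?_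
  rw [← Finset.sum_mul, sum_prod_pi fun j a => (s.pXW (w j)).1 a * (C₂ a).1 (y j, z j)]
  rfl

theorem unlabel_append (D : SeqCode s n l m A B N) (τ : Fin B ↪ (Fin l → Fin t₂)) (h₂ : 0 < t₂)
    (j : Fin B) (c : Fin A × Fin B) (k : Fin (l + m)) :
    unlabel (Fin.append (D.wordW τ j) (fun k => (label (D.w c k) ⟨0, h₂⟩ : Fin (s.w₁ * t₂))) k) =
      Fin.append D.w₀ (D.w c) k := by
  refine Fin.addCases (fun k => ?_) (fun k => ?_) k
  · rw [Fin.append_left, Fin.append_left]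
    exact unlabel_label _ _
  · rw [Fin.append_right, Fin.append_right]
    exact unlabel_label _ _

theorem toICC_enc {D : SeqCode s n l m A B N} {ε' : ℝ} (h : D.Admissible C₁ C₂ ε')
    (h₁ : 0 < t₁) (h₂ : 0 < t₂) (τV : Fin A ↪ (Fin n → Fin t₁)) (τW : Fin B ↪ (Fin l → Fin t₂))
    (e : Fin A × Fin B ≃ Fin K × Fin M) (i : Fin A) (j : Fin B) :
    (toICC h h₁ h₂ τV τW e).enc (rangeEquiv (D.wordV τV) i, rangeEquiv (D.wordW τW) j) =
      (D.wordV τV i, Fin.append (D.wordW τW j)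
        fun k => (label (D.w (i, j) k) ⟨0, h₂⟩ : Fin (s.w₁ * t₂))) := by
  change (_, Fin.append _ fun k => label (D.w ((rangeEquiv (D.wordV τV)).symm _,
    (rangeEquiv (D.wordW τW)).symm _) k) _) = _
  rw [Equiv.symm_apply_apply, Equiv.symm_apply_apply]
  rfl

/-- The channel reads letters without labels, so a run of the instance has the statistics of the
code `D`. The auxiliary input `x₂` is summed out. -/
theorem sum_runLaw {D : SeqCode s n l m A B N} {ε' : ℝ} (h : D.Admissible C₁ C₂ ε')
    (h₁ : 0 < t₁) (h₂ : 0 < t₂) (τV : Fin A ↪ (Fin n → Fin t₁)) (τW : Fin B ↪ (Fin l → Fin t₂))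
    (e : Fin A × Fin B ≃ Fin K × Fin M)
    (f : (Fin n → X₁) → (Fin n → Y₁) → (Fin n → Z₁) → Fin B → (Fin (l + m) → Y₂) →
      (Fin (l + m) → Z₂) → ℝ) :
    ∑ ω, (toICC h h₁ h₂ τV τW e).runLaw ω * f ω.1 ω.2.1 ω.2.2.1
      ((rangeEquiv (D.wordW τW)).symm ω.2.2.2.1) ω.2.2.2.2.2.1 ω.2.2.2.2.2.2 =
    D.expect C₁ C₂ f := by
  change ∑ ω : (Fin n → X₁) × (Fin n → Y₁) × (Fin n → Z₁) × (univ.map (D.wordW τW) : Finset _) ×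
    (Fin (l + m) → X₂) × (Fin (l + m) → Y₂) × (Fin (l + m) → Z₂),
    (s.seqQ C₁ ω.1 ω.2.1 ω.2.2.1 * (1 / ((univ.map (D.wordW τW)).card : ℝ)) *
      ∏ j, (s.pXW (unlabel (((toICC h h₁ h₂ τV τW e).enc
        (rangeEquiv (D.wordV τV) (D.pk ω.2.1), ω.2.2.2.1)).2 j))).1 (ω.2.2.2.2.1 j) *
        (C₂ (ω.2.2.2.2.1 j)).1 (ω.2.2.2.2.2.1 j, ω.2.2.2.2.2.2 j)) * _ = _
  rw [Finset.card_map, Finset.card_univ, Fintype.card_fin, Fintype.sum_prod_type]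
  simp only [Fintype.sum_prod_type]
  unfold expect
  rw [Finset.sum_comm]
  refine Finset.sum_congr rfl fun y₁ _ => Finset.sum_congr rfl fun x _ =>
    Finset.sum_congr rfl fun z₁ _ => ?_
  rw [← Equiv.sum_comp (rangeEquiv (D.wordW τW)), Finset.mul_sum]
  refine Finset.sum_congr rfl fun j _ => ?_
  simp only [toICC_enc, Equiv.symm_apply_apply]
  rw [← sum_mul_seqK]
  simp only [mul_assoc, ← Finset.mul_sum]
  refine congrArg₂ _ rfl (congrArg₂ _ rfl (Finset.sum_congr rfl fun x₂ _ =>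
    Finset.sum_congr rfl fun y _ => Finset.sum_congr rfl fun z _ =>
      congrArg (· * _) (Finset.prod_congr rfl fun k _ => ?_)))
  exact congrArg (fun a => (s.pXW a).1 (x₂ k) * (C₂ (x₂ k)).1 (y k, z k))
    (unlabel_append D τW h₂ j _ k)

theorem toICC_runLaw_nonneg {D : SeqCode s n l m A B N} {ε' : ℝ} (h : D.Admissible C₁ C₂ ε')
    (h₁ : 0 < t₁) (h₂ : 0 < t₂) (τV : Fin A ↪ (Fin n → Fin t₁)) (τW : Fin B ↪ (Fin l → Fin t₂))
    (e : Fin A × Fin B ≃ Fin K × Fin M) (ω) : 0 ≤ (toICC h h₁ h₂ τV τW e).runLaw ω :=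
  mul_nonneg (mul_nonneg (s.seqQ_nonneg C₁ _ _ _) (by positivity)) <|
    Finset.prod_nonneg fun _ _ =>
      mul_nonneg (stdSimplex_nonneg _ _) (stdSimplex_nonneg _ _)

theorem expect_one (D : SeqCode s n l m A B N) (hB : 0 < B) :
    D.expect C₁ C₂ (fun _ _ _ _ _ _ => 1) = 1 := by
  have hB' : (B : ℝ) ≠ 0 := by exact_mod_cast hB.ne'
  simp only [expect, mul_one, s.sum_sum_seqK, Finset.sum_const, card_univ,
    Fintype.card_fin, nsmul_eq_mul]
  simp only [mul_one_div_cancel hB', mul_one, s.sum_sum_seqQ_Y]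
  exact sum_seqProb _ (by rw [sum_law, s.sum_law₁]) n

/-- Labels do not affect bipartite typicality, so the decoder of the instance is the decoder
analysed for `D`. -/
theorem toICC_fits_iff {D : SeqCode s n l m A B N} {ε' : ℝ} (h : D.Admissible C₁ C₂ ε')
    (h₁ : 0 < t₁) (h₂ : 0 < t₂) (τV : Fin A ↪ (Fin n → Fin t₁)) (τW : Fin B ↪ (Fin l → Fin t₂))
    (e : Fin A × Fin B ≃ Fin K × Fin M) (x : Fin n → X₁) (y : Fin (l + m) → Y₂)
    (i : Fin A) (j : Fin B) :
    (toICC h h₁ h₂ τV τW e).Fits x y (rangeEquiv (D.wordV τV) i, rangeEquiv (D.wordW τW) j) ↔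
      BipJointlyTypical ε' (s.lawVX C₁) (s.lawWY C₂) (D.v i) (Fin.append D.w₀ (D.w (i, j))) x y := by
  have hp : law ((s.labelled t₁ t₂ h₁ h₂).law₁ C₁) (fun (a, x, _, _) => (a, x)) =
      blow t₁ (s.lawVX C₁) := s.lawVX_labelled C₁ h₁ h₂
  have hq : law ((s.labelled t₁ t₂ h₁ h₂).law₂ C₂) (fun (_, b, _, y, _) => (b, y)) =
      blow t₂ (s.lawWY C₂) :=
    ((s.labelled t₁ t₂ h₁ h₂).law_law₂_WY C₂).trans (s.lawWY_labelled C₂ h₁ h₂)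
  have key := bipJointlyTypical_blow_iff (ε := ε') h₁ (law_nonneg (s.law₁_nonneg C₁) _)
    (s.sum_lawVX C₁) h₂ (law_nonneg (s.lawR_nonneg C₂) _) (s.sum_lawWY C₂) (D.wordV τV i)
    (Fin.append (D.wordW τW j) fun k => (label (D.w (i, j) k) ⟨0, h₂⟩ : Fin (s.w₁ * t₂))) x y
  rw [unlabel_wordV, funext (unlabel_append D τW h₂ j (i, j))] at key
  refine Iff.trans (iff_of_eq ?_) key
  have henc := toICC_enc h h₁ h₂ τV τW e i j
  unfold ICC.Fits
  rw [henc]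
  exact congrArg₂ (fun p q => BipJointlyTypical ε' p q (D.wordV τV i)
    (Fin.append (D.wordW τW j) fun k => (label (D.w (i, j) k) ⟨0, h₂⟩ : Fin (s.w₁ * t₂))) x y) hp hq

end SeqCode
end SKE

namespace SKE

/-! ### Security of the protocol instance -/

variable {X₁ Y₁ Z₁ X₂ Y₂ Z₂ : Type*} [Fintype X₁] [Fintype Y₁] [Fintype Z₁]
  [Fintype X₂] [Fintype Y₂] [Fintype Z₂]

theorem ICC.dec_eq_some {C₁ : DMBC X₁ Y₁ Z₁} {C₂ : DMBC X₂ Y₂ Z₂} (Γ : ICC C₁ C₂)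
    {x : Fin Γ.n₁ → X₁} {y : Fin Γ.n₂ → Y₂} {c : Γ.codeV × Γ.codeW} (hc : Γ.Fits x y c)
    (huniq : ∀ c', Γ.Fits x y c' → c' = c) : Γ.dec x y = some c := by
  have h : ∃! c, Γ.Fits x y c := ⟨c, hc, huniq⟩
  unfold ICC.dec
  rw [dif_pos h]
  exact congrArg some (huniq _ h.choose_spec.1)

namespace SeqCode

variable {s : Selection X₁ Y₁ X₂} {n l m A B N t₁ t₂ K M : ℕ}
  {C₁ : DMBC X₁ Y₁ Z₁} {C₂ : DMBC X₂ Y₂ Z₂}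

/-- On a good run the chosen codeword is jointly typical, the true pair fits by `hbip`, and no other
pair does; so the decoder returns it. -/
theorem not_error_of_good {D : SeqCode s n l m A B N} {ε ε' : ℝ} (h : D.Admissible C₁ C₂ ε')
    (h₁ : 0 < t₁) (h₂ : 0 < t₂) (τV : Fin A ↪ (Fin n → Fin t₁)) (τW : Fin B ↪ (Fin l → Fin t₂))
    (e : Fin A × Fin B ≃ Fin K × Fin M) (hε : ε < ε')
    (hbip : ∀ x y₁ z₁ j y z, D.Good C₁ C₂ ε ε' x y₁ z₁ j y z →
      BipJointlyTypical ε' (s.lawVX C₁) (s.lawWY C₂) (D.v (D.pk y₁))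
        (Fin.append D.w₀ (D.w (D.pk y₁, j))) x y)
    (ω : (toICC h h₁ h₂ τV τW e).Outcome)
    (hg : D.Good C₁ C₂ ε ε' ω.1 ω.2.1 ω.2.2.1 ((rangeEquiv (D.wordW τW)).symm ω.2.2.2.1)
      ω.2.2.2.2.2.1 ω.2.2.2.2.2.2) :
    ¬ ((toICC h h₁ h₂ τV τW e).PickFails ω ∨
      (toICC h h₁ h₂ τV τW e).keyEstimate ω ≠ some ((toICC h h₁ h₂ τV τW e).key ω)) := by
  obtain ⟨x, y₁, z₁, w, x₂, y, z⟩ := ω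
  obtain ⟨j, rfl⟩ := (rangeEquiv (D.wordW τW)).surjective w
  replace hg : D.Good C₁ C₂ ε ε' x y₁ z₁ j y z := by
    have := hg
    simp only [Equiv.symm_apply_apply] at this
    exact this
  refine not_or.mpr ⟨fun hp => hp ?_, not_not.mpr ?_⟩
  · exact ⟨rangeEquiv (D.wordV τV) (D.pk y₁),
      (wordV_jointlyTypical_iff h₁ τV _ y₁ (s.lawVY_labelled C₁ h₁ h₂)).mpr
        (hg.1.jointlyTypical hε h.n_pos)⟩
  · have hd := (toICC h h₁ h₂ τV τW e).dec_eq_some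
      ((toICC_fits_iff h h₁ h₂ τV τW e x y (D.pk y₁) j).mpr (hbip x y₁ z₁ j y z hg)) (by
        rintro ⟨c₁, c₂⟩ hc
        obtain ⟨i', rfl⟩ := (rangeEquiv (D.wordV τV)).surjective c₁
        obtain ⟨j', rfl⟩ := (rangeEquiv (D.wordW τW)).surjective c₂
        by_contra hne
        refine hg.2.2 (i', j') (fun heq => hne ?_)
          ((toICC_fits_iff h h₁ h₂ τV τW e x y i' j').mp hc)
        obtain ⟨rfl, rfl⟩ := Prod.mk.inj heq
        rfl)
    exact congrArg (Option.map (toICC h h₁ h₂ τV τW e).g) hd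

/-- A good code yields a secure instance of the protocol. -/
theorem exists_icc {D : SeqCode s n l m A B N} {ε ε' β : ℝ} (h : D.Admissible C₁ C₂ ε')
    (h₁ : 0 < t₁) (h₂ : 0 < t₂) (hA : A ≤ t₁ ^ n) (hB : B ≤ t₂ ^ l) (hKM : A * B = K * M)
    (hε : ε < ε')
    (hbip : ∀ x y₁ z₁ j y z, D.Good C₁ C₂ ε ε' x y₁ z₁ j y z →
      BipJointlyTypical ε' (s.lawVX C₁) (s.lawWY C₂) (D.v (D.pk y₁))
        (Fin.append D.w₀ (D.w (D.pk y₁, j))) x y)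
    (hβ : 0 < β)
    (hbad : D.expect C₁ C₂ (fun x y₁ z₁ j y z => ind (¬ D.Good C₁ C₂ ε ε' x y₁ z₁ j y z)) ≤ β)
    (hK : (2 : ℝ) ^ (n * (s.infoVZ C₁ + 3 * ε)) / 2 ^ (n * (s.infoVY C₁ - 3 * ε)) * (1 / B) *
      (2 ^ (m * (s.infoW C₂ Prod.snd - s.infoU C₂ Prod.snd + 4 * ε)) * N) ≤ 1 / K)
    (hL : 1 ≤ K * β ^ 2 / 2) :
    ∃ Γ : ICC C₁ C₂, Γ.ε = ε' ∧ Γ.n₁ = n ∧ Γ.n₂ = l + m ∧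
      prob Γ.runLaw (fun ω => Γ.PickFails ω ∨ Γ.keyEstimate ω ≠ some (Γ.key ω)) ≤ β ∧
      (1 - 6 * β) * Real.logb 2 (K * β ^ 2 / 2) ≤ condEnt Γ.runLaw Γ.key Γ.viewE ∧
      condEnt Γ.runLaw Γ.key Γ.viewE ≤ ent Γ.runLaw Γ.key ∧
      ent Γ.runLaw Γ.key ≤ Real.logb 2 K := by
  classical
  -- Label sequences that make the codewords distinct, even where the random code repeats itself.
  obtain ⟨τV⟩ : Nonempty (Fin A ↪ (Fin n → Fin t₁)) :=
    Function.Embedding.nonempty_of_card_le (by simpa using hA)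
  obtain ⟨τW⟩ : Nonempty (Fin B ↪ (Fin l → Fin t₂)) :=
    Function.Embedding.nonempty_of_card_le (by simpa using hB)
  obtain ⟨e⟩ : Nonempty (Fin A × Fin B ≃ Fin K × Fin M) :=
    Fintype.card_eq.mp (by simpa using hKM)
  -- The law of a run does not involve the partition. So the estimates for `Γ₀` remain valid after
  -- `e` is replaced by `σ.trans e`, which only changes the key.
  set Γ₀ := toICC h h₁ h₂ τV τW e with hΓ₀
  set eW := rangeEquiv (D.wordW τW) with heW
  have hP0 : ∀ ω, 0 ≤ Γ₀.runLaw ω := toICC_runLaw_nonneg h h₁ h₂ τV τW e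
  have hP1 : ∑ ω, Γ₀.runLaw ω = 1 := by
    have := sum_runLaw h h₁ h₂ τV τW e fun _ _ _ _ _ _ => 1
    rw [expect_one D h.B_pos] at this
    simpa only [mul_one] using this
  set G : Γ₀.Outcome → Prop := fun ω => D.Good C₁ C₂ ε ε' ω.1 ω.2.1 ω.2.2.1
    (eW.symm ω.2.2.2.1) ω.2.2.2.2.2.1 ω.2.2.2.2.2.2 with hG
  have hGβ : ∑ ω, Γ₀.runLaw ω * ind (¬ G ω) ≤ β :=
    (sum_runLaw h h₁ h₂ τV τW e fun x y₁ z₁ j y z =>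
      ind (¬ D.Good C₁ C₂ ε ε' x y₁ z₁ j y z)).trans_le hbad
  have hK0 : (0 : ℝ) < K := by
    rcases Nat.eq_zero_or_pos K with h0 | h0
    · rw [h0] at hL; norm_num at hL
    · exact_mod_cast h0
  obtain ⟨σ, hσ⟩ := exists_perm_le_condEnt hP0 hP1
    (fun ω => ((D.pk ω.2.1, eW.symm ω.2.2.2.1) : Fin A × Fin B)) Γ₀.viewE G
    (fun c => (e c).1) (M := M) (by
      intro k
      rw [← Equiv.sum_comp e.symm, Fintype.sum_prod_type]
      simp only [Equiv.apply_symm_apply, Finset.sum_const, card_univ, Fintype.card_fin,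
        nsmul_eq_mul, ← Finset.mul_sum]
      have : ∑ i : Fin K, ind (i = k) = 1 := by
        rw [← sum_ind_eq k]
        exact Finset.sum_congr rfl fun i _ => congrArg ind (propext eq_comm)
      rw [this, mul_one])
    (τ := D.viewLaw C₁ C₂) (D.viewLaw_nonneg C₁ C₂) (D.sum_viewLaw_le C₁ C₂) (by
      intro c z
      refine (sum_runLaw h h₁ h₂ τV τW e fun x y₁ z₁ j y z₂ => ind ((D.pk y₁, j) = c) *
        ind ((z₁, z₂) = z) * ind (D.Good C₁ C₂ ε ε' x y₁ z₁ j y z₂)).trans_le ?_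
      refine (D.expect_view_le C₁ C₂ c z).trans ?_
      exact (mul_le_mul_of_nonneg_right hK (D.viewLaw_nonneg C₁ C₂ z)).trans_eq
        (one_div_mul_eq_div _ _)) hβ hGβ hL
  refine ⟨toICC h h₁ h₂ τV τW (σ.trans e), rfl, rfl, rfl, ?_, ?_, ?_, ?_⟩
  · rw [prob_eq_sum]
    refine le_trans (Finset.sum_le_sum fun ω _ => mul_le_mul_of_nonneg_left (ind_mono ?_)
      (toICC_runLaw_nonneg h h₁ h₂ τV τW (σ.trans e) ω)) hGβ
    exact fun herr hg => not_error_of_good h h₁ h₂ τV τW (σ.trans e) hε hbip ω hg herr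
  · refine hσ.trans (le_of_eq ?_)
    refine congrArg (fun A => condEnt Γ₀.runLaw A Γ₀.viewE) (funext fun ω => ?_)
    change _ = (e (σ ((rangeEquiv (D.wordV τV)).symm (rangeEquiv (D.wordV τV) (D.pk ω.2.1)),
      eW.symm ω.2.2.2.1))).1
    rw [Equiv.symm_apply_apply]
  · exact condEnt_le_ent hP0 hP1 _ _
  · refine (ent_le_logb_card (P := Γ₀.runLaw) hP0 hP1 _).trans (le_of_eq ?_)
    change Real.logb 2 (Fintype.card (Fin K)) = _
    rw [Fintype.card_fin]

end SeqCode
end SKE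

namespace SKE

/-! ### Nonnegativity of information, existence of typical sequences -/

section Nonneg

variable {Ω α β γ : Type*} [Fintype Ω] [Fintype α] [Fintype β] [Fintype γ]

theorem sum_law_prod_left (P : Ω → ℝ) (A : Ω → α) (C : Ω → γ) (c : γ) :
    ∑ a, law P (fun ω => (A ω, C ω)) (a, c) = law P C c := by
  rw [← law_prod_snd, law_law]

/-- Gibbs' inequality against `P(a,c) P(b,c) / P(c)`, the law under which `A` and `B` are
conditionally independent. -/
theorem condMutInfo_nonneg {P : Ω → ℝ} (hP : ∀ ω, 0 ≤ P ω) (A : Ω → α) (B : Ω → β) (C : Ω → γ) :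
    0 ≤ condMutInfo P A B C := by
  have hC : ∀ c, law P C c * law P C c / law P C c = law P C c := fun c => by
    rw [mul_self_div_self]
  have := gibbs (p := law P fun ω => (A ω, B ω, C ω))
    (q := fun x => law P (fun ω => (A ω, C ω)) (x.1, x.2.2) *
      law P (fun ω => (B ω, C ω)) x.2 / law P C x.2.2)
    (law_nonneg hP _) (fun x => div_nonneg (mul_nonneg (law_nonneg hP _ _) (law_nonneg hP _ _))
      (law_nonneg hP _ _))
    (by
      rw [sum_law, ← sum_law P C, Fintype.sum_prod_type, Finset.sum_comm, Fintype.sum_prod_type,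
        Finset.sum_comm]
      refine (Finset.sum_congr rfl fun c _ => ?_).le
      simp only [← Finset.sum_div, ← Finset.sum_mul, ← Finset.mul_sum, sum_law_prod_left]
      exact hC c)
    (fun x hx => div_pos (mul_pos (hx.trans_le (law_comp_le hP _ (fun x => (x.1, x.2.2)) x))
      (hx.trans_le (law_comp_le hP _ Prod.snd x)))
      (hx.trans_le (law_comp_le hP _ (fun x => x.2.2) x)))
  rw [sum_law_mul P (fun ω => (A ω, B ω, C ω)) fun x =>
    Real.logb 2 (law P (fun ω => (A ω, C ω)) (x.1, x.2.2) * law P (fun ω => (B ω, C ω)) x.2 /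
      law P C x.2.2) - Real.logb 2 (law P (fun ω => (A ω, B ω, C ω)) x)] at this
  have e : ent P (fun ω => (A ω, B ω, C ω)) + ent P C - ent P (fun ω => (A ω, C ω)) -
      ent P (fun ω => (B ω, C ω)) =
      ∑ ω, P ω * (Real.logb 2 (law P (fun ω => (A ω, C ω)) (A ω, C ω) *
        law P (fun ω => (B ω, C ω)) (B ω, C ω) / law P C (C ω)) -
        Real.logb 2 (law P (fun ω => (A ω, B ω, C ω)) (A ω, B ω, C ω))) := by
    simp only [ent_eq_sum, ← Finset.sum_sub_distrib, ← Finset.sum_add_distrib]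
    refine Finset.sum_congr rfl fun ω _ => ?_
    rcases (hP ω).eq_or_lt with h0 | h0
    · simp [← h0]
    · have h1 := law_pos hP (fun ω => (A ω, C ω)) h0
      have h2 := law_pos hP (fun ω => (B ω, C ω)) h0
      have h3 := law_pos hP C h0
      rw [Real.logb_div (mul_pos h1 h2).ne' h3.ne', Real.logb_mul h1.ne' h2.ne']
      simp only [surp]
      ring
  simp only at this
  rw [← e] at this
  unfold condMutInfo condEnt
  linarith

theorem mutInfo_nonneg {P : Ω → ℝ} (hP : ∀ ω, 0 ≤ P ω) (h1 : ∑ ω, P ω = 1) (A : Ω → α)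
    (B : Ω → β) : 0 ≤ ent P A + ent P B - ent P (fun ω => (A ω, B ω)) := by
  have := condEnt_le_ent hP h1 A B
  unfold condEnt at this
  linarith

theorem exists_sum_not_typical_le {p : α → ℝ} (hp : ∀ a, 0 ≤ p a) (h1 : ∑ a, p a = 1) {ε : ℝ}
    (hε : 0 < ε) : ∃ c : ℝ, 0 ≤ c ∧ ∀ n : ℕ, 0 < n →
      ∑ u : Fin n → α, seqProb p u * ind (¬ Typical ε p u) ≤ c / n := by
  obtain ⟨c, hc, h⟩ := exists_sum_not_empTypical_le hp h1 (fun _ : Unit => surp p id) (half_pos hε)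
  refine ⟨c, hc, fun n hn => le_trans (Finset.sum_le_sum fun u _ => ?_) (h n)⟩
  refine mul_le_mul_of_nonneg_left (ind_mono fun hno ht => hno ?_)
    (Finset.prod_nonneg fun _ _ => hp _)
  have hid : law p id = p := by
    funext a
    rw [law_eq_sum]
    exact sum_mul_ind_eq _ _
  have := EmpTypical.abs_logb_le hp ht id () rfl
  rw [ent, hid] at this
  refine nearEntropy_of_abs_logb_lt hn (seqProb_pos ht.1) (lt_of_le_of_lt this ?_)
  have : (0 : ℝ) < n := by exact_mod_cast hn
  nlinarith

/-- Supplies the fixed information sequence `w₀`. -/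
theorem exists_typical {p : α → ℝ} (hp : ∀ a, 0 ≤ p a) (h1 : ∑ a, p a = 1) {ε : ℝ}
    (hε : 0 < ε) : ∀ᶠ n : ℕ in Filter.atTop, ∃ u : Fin n → α, Typical ε p u := by
  obtain ⟨c, hc, h⟩ := exists_sum_not_typical_le hp h1 hε
  have ht : Filter.Tendsto (fun n : ℕ => c / (n : ℝ)) Filter.atTop (nhds 0) :=
    tendsto_const_div_atTop_nhds_zero_nat c
  filter_upwards [ht.eventually (gt_mem_nhds one_pos), Filter.eventually_gt_atTop 0] with n h2 hn
  by_contra! hno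
  have h3 := h n hn
  simp only [ind_true (hno _), mul_one, sum_seqProb p h1 n] at h3
  linarith

end Nonneg

namespace Selection

variable {X₁ Y₁ Z₁ X₂ Y₂ Z₂ : Type*} [Fintype X₁] [Fintype Y₁] [Fintype Z₁]
  [Fintype X₂] [Fintype Y₂] [Fintype Z₂] (s : Selection X₁ Y₁ X₂) (C₁ : DMBC X₁ Y₁ Z₁)
  (C₂ : DMBC X₂ Y₂ Z₂)

theorem infoVY_nonneg : 0 ≤ s.infoVY C₁ := mutInfo_nonneg (s.law₁_nonneg C₁) (s.sum_law₁ C₁) _ _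

theorem infoVZ_nonneg : 0 ≤ s.infoVZ C₁ := mutInfo_nonneg (s.law₁_nonneg C₁) (s.sum_law₁ C₁) _ _

/-- Data processing along `V ↔ Y₁ ↔ X₁`. -/
theorem infoVX_le_infoVY : s.infoVX C₁ ≤ s.infoVY C₁ := by
  have := condMutInfo_nonneg (s.law₁_nonneg C₁) (fun (v, _, _, _) => v)
    (fun (_, _, y, _) => y) (fun (_, x, _, _) => x)
  rw [condMutInfo_VYX] at this
  linarith

variable {β : Type*} [Fintype β] (F : Y₂ × Z₂ → β)

theorem infoU_nonneg : 0 ≤ s.infoU C₂ F := mutInfo_nonneg (s.lawR_nonneg C₂) (s.sum_lawR C₂) _ _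

theorem law₂_nonneg (ω) : 0 ≤ s.law₂ C₂ ω :=
  mul_nonneg (mul_nonneg (stdSimplex_nonneg _ _) (stdSimplex_nonneg _ _)) (stdSimplex_nonneg _ _)

theorem infoU_le_infoW : s.infoU C₂ F ≤ s.infoW C₂ F := by
  have := condMutInfo_nonneg (s.law₂_nonneg C₂) (fun ω => ω.2.1) (fun ω => F ω.2.2.2)
    (fun ω => ω.1)
  rw [condMutInfo_WFU] at this
  linarith

end Selection
end SKE

namespace SKE

/-! ### Long instances -/

theorem tendsto_two_rpow_neg_mul {t : ℝ} (ht : 0 < t) :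
    Filter.Tendsto (fun k : ℕ => (2 : ℝ) ^ (-(k * t))) Filter.atTop (nhds 0) := by
  have h : ∀ k : ℕ, (2 : ℝ) ^ (-((k : ℝ) * t)) = ((2 : ℝ) ^ (-t)) ^ k := fun k => by
    rw [← Real.rpow_natCast, ← Real.rpow_mul zero_le_two]
    congr 1
    ring
  simp only [h]
  exact tendsto_pow_atTop_nhds_zero_of_lt_one (by positivity)
    (Real.rpow_lt_one_of_one_lt_of_neg one_lt_two (neg_lt_zero.mpr ht))

namespace Selection

variable {X₁ Y₁ Z₁ X₂ Y₂ Z₂ : Type*} [Fintype X₁] [Fintype Y₁] [Fintype Z₁]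
  [Fintype X₂] [Fintype Y₂] [Fintype Z₂] (s : Selection X₁ Y₁ X₂) (C₁ : DMBC X₁ Y₁ Z₁)
  (C₂ : DMBC X₂ Y₂ Z₂)

set_option maxHeartbeats 1000000 in
/-- Long instances of the protocol with given information rates. -/
theorem eventually_exists_icc {ε β c₀ c₁ ρ χ : ℝ} {a₁ a₂ : ℕ} (ha₁ : 0 < a₁) (ha₂ : 0 < a₂)
    (hε : 0 < ε) (hβ : 0 < β) (hβ1 : 6 * β ≤ 1)
    (hc₀ : 1 ≤ c₀) (hY : ∀ y, 0 < s.lawY₂ C₂ y → 1 ≤ c₀ * s.lawY₂ C₂ y)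
    (hcW : ∀ w, |Real.logb 2 (s.lawW C₂ w) + ent (s.lawR C₂) (fun ω => ω.2.1)| ≤ c₁)
    (hcY : ∀ y, |Real.logb 2 (s.lawY₂ C₂ y) + ent (s.lawR C₂) (fun ω => ω.2.2.1)| ≤ c₁)
    (hcWY : ∀ a, |Real.logb 2 (s.lawWY C₂ a) +
      ent (s.lawR C₂) (fun ω => (ω.2.1, ω.2.2.1))| ≤ c₁)
    (hc₁ : c₁ < (a₁ + 1 + a₂) * ε)
    (hρ0 : 0 < ρ) (hχ0 : 0 < χ)
    (hρ : ρ + a₁ * (s.infoVY C₁ + 8 * ε) + Real.logb 2 c₀ + 2 * ε ≤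
      a₁ * s.infoVX C₁ + (1 + a₂) * s.infoW C₂ Prod.fst - 6 * ε * (a₁ + 1 + a₂))
    (hχ : χ + ε + a₂ * (s.infoU C₂ Prod.fst + 3 * ε) +
      a₂ * (s.infoW C₂ Prod.snd - s.infoU C₂ Prod.snd + 4 * ε) ≤
      a₁ * (s.infoVY C₁ - s.infoVZ C₁ - 6 * ε) + ρ) :
    ∀ᶠ k : ℕ in Filter.atTop, ∃ Γ : ICC C₁ C₂, Γ.ε = 2 * ε ∧ Γ.n₁ = k * a₁ ∧
      Γ.n₂ = k + k * a₂ ∧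
      prob Γ.runLaw (fun ω => Γ.PickFails ω ∨ Γ.keyEstimate ω ≠ some (Γ.key ω)) ≤ β ∧
      (1 - 6 * β) * (k * χ - 1 + Real.logb 2 (β ^ 2 / 2)) ≤ condEnt Γ.runLaw Γ.key Γ.viewE ∧
      condEnt Γ.runLaw Γ.key Γ.viewE ≤ ent Γ.runLaw Γ.key ∧
      ent Γ.runLaw Γ.key ≤ k * χ := by
  obtain ⟨c, hc, h₁⟩ := s.exists_sum_not_typ₁_le C₁ hε
  obtain ⟨c', hc', h₂⟩ := s.exists_sum_not_typ₂_le C₂ hε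
  have hw := exists_typical (law_nonneg (s.lawR_nonneg C₂) fun ω => ω.2.1)
    (by rw [sum_law, s.sum_lawR]) (show 0 < 2 * ε by linarith)
  have hd : Filter.Tendsto (fun k : ℕ => (c + c') / (k : ℝ)) Filter.atTop (nhds 0) :=
    tendsto_const_div_atTop_nhds_zero_nat _
  have hT := tendsto_two_rpow_neg_mul (show 0 < 2 * ε by linarith)
  have hT' := tendsto_two_rpow_neg_mul hχ0
  have herr : Filter.Tendsto (fun k : ℕ => (c + c') / (k : ℝ) / (β / 2) +
      5 * (2 : ℝ) ^ (-(k * (2 * ε))) + (c + c') / (k : ℝ)) Filter.atTop (nhds 0) := by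
    have := ((hd.div_const (β / 2)).add (hT.const_mul 5)).add hd
    simpa using this
  have hkε : ∀ᶠ k : ℕ in Filter.atTop, 2 ≤ k * ε := by
    have := tendsto_natCast_atTop_atTop (R := ℝ).atTop_mul_const hε
    exact this.eventually_ge_atTop 2
  filter_upwards [hw, hd.eventually (gt_mem_nhds one_pos),
    herr.eventually (gt_mem_nhds (half_pos hβ)), hkε, Filter.eventually_gt_atTop 0,
    hT'.eventually (gt_mem_nhds (show 0 < β ^ 2 / 4 by positivity))]
    with k ⟨w₀, hw₀⟩ hk1 hkerr hkε hk hkχ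
  have hk' : (0 : ℝ) < k := by exact_mod_cast hk
  have ha₁' : (1 : ℝ) ≤ a₁ := by exact_mod_cast ha₁
  have ha₂' : (1 : ℝ) ≤ a₂ := by exact_mod_cast ha₂
  have iVY := s.infoVY_nonneg C₁
  have iVZ := s.infoVZ_nonneg C₁
  have iUY := s.infoU_nonneg C₂ Prod.fst
  have iUW := s.infoU_le_infoW C₂ Prod.snd
  -- The binary logarithms of the code sizes: `α` for the covering codewords, `ν` for the clouds,
  -- `b` for the fresh message, `κ` for the key. In `8 * ε`, six come from joint typicality at level
  -- `2 * ε`, and two make the covering error decay.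
  obtain ⟨α, fα1, fα2⟩ : ∃ α : ℕ, k * (a₁ * (s.infoVY C₁ + 8 * ε)) ≤ α ∧
      (α : ℝ) < k * (a₁ * (s.infoVY C₁ + 8 * ε)) + 1 :=
    ⟨_, Nat.le_ceil _, Nat.ceil_lt_add_one (by positivity)⟩
  obtain ⟨ν, fν1, fν2⟩ : ∃ ν : ℕ, k * (a₂ * (s.infoU C₂ Prod.fst + 3 * ε)) ≤ ν ∧
      (ν : ℝ) < k * (a₂ * (s.infoU C₂ Prod.fst + 3 * ε)) + 1 :=
    ⟨_, Nat.le_ceil _, Nat.ceil_lt_add_one (by positivity)⟩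
  obtain ⟨b, fb1, fb2⟩ : ∃ b : ℕ, (b : ℝ) ≤ k * ρ ∧ k * ρ < b + 1 :=
    ⟨_, Nat.floor_le (by positivity), Nat.lt_floor_add_one _⟩
  obtain ⟨κ, fκ1, fκ2⟩ : ∃ κ : ℕ, (κ : ℝ) ≤ k * χ ∧ k * χ < κ + 1 :=
    ⟨_, Nat.floor_le (by positivity), Nat.lt_floor_add_one _⟩
  have hρk := mul_le_mul_of_nonneg_left hρ hk'.le
  have hχk := mul_le_mul_of_nonneg_left hχ hk'.le
  have hn : 0 < k * a₁ := Nat.mul_pos hk ha₁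
  have castn : ((k * a₁ : ℕ) : ℝ) = k * a₁ := by push_cast; ring
  have castm : ((k * a₂ : ℕ) : ℝ) = k * a₂ := by push_cast; ring
  have castlm : ((k + k * a₂ : ℕ) : ℝ) = k + k * a₂ := by push_cast; ring
  have castt : ((k * a₁ + (k + k * a₂) : ℕ) : ℝ) = k * (a₁ + 1 + a₂) := by push_cast; ring
  have cast2 : ∀ j : ℕ, ((2 ^ j : ℕ) : ℝ) = (2 : ℝ) ^ (j : ℝ) := fun j => by
    rw [Real.rpow_natCast]; push_cast; rfl
  have two : (0 : ℝ) < 2 := two_pos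
  have hle : ∀ {a : ℕ}, (1 : ℝ) ≤ a → ∀ {e : ℝ}, 0 ≤ e → e ≤ c + c' →
      e / ((k : ℝ) * a) ≤ (c + c') / k := by
    intro a ha e he0 he
    exact div_le_div₀ (by linarith) he hk' (le_mul_of_one_le_right hk'.le ha)
  -- All sizes are powers of two, so this inequality suffices for the message set to split into
  -- parts of equal size.
  have hκαb : κ ≤ α + b := by
    have : (κ : ℝ) < (α + b : ℕ) + 1 := by
      push_cast
      have h1 : 0 ≤ (k : ℝ) * (a₁ * s.infoVZ C₁) := by positivity
      have h2 : 0 ≤ (k : ℝ) * (a₂ * (s.infoW C₂ Prod.snd - s.infoU C₂ Prod.snd + 4 * ε)) :=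
        mul_nonneg hk'.le (mul_nonneg (by positivity) (by linarith))
      have h3 : 0 ≤ (k : ℝ) * (a₂ * (s.infoU C₂ Prod.fst + 3 * ε)) := by positivity
      have h4 : 0 ≤ (k : ℝ) * (a₁ * ε) := by positivity
      linarith
    exact Nat.lt_succ_iff.mp (by exact_mod_cast this)
  obtain ⟨D, hDw₀, hDv, hDpk, hDerr⟩ := exists_seqCode s C₁ C₂ (ε := ε) (ε' := 2 * ε)
    (c := c + c') (η' := β / 2) (n := k * a₁) (l := k) (m := k * a₂) (A := 2 ^ α) (B := 2 ^ b)
    (N := 2 ^ ν) (by linarith) hn (by positivity) (by positivity) (by positivity) w₀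
    (by
      rw [castn]
      exact (hle ha₁' (by linarith) le_rfl).trans_lt hk1)
    ((h₁ _).trans (by gcongr; linarith)) ((h₂ _ _ w₀).trans (by gcongr; linarith)) hc₀ hY
    (by positivity) (by linarith)
  have hadm : D.Admissible C₁ C₂ (2 * ε) := ⟨by linarith, hn, by positivity, hDv, hDw₀ ▸ hw₀, hDpk⟩
  have hbad : D.expect C₁ C₂
      (fun x y₁ z₁ j y z => ind (¬ D.Good C₁ C₂ ε (2 * ε) x y₁ z₁ j y z)) ≤ β := by
    refine hDerr.trans ?_
    rw [castn, castm, castlm, castt, cast2, cast2, cast2]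
    have e1 : (c + c') / ((k : ℝ) * a₁) / (β / 2) ≤ (c + c') / k / (β / 2) :=
      div_le_div_of_nonneg_right (hle ha₁' (by linarith) le_rfl) (by positivity)
    have e2 : (2 : ℝ) ^ ((k : ℝ) * a₁ * (s.infoVY C₁ + 3 * (2 * ε))) / 2 ^ (α : ℝ) ≤
        (2 : ℝ) ^ (-(k * (2 * ε))) := by
      rw [← Real.rpow_sub two]
      refine Real.rpow_le_rpow_of_exponent_le one_le_two ?_
      linarith [mul_le_mul_of_nonneg_left ha₁' (show 0 ≤ (k : ℝ) * (2 * ε) by positivity)]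
    have e3 : (c + c') / ((k : ℝ) * a₂) ≤ (c + c') / k := hle ha₂' (by linarith) le_rfl
    -- There are enough clouds for the shared-cloud penalty to be at most a factor 2.
    have e4 : 1 + (2 : ℝ) ^ ((k : ℝ) * a₂ * (s.infoU C₂ Prod.fst + 3 * ε)) / 2 ^ (ν : ℝ) ≤ 2 := by
      rw [← Real.rpow_sub two]
      have := Real.rpow_le_one_of_one_le_of_nonpos (one_le_two (α := ℝ))
        (show (k : ℝ) * a₂ * (s.infoU C₂ Prod.fst + 3 * ε) - ν ≤ 0 by linarith)
      linarith
    -- The decoding condition. The factor 2 is the rounding of `α`; the decay comes from the `2 * ε`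
    -- reserved in `hρ`.
    have e5 : (2 : ℝ) ^ (α : ℝ) * 2 ^ (b : ℝ) / ((2 : ℝ) ^ ((k : ℝ) * a₁ * s.infoVX C₁ +
        (k + k * a₂) * s.infoW C₂ Prod.fst - 3 * ((k : ℝ) * (a₁ + 1 + a₂) * (2 * ε))) / c₀ ^ k) ≤
        2 * (2 : ℝ) ^ (-(k * (2 * ε))) := by
      have hc : c₀ ^ k = (2 : ℝ) ^ (k * Real.logb 2 c₀) := by
        rw [mul_comm, Real.rpow_mul zero_le_two, Real.rpow_logb two (by norm_num) (by linarith),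
          Real.rpow_natCast]
      rw [hc, ← Real.rpow_sub two, ← Real.rpow_add two, ← Real.rpow_sub two]
      calc _ ≤ (2 : ℝ) ^ (1 + -(k * (2 * ε))) := by
            refine Real.rpow_le_rpow_of_exponent_le one_le_two ?_
            linarith
        _ = _ := by rw [Real.rpow_add two, Real.rpow_one]
    have e6 := mul_le_mul e4 e5 (by positivity) (by norm_num)
    linarith
  have hKM : 2 ^ α * 2 ^ b = 2 ^ κ * 2 ^ (α + b - κ) := by
    rw [← pow_add, ← pow_add]
    congr 1
    omega
  -- The secrecy condition. The term `ε` in `hχ` pays for the rounding of `ν` and `b`, since `2 ≤ k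
  -- * ε`.
  have hcoef : (2 : ℝ) ^ (((k * a₁ : ℕ) : ℝ) * (s.infoVZ C₁ + 3 * ε)) /
      2 ^ (((k * a₁ : ℕ) : ℝ) * (s.infoVY C₁ - 3 * ε)) * (1 / ((2 ^ b : ℕ) : ℝ)) *
      (2 ^ (((k * a₂ : ℕ) : ℝ) * (s.infoW C₂ Prod.snd - s.infoU C₂ Prod.snd + 4 * ε)) *
        ((2 ^ ν : ℕ) : ℝ)) ≤ 1 / ((2 ^ κ : ℕ) : ℝ) := by
    rw [castn, castm, cast2, cast2, cast2, ← Real.rpow_sub two, one_div, one_div,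
      ← Real.rpow_neg zero_le_two, ← Real.rpow_neg zero_le_two, ← Real.rpow_add two,
      ← Real.rpow_add two, ← Real.rpow_add two]
    refine Real.rpow_le_rpow_of_exponent_le one_le_two ?_
    linarith
  have hKpos : (0 : ℝ) < ((2 ^ κ : ℕ) : ℝ) := by positivity
  have hKlog : Real.logb 2 ((2 ^ κ : ℕ) : ℝ) = κ := by
    rw [cast2, Real.logb_rpow two (by norm_num)]
  -- `κ` is a floor, so the key size is at least `2^(k χ) / 2`, while `2^(k χ)` exceeds `4 / β²` for
  -- large `k`.
  have hL : (1 : ℝ) ≤ ((2 ^ κ : ℕ) : ℝ) * β ^ 2 / 2 := by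
    have h1 : (2 : ℝ) ^ ((k : ℝ) * χ) ≤ 2 * ((2 ^ κ : ℕ) : ℝ) := by
      rw [cast2]
      calc _ ≤ (2 : ℝ) ^ (1 + (κ : ℝ)) :=
            Real.rpow_le_rpow_of_exponent_le one_le_two (by linarith)
        _ = _ := by rw [Real.rpow_add two, Real.rpow_one]
    have h2 : (2 : ℝ) ^ (-((k : ℝ) * χ)) * 2 ^ ((k : ℝ) * χ) = 1 := by
      rw [← Real.rpow_add two]
      simp
    have h3 : (0 : ℝ) < 2 ^ ((k : ℝ) * χ) := by positivity
    nlinarith [mul_lt_mul_of_pos_right hkχ h3, mul_le_mul_of_nonneg_left h1 (sq_nonneg β)]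
  obtain ⟨Γ, g1, g2, g3, g4, g5, g6, g7⟩ := SeqCode.exists_icc hadm (t₁ := 2 ^ α) (t₂ := 2 ^ b)
    (by positivity) (by positivity) (Nat.le_self_pow hn.ne' _) (Nat.le_self_pow hk.ne' _) hKM
    (show ε < 2 * ε by linarith)
    (fun x y₁ z₁ j y z hg => s.bipJointlyTypical_of_typ C₁ C₂ hcW hcY hcWY hn (by
        rw [castt, castn, castm]
        nlinarith [mul_lt_mul_of_pos_left hc₁ hk', mul_pos hk' hε])
      (fun i => hDw₀ ▸ pos_of_seqProb_pos (law_nonneg (s.lawR_nonneg C₂) _) hw₀.1 i) hg.1 hg.2.1)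
    hβ hbad hcoef hL
  refine ⟨Γ, g1, g2, g3, g4, le_trans ?_ g5, g6, g7.trans (by rw [hKlog]; exact fκ1)⟩
  refine mul_le_mul_of_nonneg_left ?_ (by linarith)
  rw [mul_div_assoc, Real.logb_mul hKpos.ne' (by positivity), hKlog]
  linarith

end Selection
end SKE

namespace SKE

/-! ### Achievability of the objective -/
namespace Selection

variable {X₁ Y₁ Z₁ X₂ Y₂ Z₂ : Type*} [Fintype X₁] [Fintype Y₁] [Fintype Z₁]
  [Fintype X₂] [Fintype Y₂] [Fintype Z₂] (s : Selection X₁ Y₁ X₂) (C₁ : DMBC X₁ Y₁ Z₁)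
  (C₂ : DMBC X₂ Y₂ Z₂)

theorem feasible_iff {n₁ n₂ : ℕ} : s.Feasible C₁ C₂ n₁ n₂ ↔
    n₁ * (s.infoVY C₁ - s.infoVX C₁) < n₂ * s.infoW C₂ Prod.fst := by
  unfold Feasible
  rw [condMutInfo_VYX, mutInfo_WY]

variable {C₁ C₂ s}

theorem Feasible.pos {n₁ n₂ : ℕ} (h : s.Feasible C₁ C₂ n₁ n₂) : 0 < n₂ := by
  rw [feasible_iff] at h
  rcases Nat.eq_zero_or_pos n₂ with rfl | h0
  · have := mul_nonneg (Nat.cast_nonneg (α := ℝ) n₁) (sub_nonneg.mpr (s.infoVX_le_infoVY C₁))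
    simp at h
    linarith
  · exact h0

/-- The protocol runs with both channels in use approach those in which only one is used. -/
theorem Feasible.exists_pos {n₁ n₂ : ℕ} (h : s.Feasible C₁ C₂ n₁ n₂) {r : ℝ}
    (hr : r < s.valueICC C₁ C₂ n₁ n₂) :
    ∃ m₁ m₂ : ℕ, 0 < m₁ ∧ s.Feasible C₁ C₂ m₁ m₂ ∧ r < s.valueICC C₁ C₂ m₁ m₂ := by
  rcases Nat.eq_zero_or_pos n₁ with rfl | h0
  swap
  · exact ⟨n₁, n₂, h0, h, hr⟩
  have hn₂ : (0 : ℝ) < n₂ := by exact_mod_cast h.pos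
  rw [feasible_iff] at h
  simp only [Nat.cast_zero, zero_mul] at h
  have hr' : r < s.Rs₂ C₂ := by
    unfold valueICC at hr
    rwa [Nat.cast_zero, zero_mul, zero_add, zero_add, mul_div_cancel_left₀ _ hn₂.ne'] at hr
  have t1 : Filter.Tendsto (fun N : ℕ => (N : ℝ) * (n₂ * s.infoW C₂ Prod.fst)) Filter.atTop
      Filter.atTop := tendsto_natCast_atTop_atTop.atTop_mul_const h
  have t2 : Filter.Tendsto (fun N : ℕ => (N : ℝ) * (n₂ * (s.Rs₂ C₂ - r))) Filter.atTop
      Filter.atTop := tendsto_natCast_atTop_atTop.atTop_mul_const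
        (mul_pos hn₂ (sub_pos.mpr hr'))
  -- One use of the first channel next to `N * n₂` uses of the second changes the average
  -- arbitrarily little.
  obtain ⟨N, h1, h2⟩ := ((t1.eventually_gt_atTop (s.infoVY C₁ - s.infoVX C₁)).and
    (t2.eventually_gt_atTop (r - s.Rs₁ C₁))).exists
  refine ⟨1, N * n₂, one_pos, ?_, ?_⟩
  · rw [feasible_iff]
    push_cast
    linarith
  · unfold valueICC
    push_cast
    rw [lt_div_iff₀ (by positivity)]
    linarith

/-- Choice of parameters: first the slack `ε`, then a multiple `N` of the block `(n₁, n₂)` so large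
that the information symbols are negligible, then `β`, and finally the number `k` of repetitions. -/
theorem exists_secure_of_pos {n₁ n₂ : ℕ} (h : s.Feasible C₁ C₂ n₁ n₂) (hn₁ : 0 < n₁) {R δ : ℝ}
    (hδ : 0 < δ) (hR : R - δ < s.valueICC C₁ C₂ n₁ n₂) (h0 : 0 < s.valueICC C₁ C₂ n₁ n₂) :
    ∃ Γ : ICC C₁ C₂, Γ.ε < δ ∧ Γ.Secure R δ := by
  set v := s.valueICC C₁ C₂ n₁ n₂ with hv
  have hn₂ := h.pos
  rw [feasible_iff] at h
  have hn₁' : (1 : ℝ) ≤ n₁ := by exact_mod_cast hn₁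
  have hn₂' : (1 : ℝ) ≤ n₂ := by exact_mod_cast hn₂
  obtain ⟨S, hS⟩ : ∃ S : ℝ, S = n₁ + n₂ := ⟨_, rfl⟩
  have hS0 : 0 < S := by linarith
  have hvS : n₁ * s.Rs₁ C₁ + n₂ * s.Rs₂ C₂ = v * S := by
    rw [hv, valueICC, ← hS, div_mul_cancel₀ _ hS0.ne']
  rw [Rs₁_eq, Rs₂_eq] at hvS
  obtain ⟨φ, hφ⟩ : ∃ φ : ℝ, φ = n₂ * s.infoW C₂ Prod.fst -
    n₁ * (s.infoVY C₁ - s.infoVX C₁) := ⟨_, rfl⟩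
  have hφ0 : 0 < φ := by linarith
  obtain ⟨r, hr0, hrR, hrv⟩ : ∃ r : ℝ, 0 ≤ r ∧ R - δ ≤ r ∧ r < v :=
    ⟨max 0 (R - δ), le_max_left _ _, le_max_right _ _, max_lt h0 hR⟩
  obtain ⟨r', hrr', hr'v⟩ := exists_between hrv
  obtain ⟨c₀, hc₀, hY⟩ := exists_forall_one_le_mul (p := s.lawY₂ C₂)
  obtain ⟨cW, hcW0, hcW⟩ := exists_forall_abs_le
    fun w => Real.logb 2 (s.lawW C₂ w) + ent (s.lawR C₂) (fun ω => ω.2.1)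
  obtain ⟨cY, hcY0, hcY⟩ := exists_forall_abs_le
    fun y => Real.logb 2 (s.lawY₂ C₂ y) + ent (s.lawR C₂) (fun ω => ω.2.2.1)
  obtain ⟨cWY, hcWY0, hcWY⟩ := exists_forall_abs_le
    fun a => Real.logb 2 (s.lawWY C₂ a) + ent (s.lawR C₂) (fun ω => (ω.2.1, ω.2.2.1))
  -- The `ε`-terms in `ρ` add up to at most `16 * ε * N * S` and those in `χ` to at most `30 * ε * N
  -- * S`. Both are kept below half of the margins `φ` and `v - r'`, the other half being reserved
  -- for `log c₀`.
  obtain ⟨ε, hε0, hεδ, hεφ, hεv⟩ : ∃ ε : ℝ, 0 < ε ∧ 2 * ε < δ ∧ 32 * ε * S ≤ φ ∧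
      60 * ε ≤ v - r' := by
    refine ⟨min (δ / 4) (min (φ / (32 * S)) ((v - r') / 60)), ?_, ?_, ?_, ?_⟩
    · have : 0 < v - r' := by linarith
      positivity
    · linarith [min_le_left (δ / 4) (min (φ / (32 * S)) ((v - r') / 60))]
    · have : min (δ / 4) (min (φ / (32 * S)) ((v - r') / 60)) ≤ φ / (32 * S) :=
        (min_le_right _ _).trans (min_le_left _ _)
      rw [le_div_iff₀ (by positivity)] at this
      linarith
    · have : min (δ / 4) (min (φ / (32 * S)) ((v - r') / 60)) ≤ (v - r') / 60 :=
        (min_le_right _ _).trans (min_le_right _ _)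
      linarith
  have hmul : ∀ {t : ℝ}, 0 < t → Filter.Tendsto (fun k : ℕ => (k : ℝ) * t) Filter.atTop
      Filter.atTop := fun ht => tendsto_natCast_atTop_atTop.atTop_mul_const ht
  obtain ⟨N, hN1, hN2, hN3, hN4⟩ := (((hmul (half_pos hφ0)).eventually_gt_atTop
    (Real.logb 2 c₀)).and (((hmul (show 0 < S * ε by positivity)).eventually_gt_atTop
    (cW + cY + cWY)).and (((hmul (show 0 < (v - r') / 2 * S by
      have : 0 < v - r' := by linarith
      positivity)).eventually_gt_atTop (Real.logb 2 c₀)).and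
    (Filter.eventually_ge_atTop 2)))).exists
  have hN4' : (2 : ℝ) ≤ N := by exact_mod_cast hN4
  obtain ⟨a₁, ha₁⟩ : ∃ a₁ : ℕ, a₁ = N * n₁ := ⟨_, rfl⟩
  -- Of every `N * n₂` symbols of the responder one is an information symbol and `a₂` are parity
  -- symbols; `N ≥ 2` keeps `a₂` positive.
  obtain ⟨a₂, ha₂⟩ : ∃ a₂ : ℕ, a₂ + 1 = N * n₂ := ⟨N * n₂ - 1, by
    have := Nat.mul_pos (show 0 < N by omega) hn₂
    omega⟩
  have ra₁ : (a₁ : ℝ) = N * n₁ := by rw [ha₁]; push_cast; ring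
  have ra₂ : (a₂ : ℝ) = N * n₂ - 1 := by
    rw [eq_sub_iff_add_eq]
    exact_mod_cast ha₂
  have hL : (a₁ : ℝ) + 1 + a₂ = N * S := by rw [ra₁, ra₂, hS]; ring
  have ha₂0 : 0 < a₂ := by
    have := Nat.mul_le_mul hN4 hn₂
    omega
  have ha₁0 : 0 < a₁ := by
    rw [ha₁]
    exact Nat.mul_pos (by omega) hn₁
  have hNS : 1 ≤ N * S := by nlinarith
  have a₁S : (a₁ : ℝ) ≤ N * S := by rw [← hL]; linarith [Nat.cast_nonneg (α := ℝ) a₂]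
  have a₂S : (a₂ : ℝ) ≤ N * S := by rw [← hL]; linarith [Nat.cast_nonneg (α := ℝ) a₁]
  have e1 := mul_le_mul_of_nonneg_right a₁S hε0.le
  have e2 := mul_le_mul_of_nonneg_right a₂S hε0.le
  have e3 := mul_le_mul_of_nonneg_right hNS hε0.le
  have iUY := s.infoU_nonneg C₂ Prod.fst
  have iUW := s.infoU_le_infoW C₂ Prod.snd
  obtain ⟨ρ, hρ⟩ : ∃ ρ : ℝ, ρ = a₁ * s.infoVX C₁ + (1 + a₂) * s.infoW C₂ Prod.fst -
    6 * ε * (a₁ + 1 + a₂) - a₁ * (s.infoVY C₁ + 8 * ε) - Real.logb 2 c₀ - 2 * ε := ⟨_, rfl⟩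
  obtain ⟨χ, hχ⟩ : ∃ χ : ℝ, χ = a₁ * (s.infoVY C₁ - s.infoVZ C₁ - 6 * ε) + ρ - ε -
    a₂ * (s.infoU C₂ Prod.fst + 3 * ε) -
    a₂ * (s.infoW C₂ Prod.snd - s.infoU C₂ Prod.snd + 4 * ε) := ⟨_, rfl⟩
  -- `ρ` is `N` times the feasibility margin `φ`, up to the losses: this is where feasibility is
  -- used.
  have hρ0 : 0 < ρ := by
    have h1 : ρ = N * φ - 6 * ε * (N * S) - 8 * (a₁ * ε) - Real.logb 2 c₀ - 2 * ε := by
      rw [hρ, hφ, ← hL, ra₁, ra₂]; ring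
    have h2 := mul_le_mul_of_nonneg_left hεφ (Nat.cast_nonneg (α := ℝ) N)
    linarith
  have hχL : r' * (N * S) ≤ χ := by
    -- The nonnegative extra term arises because the information symbols count for decoding but
    -- cause no leakage.
    have h1 : χ = N * (v * S) + (s.infoU C₂ Prod.fst + s.infoW C₂ Prod.snd - s.infoU C₂ Prod.snd) -
        14 * (a₁ * ε) - 6 * ε * (N * S) - 7 * (a₂ * ε) - 3 * ε - Real.logb 2 c₀ := by
      rw [hχ, hρ, ← hvS, ← hL, ra₁, ra₂]; ring
    have h2 := mul_le_mul_of_nonneg_left hεv (show 0 ≤ N * S by linarith)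
    linarith
  have hχ0 : 0 < χ := lt_of_lt_of_le (mul_pos (by linarith) (by linarith)) hχL
  -- The factor `1 - 6 * β` from privacy amplification must leave the rate above `r` and the secrecy
  -- ratio above `1 - δ`.
  obtain ⟨β, hβ0, hβ1, hβδ, hβr⟩ : ∃ β : ℝ, 0 < β ∧ 6 * β ≤ 1 ∧ 6 * β < δ ∧
      6 * β * r' < r' - r := by
    have hr'0 : 0 < r' := by linarith
    refine ⟨min (1 / 6) (min (δ / 12) ((r' - r) / (12 * r'))), ?_, ?_, ?_, ?_⟩
    · have : 0 < r' - r := by linarith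
      positivity
    · linarith [min_le_left (1 / 6) (min (δ / 12) ((r' - r) / (12 * r')))]
    · have : min (1 / 6) (min (δ / 12) ((r' - r) / (12 * r'))) ≤ δ / 12 :=
        (min_le_right _ _).trans (min_le_left _ _)
      linarith
    · have : min (1 / 6) (min (δ / 12) ((r' - r) / (12 * r'))) ≤ (r' - r) / (12 * r') :=
        (min_le_right _ _).trans (min_le_right _ _)
      rw [le_div_iff₀ (by positivity)] at this
      linarith
  have hev := s.eventually_exists_icc C₁ C₂ (ε := ε) (β := β) (c₀ := c₀) (c₁ := cW + cY + cWY)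
    (ρ := ρ) (χ := χ) ha₁0 ha₂0 hε0 hβ0 hβ1 hc₀ hY (fun w => (hcW w).trans (by linarith))
    (fun y => (hcY y).trans (by linarith)) (fun a => (hcWY a).trans (by linarith))
    (by rw [hL]; linarith) hρ0 hχ0 (by linarith) (by linarith)
  have p1 : 0 < (1 - 6 * β) * χ - r * (N * S) := by
    have h1 := mul_le_mul_of_nonneg_left hχL (show 0 ≤ 1 - 6 * β by linarith)
    have h2 := mul_lt_mul_of_pos_right hβr (show 0 < N * S by linarith)
    linarith
  have p2 : 0 < (δ - 6 * β) * χ := mul_pos (by linarith) hχ0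
  obtain ⟨k, ⟨Γ, g1, g2, g3, g4, g5, g6, g7⟩, hk1, hk2, hk0⟩ := (hev.and
    (((hmul p1).eventually_gt_atTop ((1 - 6 * β) * (1 - Real.logb 2 (β ^ 2 / 2)))).and
    (((hmul p2).eventually_gt_atTop ((1 - 6 * β) * (1 - Real.logb 2 (β ^ 2 / 2)))).and
    (Filter.eventually_gt_atTop 0)))).exists
  have hk0' : (0 : ℝ) < k := by exact_mod_cast hk0
  have hlen : (Γ.n₁ : ℝ) + Γ.n₂ = k * (N * S) := by
    rw [g2, g3, ← hL]
    push_cast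
    ring
  have hcond : r * (k * (N * S)) < condEnt Γ.runLaw Γ.key Γ.viewE := by linarith
  have hcond0 : 0 < condEnt Γ.runLaw Γ.key Γ.viewE :=
    lt_of_le_of_lt (mul_nonneg hr0 (mul_nonneg hk0'.le (by linarith))) hcond
  refine ⟨Γ, by linarith, ?_, by linarith, fun _ => ?_⟩
  · refine lt_of_le_of_lt hrR ?_
    rw [hlen, lt_div_iff₀ (mul_pos hk0' (by linarith))]
    linarith
  · rw [lt_div_iff₀ (hcond0.trans_le g6)]
    rcases le_total (1 - δ) 0 with h1 | h1
    · exact lt_of_le_of_lt (mul_nonpos_of_nonpos_of_nonneg h1 (hcond0.le.trans g6)) hcond0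
    · linarith [mul_le_mul_of_nonneg_left g7 h1]

/-- Every positive value of the objective is achieved. -/
theorem exists_secure {n₁ n₂ : ℕ} (h : s.Feasible C₁ C₂ n₁ n₂) {R δ : ℝ}
    (hδ : 0 < δ) (hR : R - δ < s.valueICC C₁ C₂ n₁ n₂) (h0 : 0 < s.valueICC C₁ C₂ n₁ n₂) :
    ∃ Γ : ICC C₁ C₂, Γ.ε < δ ∧ Γ.Secure R δ := by
  obtain ⟨m₁, m₂, hm, hf, hv⟩ := h.exists_pos (max_lt hR h0)
  exact exists_secure_of_pos hf hm hδ ((le_max_left _ _).trans_lt hv)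
    ((le_max_right _ _).trans_lt hv)

end Selection
end SKE

namespace SKE

/-! ### Instances with a constant key -/

/-- The point mass. -/
noncomputable def pointMass {α : Type*} [Fintype α] (a : α) : stdSimplex ℝ α :=
  ⟨fun b => ind (a = b), fun _ => ind_nonneg _, sum_ind_eq a⟩

section Constant

variable {α α' β : Type*} [Fintype α] [Fintype α'] [Fintype β]

theorem nearEntropy_one {ε : ℝ} (hε : 0 < ε) (N : ℕ) : NearEntropy ε N 1 0 := by
  simp [NearEntropy, hε]

theorem seqProb_zero (p : α → ℝ) (u : Fin 0 → α) : seqProb p u = 1 := by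
  simp [seqProb]

theorem jointlyTypical_zero {ε : ℝ} (hε : 0 < ε) (p : α × β → ℝ) (u : Fin 0 → α)
    (y : Fin 0 → β) : JointlyTypical ε p u y := by
  simp [JointlyTypical, Typical, NearEntropy, seqProb, hε]

/-- A constant `W₁` and an empty first part reduce bipartite typicality to typicality of `y`. -/
theorem bipJointlyTypical_of_typical {ε : ℝ} (hε : 0 < ε) {d : ℕ} {p : α × α' → ℝ}
    {q : Fin 1 × β → ℝ} (hq1 : ∑ a, q a = 1) (u : Fin 0 → α) (x : Fin 0 → α')
    (t : Fin d → Fin 1) {y : Fin d → β} (h : Typical ε (law q Prod.snd) y) :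
    BipJointlyTypical ε p q u t x y := by
  have e1 : ∀ a, law q Prod.fst a = 1 := fun a => by
    rw [law_prod_fst, ← hq1, Fintype.sum_prod_type, Fin.sum_univ_one, Subsingleton.elim a 0]
  have e2 : ∀ a, law q Prod.snd a.2 = q a := fun a => by
    rw [law_prod_snd, Fin.sum_univ_one]
    exact congrArg q (Prod.ext (Subsingleton.elim _ _) rfl)
  have e3 : entropy (law q Prod.snd) = entropy q := by
    unfold entropy
    rw [Fintype.sum_prod_type, Fin.sum_univ_one]
    exact Finset.sum_congr rfl fun b _ => by rw [← e2 (0, b)]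
  have e4 : seqProb (law q Prod.snd) y = seqProb q fun i => (t i, y i) :=
    Finset.prod_congr rfl fun i _ => e2 (t i, y i)
  have h' := h
  unfold Typical at h'
  rw [e3, e4] at h'
  refine ⟨?_, ?_, ?_⟩ <;> unfold BipTypical
  · have : seqProb (law q Prod.fst) t = 1 := Finset.prod_eq_one fun i _ => e1 _
    rw [this, seqProb_zero]
    have : entropy (law q Prod.fst) = 0 := by simp [entropy, e1]
    rw [this]
    simpa using nearEntropy_one hε (0 + d)
  · rw [seqProb_zero, one_mul, Nat.cast_zero, zero_mul, zero_add, zero_add]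
    exact h
  · rw [seqProb_zero, one_mul, Nat.cast_zero, zero_mul, zero_add, zero_add]
    exact h'

end Constant

variable {X₁ Y₁ Z₁ X₂ Y₂ Z₂ : Type*} [Fintype X₁] [Fintype Y₁] [Fintype Z₁]
  [Fintype X₂] [Fintype Y₂] [Fintype Z₂]

/-- The selection with constant random variables. -/
noncomputable def Selection.const (x₁ : X₁) (x₂ : X₂) : Selection X₁ Y₁ X₂ where
  v := 1
  w₁ := 1
  w₂ := 1
  pX := pointMass x₁
  pV _ := pointMass 0
  pW := pointMass 0
  pXW _ := pointMass x₂

theorem Selection.law_const_WY (x₁ : X₁) (x₂ : X₂) (C₂ : DMBC X₂ Y₂ Z₂) :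
    law (law ((Selection.const (Y₁ := Y₁) x₁ x₂).law₂ C₂) (fun (_, b, _, y, _) => (b, y))) Prod.snd =
      fun y => ∑ z, (C₂ x₂).1 (y, z) := by
  rw [law_law]
  funext y
  rw [law_eq_sum]
  change ∑ ω : Fin 1 × Fin 1 × X₂ × Y₂ × Z₂, ind ((0 : Fin 1 × Fin 1) = (ω.1, ω.2.1)) *
    ind (x₂ = ω.2.2.1) * (C₂ ω.2.2.1).1 ω.2.2.2 * ind (ω.2.2.2.1 = y) = _
  have h1 : ∀ a b : Fin 1, ind ((0 : Fin 1 × Fin 1) = (a, b)) = 1 := fun a b =>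
    ind_true (Subsingleton.elim _ _)
  simp only [Fintype.sum_prod_type, h1, one_mul, Fintype.sum_unique, mul_assoc, ← Finset.mul_sum,
    sum_ind_eq_mul]
  simp only [← Finset.sum_mul, sum_mul_ind_eq]

/-- The instance with constant random variables that uses the responder's channel `n` times. -/
noncomputable def ICC.const (C₁ : DMBC X₁ Y₁ Z₁) (C₂ : DMBC X₂ Y₂ Z₂) (x₁ : X₁) (x₂ : X₂) {ε : ℝ}
    (hε : 0 < ε) {n : ℕ} (hn : 0 < n) : ICC C₁ C₂ where
  toSelection := Selection.const x₁ x₂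
  ε := ε
  ε_pos := hε
  -- Both codebooks consist of the empty word, so decoding is unique. The `n` parity symbols are
  -- there because the length must be positive.
  n₁ := 0
  n₂₁ := 0
  n₂₂ := n
  length_pos := by omega
  codeV := univ
  codeV_typical c _ := by simp [Typical, NearEntropy, seqProb, hε]
  codeW := univ
  codeW_typical c _ := by simp [Typical, NearEntropy, seqProb, hε]
  codeW_nonempty := univ_nonempty
  pick _ := ⟨fun i => i.elim0, mem_univ _⟩
  pick_typical _ _ := jointlyTypical_zero hε _ _ _
  parity _ _ _ := (0 : Fin 1)
  K := 1
  g _ := 0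
  g_equal i j := by rw [Subsingleton.elim i j]

namespace ICC

variable {C₁ : DMBC X₁ Y₁ Z₁} {C₂ : DMBC X₂ Y₂ Z₂} {x₁ : X₁} {x₂ : X₂} {ε : ℝ}

theorem sum_const_runLaw (hε : 0 < ε) {n : ℕ} (hn : 0 < n) (f : (Fin (0 + n) → Y₂) → ℝ) :
    ∑ ω, (ICC.const C₁ C₂ x₁ x₂ hε hn).runLaw ω * f ω.2.2.2.2.2.1 =
      ∑ y, seqProb (fun y => ∑ z, (C₂ x₂).1 (y, z)) y * f y := by
  change ∑ ω : (Fin 0 → X₁) × (Fin 0 → Y₁) × (Fin 0 → Z₁) ×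
    ↥(univ : Finset (Fin 0 → Fin 1)) × (Fin (0 + n) → X₂) × (Fin (0 + n) → Y₂) ×
    (Fin (0 + n) → Z₂), (∏ i : Fin 0, ind (x₁ = ω.1 i) * (C₁ (ω.1 i)).1 (ω.2.1 i, ω.2.2.1 i)) *
      (1 / ((univ : Finset (Fin 0 → Fin 1)).card : ℝ)) *
      (∏ j, ind (x₂ = ω.2.2.2.2.1 j) * (C₂ (ω.2.2.2.2.1 j)).1
        (ω.2.2.2.2.2.1 j, ω.2.2.2.2.2.2 j)) * f ω.2.2.2.2.2.1 = _
  simp only [Fintype.sum_prod_type, Finset.univ_eq_empty, Finset.prod_empty, one_mul,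
    Fintype.sum_unique, Finset.card_univ, Fintype.card_unique, Nat.cast_one, div_one]
  rw [Finset.sum_const, Finset.card_univ, Fintype.card_coe, Finset.card_univ, Fintype.card_unique,
    one_smul, Finset.sum_comm]
  refine Finset.sum_congr rfl fun y _ => ?_
  simp only [← Finset.sum_mul]
  rw [sum_sum_prod_pi fun j a z => ind (x₂ = a) * (C₂ a).1 (y j, z)]
  simp only [← Finset.mul_sum, sum_ind_eq_mul]
  rfl

/-- The key is constant, so the rate bound is `R - δ < 0` and secrecy is void. A NULL of the decoder
can only come from an atypical output, which is rare for large `n`. -/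
theorem exists_secure_of_nonpos [Nonempty X₁] [Nonempty X₂] (C₁ : DMBC X₁ Y₁ Z₁)
    (C₂ : DMBC X₂ Y₂ Z₂) {R δ : ℝ} (hR : R ≤ 0) (hδ : 0 < δ) :
    ∃ Γ : ICC C₁ C₂, Γ.ε < δ ∧ Γ.Secure R δ := by
  obtain ⟨x₁⟩ := ‹Nonempty X₁›
  obtain ⟨x₂⟩ := ‹Nonempty X₂›
  set p : Y₂ → ℝ := fun y => ∑ z, (C₂ x₂).1 (y, z) with hp
  have hp0 : ∀ y, 0 ≤ p y := fun y => Finset.sum_nonneg fun _ _ => stdSimplex_nonneg _ _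
  have hp1 : ∑ y, p y = 1 := by
    rw [← stdSimplex_sum (C₂ x₂), Fintype.sum_prod_type]
  obtain ⟨c, hc, h⟩ := exists_sum_not_typical_le hp0 hp1 (half_pos hδ)
  obtain ⟨n, hn, hcn⟩ := ((Filter.eventually_gt_atTop 0).and
    ((tendsto_const_div_atTop_nhds_zero_nat c).eventually (gt_mem_nhds hδ))).exists
  set Γ := ICC.const C₁ C₂ x₁ x₂ (half_pos hδ) hn with hΓ
  have hP1 : ∑ ω, Γ.runLaw ω = 1 := by
    have := sum_const_runLaw (C₁ := C₁) (C₂ := C₂) (x₁ := x₁) (x₂ := x₂) (half_pos hδ) hn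
      fun _ => 1
    simp only [mul_one] at this
    rw [this]
    exact sum_seqProb p hp1 _
  have hent : ent Γ.runLaw Γ.key = 0 :=
    have : Subsingleton (Fin Γ.K) := inferInstanceAs (Subsingleton (Fin 1))
    ent_const hP1 _
  refine ⟨Γ, half_lt_self hδ, ?_, ?_, fun h0 => absurd hent h0⟩
  · rw [hent, zero_div]
    linarith
  · rw [prob_eq_sum]
    have hle : ∑ ω, Γ.runLaw ω * ind (Γ.PickFails ω ∨ Γ.keyEstimate ω ≠ some (Γ.key ω)) ≤
        ∑ ω : Γ.Outcome, Γ.runLaw ω * ind (¬ Typical (δ / 2) p ω.2.2.2.2.2.1) := by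
      refine Finset.sum_le_sum fun ω _ => mul_le_mul_of_nonneg_left (ind_mono fun herr ht => ?_)
        (mul_nonneg (mul_nonneg (Finset.prod_nonneg fun _ _ => mul_nonneg (stdSimplex_nonneg _ _)
          (stdSimplex_nonneg _ _)) (by positivity)) (Finset.prod_nonneg fun _ _ =>
            mul_nonneg (stdSimplex_nonneg _ _) (stdSimplex_nonneg _ _)))
      obtain ⟨x, y₁, z₁, w, x', y, z⟩ := ω
      refine herr.elim (fun hp => hp ⟨⟨fun i => i.elim0, mem_univ _⟩, ?_⟩) (fun hk => hk ?_)
      · exact jointlyTypical_zero (half_pos hδ) _ _ _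
      · have : Subsingleton (Γ.codeV × Γ.codeW) :=
          inferInstanceAs (Subsingleton (↥(univ : Finset (Fin 0 → Fin 1)) ×
            ↥(univ : Finset (Fin 0 → Fin 1))))
        have hd : Γ.dec x y = some (Γ.pick y₁, w) := Γ.dec_eq_some (by
          refine bipJointlyTypical_of_typical (half_pos hδ) ?_ _ _ _ ?_
          · exact (congrArg (fun q => ∑ a, q a) (Γ.law_law₂_WY C₂)).trans (Γ.sum_lawWY C₂)
          · exact (Selection.law_const_WY (Y₁ := Y₁) x₁ x₂ C₂).symm ▸ ht)
          fun _ _ => Subsingleton.elim _ _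
        exact congrArg (Option.map Γ.g) hd
    refine lt_of_le_of_lt (hle.trans (le_of_eq_of_le (sum_const_runLaw (half_pos hδ) hn
      fun y => ind (¬ Typical (δ / 2) p y)) ?_)) hcn
    exact (h (0 + n) (by omega)).trans_eq (by rw [Nat.zero_add])

end ICC
end SKE

namespace SKE

/-! ### The rates under secrecy potential -/

section Rates

variable {X₁ Y₁ Z₁ X₂ Y₂ Z₂ : Type*} [Fintype X₁] [Fintype Y₁] [Fintype Z₁]
  [Fintype X₂] [Fintype Y₂] [Fintype Z₂]

namespace Selection

variable (s : Selection X₁ Y₁ X₂) (C₁ : DMBC X₁ Y₁ Z₁) (C₂ : DMBC X₂ Y₂ Z₂)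

theorem valueICC_le_valueL (n₁ n₂ : ℕ) : s.valueICC C₁ C₂ n₁ n₂ ≤ s.valueL C₁ C₂ n₁ n₂ := by
  unfold valueICC valueL
  gcongr
  exact le_max_right _ _

theorem valueICC_eq_valueL (h : 0 ≤ s.Rs₂ C₂) (n₁ n₂ : ℕ) :
    s.valueICC C₁ C₂ n₁ n₂ = s.valueL C₁ C₂ n₁ n₂ := by
  rw [valueICC, valueL, max_eq_right h]

end Selection

variable {C₁ : DMBC X₁ Y₁ Z₁} {C₂ : DMBC X₂ Y₂ Z₂}

/-- Above the threshold `r` both sets of values contain the same numbers, and each ICC value is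
dominated by an `L`-value. -/
theorem iccRate_eq_lowerBound (h : HasSecrecyPotential C₁ C₂) :
    iccRate C₁ C₂ = lowerBound C₁ C₂ := by
  obtain ⟨r, hr, hpot⟩ := h
  unfold lowerBound at hr
  unfold iccRate lowerBound
  set SL := {r | ∃ (s : Selection X₁ Y₁ X₂) (n₁ n₂ : ℕ),
    s.Feasible C₁ C₂ n₁ n₂ ∧ r = s.valueL C₁ C₂ n₁ n₂} with hSL
  set SI := {r | ∃ (s : Selection X₁ Y₁ X₂) (n₁ n₂ : ℕ),
    s.Feasible C₁ C₂ n₁ n₂ ∧ r = s.valueICC C₁ C₂ n₁ n₂} with hSI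
  have hIL : ∀ x ∈ SI, ∃ y ∈ SL, x ≤ y := by
    rintro _ ⟨s, n₁, n₂, hf, rfl⟩
    exact ⟨_, ⟨s, n₁, n₂, hf, rfl⟩, s.valueICC_le_valueL C₁ C₂ n₁ n₂⟩
  have hLI : ∀ y ∈ SL, r < y → y ∈ SI := by
    rintro _ ⟨s, n₁, n₂, hf, rfl⟩ hlt
    have h0 : 0 ≤ s.Rs₂ C₂ := by
      by_contra! hneg
      exact absurd (hpot s n₁ n₂ hf hneg) (not_le.mpr hlt)
    exact ⟨s, n₁, n₂, hf, (s.valueICC_eq_valueL C₁ C₂ h0 n₁ n₂).symm⟩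
  rcases SL.eq_empty_or_nonempty with he | hne
  · have : SI = ∅ := by
      refine Set.eq_empty_iff_forall_notMem.mpr fun x hx => ?_
      obtain ⟨y, hy, -⟩ := hIL x hx
      rw [he] at hy
      exact hy
    rw [this, he]
  by_cases hb : BddAbove SL
  · obtain ⟨y₀, hy₀, hry₀⟩ := exists_lt_of_lt_csSup hne hr
    have hbI : BddAbove SI := by
      obtain ⟨M, hM⟩ := hb
      refine ⟨M, fun x hx => ?_⟩
      obtain ⟨y, hy, hxy⟩ := hIL x hx
      exact hxy.trans (hM hy)
    refine le_antisymm (csSup_le ⟨y₀, hLI y₀ hy₀ hry₀⟩ fun x hx => ?_) (le_of_forall_lt fun b hlt => ?_)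
    · obtain ⟨y, hy, hxy⟩ := hIL x hx
      exact hxy.trans (le_csSup hb hy)
    · obtain ⟨y, hy, hby⟩ := exists_lt_of_lt_csSup hne (max_lt hlt hr)
      exact ((le_max_left _ _).trans_lt hby).trans_le
        (le_csSup hbI (hLI y hy ((le_max_right _ _).trans_lt hby)))
  -- If one set is unbounded so is the other, and both suprema take the default value `0`.
  · have hbI : ¬ BddAbove SI := by
      rintro ⟨M, hM⟩
      refine hb ⟨max M r, fun y hy => ?_⟩
      by_contra! hlt
      exact absurd (hM (hLI y hy ((le_max_right _ _).trans_lt hlt)))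
        (not_le.mpr ((le_max_left _ _).trans_lt hlt))
    rw [Real.sSup_of_not_bddAbove hb, Real.sSup_of_not_bddAbove hbI]

/-- A value close to `L` exceeds `r`, so its choice has `Rs₂ ≥ 0` and it is a value of the ICC
objective; being positive, it is achieved. -/
theorem HasSecrecyPotential.exists_secure (h : HasSecrecyPotential C₁ C₂)
    (h0 : 0 < lowerBound C₁ C₂) {δ : ℝ} (hδ : 0 < δ) :
    ∃ Γ : ICC C₁ C₂, Γ.ε < δ ∧ Γ.Secure (lowerBound C₁ C₂) δ := by
  obtain ⟨r, hr, hpot⟩ := h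
  have hne : {r | ∃ (s : Selection X₁ Y₁ X₂) (n₁ n₂ : ℕ),
      s.Feasible C₁ C₂ n₁ n₂ ∧ r = s.valueL C₁ C₂ n₁ n₂}.Nonempty := by
    rw [Set.nonempty_iff_ne_empty]
    intro he
    rw [lowerBound, he, Real.sSup_empty] at h0
    exact lt_irrefl _ h0
  obtain ⟨_, ⟨s, n₁, n₂, hf, rfl⟩, hlt⟩ := exists_lt_of_lt_csSup hne
    (max_lt hr (max_lt h0 (sub_lt_self (lowerBound C₁ C₂) hδ)))
  have hs : 0 ≤ s.Rs₂ C₂ := by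
    by_contra! hneg
    exact absurd (hpot s n₁ n₂ hf hneg) (not_le.mpr ((le_max_left _ _).trans_lt hlt))
  rw [← s.valueICC_eq_valueL C₁ C₂ hs] at hlt
  have h2 := (le_max_right _ _).trans_lt hlt
  exact Selection.exists_secure hf hδ ((le_max_right _ _).trans_lt h2)
    ((le_max_left _ _).trans_lt h2)

end Rates

end SKE

theorem corollary1 {Xf Yf Zf Xb Yb Zb : Type*}
    [Fintype Xf] [Fintype Yf] [Fintype Zf] [Fintype Xb] [Fintype Yb] [Fintype Zb]
    [Nonempty Xf] [Nonempty Xb]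
    (Cf : SKE.DMBC Xf Yf Zf) (Cb : SKE.DMBC Xb Yb Zb)
    (hb : SKE.HasSecrecyPotential Cf Cb) (hf : SKE.HasSecrecyPotential Cb Cf) :
    SKE.iccRate Cf Cb = SKE.lowerBound Cf Cb ∧
    SKE.iccRate Cb Cf = SKE.lowerBound Cb Cf ∧
    SKE.ICCAchieves Cf Cb (max (SKE.lowerBound Cf Cb) (SKE.lowerBound Cb Cf)) := by
  refine ⟨SKE.iccRate_eq_lowerBound hb, SKE.iccRate_eq_lowerBound hf, fun δ hδ => ?_⟩
  -- Random coding needs a positive value; a maximum that is not positive is met by a constant key.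
  rcases le_or_gt (max (SKE.lowerBound Cf Cb) (SKE.lowerBound Cb Cf)) 0 with h0 | h0
  · exact Or.inl (SKE.ICC.exists_secure_of_nonpos Cf Cb h0 hδ)
  rcases le_total (SKE.lowerBound Cb Cf) (SKE.lowerBound Cf Cb) with h | h
  · rw [max_eq_left h] at h0 ⊢
    exact Or.inl (hb.exists_secure h0 hδ)
  · rw [max_eq_right h] at h0 ⊢
    exact Or.inr (hf.exists_secure h0 hδ)
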